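/- Let $\alpha\in(1,3/2)$, $\beta>0$ and $b_N=2^{(2-\alpha)N}$. The Dyson hierarchical Ising spin glass on the Nishimori line has spins $\sigma_i=\pm1$, $1\le i\le 2^N$, and the Hamiltonian defined recursively by $H_0=0$ and $$H_N(\sigma)=H_{N-1}^1(\sigma_1,\dots,\sigma_{2^{N-1}})+H_{N-1}^2(\sigma_{2^{N-1}+1},\dots,\sigma_{2^N})-\sum_{i,j=1}^{2^N}J^{(N)}_{ij}\sigma_i\sigma_j ,$$ where $H^1_{N-1},H^2_{N-1}$ are copies of the model on the two half blocks with independent couplings, and all couplings are independent Gaussian variables, $J^{(N)}_{ij}\sim\mathcal N\big(\beta b_N/4^{N},\,b_N/4^{N}\big)$. Let $\langle\cdot\rangle_N$ be the Gibbs average with weights proportional to $e^{-\beta H_N}$ and $\mathbb E$ the expectation over the couplings. For $0\le p\le N$ and $1\le r\le 2^{N-p}$ put $S_{p,r}=\sum_{j=(r-1)2^p+1}^{r2^p}\sigma_j$ and $f_N(p)=4^{-p}\,\mathbb E[\langle S_{p,r}^2\rangle_N]$. If $\beta\ge 2^{(\alpha-2)/2}$, then $f_N(p)$ does not depend on $r$,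 the limits $f(p)=\lim_{N\to\infty}f_N(p)$ and $m^2=\lim_{p\to\infty}f(p)$ exist, and, with $R=2/(2^\alpha-2)$, $$\begin{aligned} m^2\ \ge\ &\frac12+\frac12\,\mathbb E[\langle\sigma_1\sigma_2\rangle_1]-\frac{2^{2\alpha-1}}{\beta^2(4-2^\alpha)}(1+\log\beta)-\frac{4^{\alpha-1}\big(2^\alpha(\alpha-4)-8(\alpha-3)\big)\log 2}{\beta^2(4-2^\alpha)^2}\\ &-\frac{2^{2\alpha-3/2}\big(2^\alpha(\alpha-4)-2^{5/2}(\alpha-3)\big)R^{1/2}\log 2}{\beta(2^{3/2}-2^\alpha)^2}-\frac{4^\alpha R^{1/2}\log\big(\beta+\beta\sqrt{2\pi e}\big)}{\beta(4-2^{\alpha+1/2})}. \end{aligned}$$ In particular there is long-range order at sufficiently low temperature: there is $\beta_0$ (depending on $\alpha$) such that $m^2>0$ for all $\beta\ge\beta_0$. Moreover $m^2\to1$ as $\beta\to\infty$. -/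

import Mathlib

open Filter Topology

noncomputable section

namespace DysonNishimori

/-- The sequence `b_N = 2 ^ ((2 - α) N)`. -/
def b (α : ℝ) (N : ℕ) : ℝ := (2 : ℝ) ^ ((2 - α) * (N : ℝ))

/-- A realization of the couplings: `J (p, i, j)` is the level-`p` coupling `J_{ij}^{(p)}` of the
ordered pair of sites `(i, j)`. Distinct blocks of the same level use distinct pairs `(i, j)`. -/
abbrev Disorder : Type := ℕ × ℕ × ℕ → ℝ

/-- The joint law of the couplings: independent Gaussians, `J_{ij}^{(p)}` having mean
`β b_p / 2 ^ (2 p)` and variance `b_p / 2 ^ (2 p)`. -/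
def disorderLaw (α β : ℝ) : MeasureTheory.Measure Disorder :=
  MeasureTheory.Measure.infinitePi fun e : ℕ × ℕ × ℕ =>
    ProbabilityTheory.gaussianReal (β * b α e.1 / 2 ^ (2 * e.1))
      (Real.toNNReal (b α e.1 / 2 ^ (2 * e.1)))

/-- The Hamiltonian of the hierarchical model on the block of the `2 ^ N` consecutive sites
`a + 1, …, a + 2 ^ N`: the Hamiltonians of the left and of the right half block, and the interaction
of level `N` between all ordered pairs of sites of the block. -/
def blockHamiltonian (J : Disorder) (σ : ℕ → ℝ) : ℕ → ℕ → ℝ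
  | 0, _ => 0
  | N + 1, a =>
      blockHamiltonian J σ N a + blockHamiltonian J σ N (a + 2 ^ N)
        - ∑ i ∈ Finset.Ioc a (a + 2 ^ (N + 1)), ∑ j ∈ Finset.Ioc a (a + 2 ^ (N + 1)),
            J (N + 1, i, j) * σ i * σ j

/-- The Hamiltonian `H_N` of the model with sites `1, …, 2 ^ N`. -/
def hamiltonian (J : Disorder) (N : ℕ) (σ : ℕ → ℝ) : ℝ := blockHamiltonian J σ N 0

/-- Configurations of `±1` spins on the sites `1, …, 2 ^ N`. -/
abbrev Config (N : ℕ) : Type := ↥(Finset.Ioc 0 (2 ^ N)) → ℤˣ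

/-- The value `σ_i ∈ {1, -1}` of the spin at a site `i ∈ {1, …, 2 ^ N}`
(`0` at labels that are not sites). -/
def Config.spin {N : ℕ} (s : Config N) (i : ℕ) : ℝ :=
  if h : i ∈ Finset.Ioc 0 (2 ^ N) then (((s ⟨i, h⟩ : ℤˣ) : ℤ) : ℝ) else 0

/-- The thermal average `⟨F⟩_N` at inverse temperature `β` for the couplings `J`. -/
def thermalAverage (β : ℝ) (N : ℕ) (J : Disorder) (F : (ℕ → ℝ) → ℝ) : ℝ :=
  (∑ s : Config N, F s.spin * Real.exp (-β * hamiltonian J N s.spin)) /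
    ∑ s : Config N, Real.exp (-β * hamiltonian J N s.spin)

/-- The quenched average `𝔼[⟨F⟩_N]` on the Nishimori line. -/
def quenchedAverage (α β : ℝ) (N : ℕ) (F : (ℕ → ℝ) → ℝ) : ℝ :=
  ∫ J, thermalAverage β N J F ∂(disorderLaw α β)

/-- The block spin `S_{p,r} = ∑ σ_j` over `(r - 1) 2 ^ p + 1 ≤ j ≤ r 2 ^ p`, for `1 ≤ r`. -/
def blockSpin (p r : ℕ) (σ : ℕ → ℝ) : ℝ :=
  ∑ j ∈ Finset.Ioc ((r - 1) * 2 ^ p) (r * 2 ^ p), σ j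

/-- `𝔼[⟨S_{p,r}²⟩_N] / 2 ^ (2 p)`, for `p ≤ N` and `1 ≤ r ≤ 2 ^ (N - p)`. -/
def blockOrder (α β : ℝ) (N p r : ℕ) : ℝ :=
  1 / 2 ^ (2 * p) * quenchedAverage α β N fun σ => blockSpin p r σ ^ 2

/-- `f_N(p)`, computed in the first block. -/
def f (α β : ℝ) (N p : ℕ) : ℝ := blockOrder α β N p 1

/-- `f(p) = lim_{N → ∞} f_N(p)`. -/
def fLim (α β : ℝ) (p : ℕ) : ℝ := limUnder atTop fun N => f α β N p

/-- The long-range order parameter `m² = lim_{p → ∞} f(p)`. -/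
def mSq (α β : ℝ) : ℝ := limUnder atTop fun p => fLim α β p

/-- The constant `R = 2 / (2 ^ α - 2)`. -/
def R (α : ℝ) : ℝ := 2 / ((2 : ℝ) ^ α - 2)

end DysonNishimori

end

/-!
On the Nishimori line the mean and the variance of each coupling `β J` agree; call the common value
its signal-to-noise ratio. The proof treats general spin systems whose configurations form a finite
group `Ω` and whose couplings multiply characters of `Ω` with values `±1`; gauge symmetry is then
translation in `Ω`.

Shifting a Gaussian of variance `τ` by `τ` multiplies its law by a Boltzmann weight. Averaging over
gauges gives the Nishimori identity `𝔼⟨y⟩² = 𝔼⟨y⟩`, the square standing inside the expectation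
(`integral_gibbs_sq`), and the fact that the averages `𝔼⟨y⟩` increase with the signal-to-noise ratios
(`avg_mono`). So correlations increase when couplings are added (`avg_le_avg`). This yields the
monotonicity of `f_N(p)` in `N`, hence its limit, and it also shows that `𝔼 log Z` is convex in the
signal-to-noise ratios, with derivative `(1 + 𝔼⟨y⟩) / 2` (`freeEnergy_sub_le`,
`le_freeEnergy_sub`).

The heart of the proof is a comparison of two blocks, coupled by ratio `T` on all pairs of sites, with
two independent blocks, each with ratio `T` on all of its own pairs (`sum_avg_block_le`). By convexity,
the gain of free energy by coupling the blocks is at most `T` times the sum of the final correlations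
between them, up to a constant; the gain by the inner couplings is at least `T` times the sum of the
initial correlations within a block, up to the same constant. The former gain is at least the latter up
to a small error. Indeed, restrict to pairs of configurations with nearly the same total spin. On these,
Guerra's interpolation shows that joining the blocks gives the larger free energy
(`integral_logZ_subtype_sub_le`). For independent blocks the restriction costs little, because the
restricted free energies of the two blocks have the same law and concentrate
(`two_mul_freeEnergy_le`); the concentration estimate is `integral_exp_sub_integral_le`.

In the hierarchical model the comparison shows that doubling an isolated block of `2 ^ (k - 1)` sites
costs at most `loss α β k` in the order parameter (`blockSum_step`). The losses are summable because
`α < 3 / 2`, and their sum is the explicit expression in the lower bound (`hasSum_loss`). Since `f_N(p)`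
increases with `N`, the order of isolated blocks is a lower bound for `f(p)`, hence for `m²`. At low
temperature all losses vanish and a single pair of spins is fully correlated (`tendsto_lowerBound`).
-/

namespace NishimoriSpin

open MeasureTheory ProbabilityTheory
open scoped NNReal ENNReal

/-! ### Products of Gaussian measures -/

section GaussianProduct

variable {E : Type*} [Fintype E]

/-- The law of independent Gaussian variables with means `m e` and variances `v e`. -/
noncomputable def gaussianPi (m : E → ℝ) (v : E → ℝ≥0) : Measure (E → ℝ) :=
  Measure.pi fun e => gaussianReal (m e) (v e)

instance (m : E → ℝ) (v : E → ℝ≥0) : IsProbabilityMeasure (gaussianPi m v) := by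
  unfold gaussianPi; infer_instance

/-- Measurable functions of at most exponential growth. They form an algebra, and they are
integrable for every product of Gaussian measures. -/
def ExpBounded (F : (E → ℝ) → ℝ) : Prop :=
  Measurable F ∧ ∃ A c : ℝ, ∀ h, |F h| ≤ A * Real.exp (c * ∑ e, |h e|)

lemma ExpBounded.of_bounded {F : (E → ℝ) → ℝ} (hF : Measurable F) (A : ℝ)
    (h : ∀ h, |F h| ≤ A) : ExpBounded F := ⟨hF, A, 0, fun g => by simpa using h g⟩

lemma ExpBounded.exists_pos {F : (E → ℝ) → ℝ} (hF : ExpBounded F) :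
    ∃ A c : ℝ, 0 ≤ A ∧ 0 ≤ c ∧ ∀ h, |F h| ≤ A * Real.exp (c * ∑ e, |h e|) := by
  obtain ⟨_, A, c, h⟩ := hF
  refine ⟨|A|, |c|, abs_nonneg _, abs_nonneg _, fun g => (h g).trans ?_⟩
  have : 0 ≤ ∑ e, |g e| := Finset.sum_nonneg fun _ _ => abs_nonneg _
  gcongr
  · exact le_abs_self A
  · exact le_abs_self c

lemma ExpBounded.add {F G : (E → ℝ) → ℝ} (hF : ExpBounded F) (hG : ExpBounded G) :
    ExpBounded (fun h => F h + G h) := by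
  obtain ⟨A, c, hA, hc, h1⟩ := hF.exists_pos
  obtain ⟨B, d, hB, hd, h2⟩ := hG.exists_pos
  refine ⟨hF.1.add hG.1, A + B, c + d, fun g => (abs_add_le _ _).trans ?_⟩
  have : 0 ≤ ∑ e, |g e| := Finset.sum_nonneg fun _ _ => abs_nonneg _
  rw [add_mul]
  refine add_le_add ((h1 g).trans ?_) ((h2 g).trans ?_) <;> gcongr <;> linarith

lemma ExpBounded.mul {F G : (E → ℝ) → ℝ} (hF : ExpBounded F) (hG : ExpBounded G) :
    ExpBounded (fun h => F h * G h) := by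
  obtain ⟨A, c, hA, hc, h1⟩ := hF.exists_pos
  obtain ⟨B, d, hB, hd, h2⟩ := hG.exists_pos
  refine ⟨hF.1.mul hG.1, A * B, c + d, fun g => ?_⟩
  rw [abs_mul, add_mul, Real.exp_add]
  calc _ ≤ (A * Real.exp (c * ∑ e, |g e|)) * (B * Real.exp (d * ∑ e, |g e|)) :=
        mul_le_mul (h1 g) (h2 g) (abs_nonneg _) (by positivity)
    _ = _ := by ring

lemma ExpBounded.const (a : ℝ) : ExpBounded (fun _ : E → ℝ => a) :=
  .of_bounded measurable_const |a| fun _ => le_rfl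

lemma ExpBounded.const_mul {F : (E → ℝ) → ℝ} (hF : ExpBounded F) (a : ℝ) :
    ExpBounded (fun h => a * F h) := (ExpBounded.const a).mul hF

lemma ExpBounded.neg {F : (E → ℝ) → ℝ} (hF : ExpBounded F) : ExpBounded (fun h => -F h) := by
  simpa using hF.const_mul (-1)

lemma ExpBounded.sub {F G : (E → ℝ) → ℝ} (hF : ExpBounded F) (hG : ExpBounded G) :
    ExpBounded (fun h => F h - G h) := by
  simpa [sub_eq_add_neg] using hF.add hG.neg

lemma ExpBounded.sum {ι : Type*} (s : Finset ι) {F : ι → (E → ℝ) → ℝ}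
    (hF : ∀ i ∈ s, ExpBounded (F i)) : ExpBounded (fun h => ∑ i ∈ s, F i h) := by
  classical
  induction s using Finset.induction_on with
  | empty => simpa using ExpBounded.const (E := E) 0
  | insert i s hi ih =>
    simp only [Finset.sum_insert hi]
    exact (hF i (by simp)).add (ih fun j hj => hF j (by simp [hj]))

lemma integral_of_measurePreserving {α β : Type*} {mα : MeasurableSpace α}
    {mβ : MeasurableSpace β} {μ : Measure α} {ν : Measure β} {φ : α → β}
    (hp : MeasurePreserving φ μ ν) {F : β → ℝ} (hF : Measurable F) :
    ∫ y, F y ∂ν = ∫ x, F (φ x) ∂μ := by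
  rw [← hp.map_eq]
  exact integral_map hp.measurable.aemeasurable hF.aestronglyMeasurable

lemma abs_le_sum_abs (h : E → ℝ) (e : E) : |h e| ≤ ∑ e, |h e| :=
  Finset.single_le_sum (f := fun e => |h e|) (fun _ _ => abs_nonneg _) (Finset.mem_univ e)

/-- Exponentials of functions of at most linear growth. -/
lemma ExpBounded.exp {F : (E → ℝ) → ℝ} (hF : Measurable F) (A c : ℝ)
    (h : ∀ h, F h ≤ A + c * ∑ e, |h e|) : ExpBounded (fun h => Real.exp (F h)) := by
  refine ⟨hF.exp, Real.exp A, c, fun g => ?_⟩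
  rw [Real.abs_exp, ← Real.exp_add]
  exact Real.exp_le_exp.2 (h g)

lemma ExpBounded.of_linear {F : (E → ℝ) → ℝ} (hF : Measurable F) (A c : ℝ)
    (h : ∀ h, |F h| ≤ A + c * ∑ e, |h e|) : ExpBounded F := by
  refine ⟨hF, Real.exp A, c, fun g => ?_⟩
  rw [← Real.exp_add]
  exact (h g).trans ((by linarith [Real.add_one_le_exp (A + c * ∑ e, |g e|)]))

lemma ExpBounded.eval (e : E) : ExpBounded (fun h : E → ℝ => h e) :=
  .of_linear (measurable_pi_apply e) 0 1 fun h => by simpa using abs_le_sum_abs h e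

lemma ExpBounded.integrable {F : (E → ℝ) → ℝ} (hF : ExpBounded F) (m : E → ℝ) (v : E → ℝ≥0) :
    Integrable F (gaussianPi m v) := by
  obtain ⟨A, c, hA, hc, h1⟩ := hF.exists_pos
  have h2 : Integrable (fun h : E → ℝ => A * ∏ e, Real.exp (c * |h e|)) (gaussianPi m v) := by
    refine Integrable.const_mul ?_ A
    refine Integrable.fintype_prod (f := fun _ x => Real.exp (c * |x|)) fun e => ?_
    exact integrable_exp_mul_abs (integrable_exp_mul_gaussianReal c)
      (by simpa using integrable_exp_mul_gaussianReal (-c))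
  refine h2.mono' hF.1.aestronglyMeasurable (ae_of_all _ fun g => ?_)
  rw [Real.norm_eq_abs, ← Real.exp_sum, ← Finset.mul_sum]
  exact h1 g

end GaussianProduct

/-! ### Resampling one coordinate, and Gaussian integration by parts -/

section Resampling

variable {E : Type*} [Fintype E] [DecidableEq E]

lemma measurePreserving_update (μ : E → Measure ℝ) [∀ e, IsProbabilityMeasure (μ e)] (e : E) :
    MeasurePreserving (fun p : (E → ℝ) × ℝ => Function.update p.1 e p.2)
      ((Measure.pi μ).prod (μ e)) (Measure.pi μ) := by
  have hm : Measurable (fun p : (E → ℝ) × ℝ => Function.update p.1 e p.2) := by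
    rw [measurable_pi_iff]
    intro e'
    by_cases h : e' = e
    · subst h; simpa using measurable_snd
    · simp only [Function.update_of_ne h]; fun_prop
  refine ⟨hm, (Measure.pi_eq fun s hs => ?_).symm⟩
  rw [Measure.map_apply hm (MeasurableSet.univ_pi hs)]
  have : (fun p : (E → ℝ) × ℝ => Function.update p.1 e p.2) ⁻¹' Set.univ.pi s
      = (Set.univ.pi (Function.update s e Set.univ)) ×ˢ s e := by
    ext ⟨g, z⟩
    simp only [Set.mem_preimage, Set.mem_pi, Set.mem_univ, true_implies, Set.mem_prod]
    constructor
    · intro h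
      refine ⟨fun i => ?_, by simpa using h e⟩
      by_cases hi : i = e
      · subst hi; simp
      · simpa [hi] using h i
    · rintro ⟨h1, h2⟩ i
      by_cases hi : i = e
      · subst hi; simpa using h2
      · simpa [hi] using h1 i
  rw [this, Measure.prod_prod, Measure.pi_pi,
    ← Finset.mul_prod_erase _ (fun i => μ i (s i)) (Finset.mem_univ e),
    ← Finset.mul_prod_erase _ _ (Finset.mem_univ e), mul_comm]
  simp only [Function.update_self, measure_univ, one_mul]
  congr 1
  refine Finset.prod_congr rfl fun i hi => ?_
  rw [Function.update_of_ne (Finset.ne_of_mem_erase hi)]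

lemma integral_update (m : E → ℝ) (v : E → ℝ≥0) (e : E) {F : (E → ℝ) → ℝ}
    (hF : Integrable F (gaussianPi m v)) :
    ∫ h, F h ∂gaussianPi m v =
      ∫ h, (∫ z, F (Function.update h e z) ∂gaussianReal (m e) (v e)) ∂gaussianPi m v := by
  have hp := measurePreserving_update (fun e => gaussianReal (m e) (v e)) e
  have h1 : ∫ h, F h ∂gaussianPi m v = ∫ p, F (Function.update p.1 e p.2)
      ∂((gaussianPi m v).prod (gaussianReal (m e) (v e))) := by
    have h := integral_map (f := F) hp.measurable.aemeasurable
      (by rw [hp.map_eq]; exact hF.aestronglyMeasurable)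
    rwa [hp.map_eq] at h
  rw [h1, integral_prod]
  exact hp.integrable_comp_of_integrable hF

/-- Stein's lemma in one dimension. -/
lemma integral_mul_gaussianReal {φ φ' : ℝ → ℝ} (hφ : ∀ x, HasDerivAt φ (φ' x) x) {C : ℝ}
    (h1 : ∀ x, |φ x| ≤ C) (h2 : ∀ x, |φ' x| ≤ C) :
    ∫ x, x * φ x ∂gaussianReal 0 1 = ∫ x, φ' x ∂gaussianReal 0 1 := by
  have hpdf : ∀ x, HasDerivAt (gaussianPDFReal 0 1) (-x * gaussianPDFReal 0 1 x) x := by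
    intro x
    have : gaussianPDFReal 0 1 = fun x => (√(2 * Real.pi * (1 : ℝ≥0)))⁻¹ *
        Real.exp (-(x - 0) ^ 2 / (2 * (1 : ℝ≥0))) := by
      ext; simp [gaussianPDFReal]
    rw [this]
    have h := ((((hasDerivAt_id x).sub_const 0).pow 2).neg.div_const (2 * ((1 : ℝ≥0) : ℝ))).exp
      |>.const_mul (√(2 * Real.pi * (1 : ℝ≥0)))⁻¹
    refine h.congr_deriv ?_
    simp
    ring
  have hφm : Measurable φ := (continuous_iff_continuousAt.2 fun x => (hφ x).continuousAt).measurable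
  have hφ'm : Measurable φ' := by
    have : φ' = deriv φ := funext fun x => (hφ x).deriv.symm
    rw [this]; exact measurable_deriv φ
  have hi1 : Integrable (gaussianPDFReal 0 1) := integrable_gaussianPDFReal 0 1
  have hi2 : Integrable (fun x => x * gaussianPDFReal 0 1 x) := by
    have h := (memLp_id_gaussianReal (μ := 0) (v := 1) 1).integrable (by simp)
    rw [gaussianReal_of_var_ne_zero _ one_ne_zero,
      integrable_withDensity_iff (measurable_gaussianPDF 0 1)
        (ae_of_all _ fun _ => gaussianPDF_lt_top)] at h
    simpa [toReal_gaussianPDF] using h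
  have key := integral_mul_deriv_eq_deriv_mul_of_integrable (u := φ) (v := gaussianPDFReal 0 1)
    (u' := φ') (v' := fun x => -x * gaussianPDFReal 0 1 x) (fun x _ => hφ x) (fun x _ => hpdf x)
    (by
      have := (hi2.neg).bdd_mul (c := C) hφm.aestronglyMeasurable (ae_of_all _ h1)
      simpa [Pi.mul_def, neg_mul] using this)
    (hi1.bdd_mul (c := C) hφ'm.aestronglyMeasurable (ae_of_all _ h2))
    (hi1.bdd_mul (c := C) hφm.aestronglyMeasurable (ae_of_all _ h1))
  rw [integral_gaussianReal_eq_integral_smul one_ne_zero,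
    integral_gaussianReal_eq_integral_smul one_ne_zero]
  simp only [smul_eq_mul]
  rw [← neg_inj] at key
  rw [neg_neg, ← integral_neg] at key
  convert key using 1
  · congr 1; ext x; ring
  · congr 1; ext x; ring

/-- Gaussian integration by parts in one of the coordinates. -/
lemma integral_eval_mul (e : E) {φ φ' : (E → ℝ) → ℝ}
    (hφ : ∀ h x, HasDerivAt (fun z => φ (Function.update h e z)) (φ' (Function.update h e x)) x)
    (hm : Measurable φ) (hm' : Measurable φ') {C : ℝ} (h1 : ∀ h, |φ h| ≤ C)
    (h2 : ∀ h, |φ' h| ≤ C) :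
    ∫ h, h e * φ h ∂gaussianPi (fun _ : E => 0) (fun _ => 1) =
      ∫ h, φ' h ∂gaussianPi (fun _ : E => 0) (fun _ => 1) := by
  rw [integral_update _ _ e ((((ExpBounded.eval e).mul (.of_bounded hm C h1))).integrable _ _),
    integral_update _ _ e ((ExpBounded.of_bounded hm' C h2).integrable _ _)]
  congr 1
  ext h
  simp only [Function.update_self]
  exact integral_mul_gaussianReal (hφ h) (fun x => h1 _) (fun x => h2 _)

end Resampling

/-! ### Concentration of Lipschitz functions of independent Gaussian variables -/

section Concentration

/-- One-dimensional sub-Gaussian bound. By Jensen's inequality the mean may be replaced by an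
independent copy, and then the Lipschitz function by the identity. -/
lemma integral_exp_sub_integral_gaussianReal_le (m : ℝ) (v : ℝ≥0) {φ : ℝ → ℝ}
    (hφ : ∀ x y, |φ x - φ y| ≤ |x - y|) (t : ℝ) :
    ∫ x, Real.exp (t * (φ x - ∫ y, φ y ∂gaussianReal m v)) ∂gaussianReal m v
      ≤ Real.exp (t ^ 2 * v) := by
  set μ := gaussianReal m v with hμ
  have hφm : Measurable φ := by
    have : LipschitzWith 1 φ := LipschitzWith.of_dist_le_mul fun x y => by
      simpa [Real.dist_eq] using hφ x y
    exact this.continuous.measurable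
  have hlin : ∀ x, |φ x| ≤ |φ 0| + |x| := fun x => by
    have h1 := hφ x 0
    have h2 := abs_add_le (φ x - φ 0) (φ 0)
    simp only [sub_add_cancel, sub_zero] at h1 h2
    linarith
  have hexpabs : ∀ c : ℝ, Integrable (fun x => Real.exp (c * |x|)) μ := fun c =>
    integrable_exp_mul_abs (integrable_exp_mul_gaussianReal c)
      (by simpa using integrable_exp_mul_gaussianReal (-c))
  have hexp : ∀ c : ℝ, Integrable (fun x => Real.exp (c * φ x)) μ := fun c => by
    refine ((hexpabs |c|).const_mul (Real.exp (|c| * |φ 0|))).mono'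
      (by fun_prop) (ae_of_all _ fun x => ?_)
    rw [Real.norm_eq_abs, Real.abs_exp, ← Real.exp_add, ← mul_add]
    refine Real.exp_le_exp.2 ((le_abs_self _).trans ?_)
    rw [abs_mul]
    exact mul_le_mul_of_nonneg_left (hlin x) (abs_nonneg c)
  have hint : Integrable φ μ := by
    refine ((hexpabs 1).const_mul (Real.exp |φ 0|)).mono'
      hφm.aestronglyMeasurable (ae_of_all _ fun x => ?_)
    rw [Real.norm_eq_abs, ← Real.exp_add, one_mul]
    exact (hlin x).trans (by linarith [Real.add_one_le_exp (|φ 0| + |x|)])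
  have hJ : Real.exp (-t * ∫ y, φ y ∂μ) ≤ ∫ y, Real.exp (-t * φ y) ∂μ := by
    have := convexOn_exp.map_integral_le (μ := μ) (f := fun y => -t * φ y)
      Real.continuous_exp.continuousOn isClosed_univ (by simp) (hint.const_mul _) (hexp _)
    rwa [integral_const_mul] at this
  have h1 : ∫ x, Real.exp (t * (φ x - ∫ y, φ y ∂μ)) ∂μ
      ≤ (∫ x, Real.exp (t * φ x) ∂μ) * ∫ y, Real.exp (-t * φ y) ∂μ := by
    have : ∀ x, Real.exp (t * (φ x - ∫ y, φ y ∂μ))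
        = Real.exp (t * φ x) * Real.exp (-t * ∫ y, φ y ∂μ) := fun x => by
      rw [← Real.exp_add]; ring_nf
    simp_rw [this]
    rw [integral_mul_const]
    exact mul_le_mul_of_nonneg_left hJ (integral_nonneg fun _ => (Real.exp_pos _).le)
  -- Symmetrize over two independent copies: `cosh` is monotone in the absolute value.
  have hI : ∀ c d : ℝ, Integrable (fun p : ℝ × ℝ => Real.exp (c * φ p.1) * Real.exp (d * φ p.2))
      (μ.prod μ) := fun c d => (hexp c).mul_prod (hexp d)
  have hI' : ∀ c d : ℝ, Integrable (fun p : ℝ × ℝ => Real.exp (c * p.1) * Real.exp (d * p.2))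
      (μ.prod μ) := fun c d =>
    (integrable_exp_mul_gaussianReal c).mul_prod (integrable_exp_mul_gaussianReal d)
  have h2 : ∫ p : ℝ × ℝ, (Real.exp (t * φ p.1) * Real.exp (-t * φ p.2)
        + Real.exp (-t * φ p.1) * Real.exp (t * φ p.2)) ∂(μ.prod μ)
      ≤ ∫ p : ℝ × ℝ, (Real.exp (t * p.1) * Real.exp (-t * p.2)
        + Real.exp (-t * p.1) * Real.exp (t * p.2)) ∂(μ.prod μ) := by
    refine integral_mono ((hI _ _).add (hI _ _)) ((hI' _ _).add (hI' _ _)) fun p => ?_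
    have h := Real.cosh_le_cosh.2 (show |t * (φ p.1 - φ p.2)| ≤ |t * (p.1 - p.2)| by
      rw [abs_mul, abs_mul]; exact mul_le_mul_of_nonneg_left (hφ _ _) (abs_nonneg t))
    rw [Real.cosh_eq, Real.cosh_eq] at h
    simp only [← Real.exp_add]
    ring_nf at h ⊢
    linarith
  rw [integral_add (hI _ _) (hI _ _), integral_add (hI' _ _) (hI' _ _)] at h2
  have hp := fun c d : ℝ => integral_prod_mul (μ := μ) (ν := μ) (fun x => Real.exp (c * φ x))
    (fun x => Real.exp (d * φ x))
  have hp' := fun c d : ℝ => integral_prod_mul (μ := μ) (ν := μ) (fun x => Real.exp (c * x))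
    (fun x => Real.exp (d * x))
  have hg : ∀ c : ℝ, ∫ x, Real.exp (c * x) ∂μ = Real.exp (m * c + v * c ^ 2 / 2) := fun c =>
    congrFun mgf_fun_id_gaussianReal c
  rw [hp, hp, hp', hp', hg, hg, ← Real.exp_add, ← Real.exp_add] at h2
  refine h1.trans ?_
  ring_nf at h2 ⊢
  linarith

variable {E : Type*} [Fintype E]

lemma continuous_of_abs_sub_le_sum {F : (E → ℝ) → ℝ}
    (hF : ∀ h k, |F h - F k| ≤ ∑ e, |h e - k e|) : Continuous F := by
  refine (LipschitzWith.of_dist_le_mul (K := (Fintype.card E : ℝ≥0)) fun h k => ?_).continuous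
  rw [Real.dist_eq]
  refine (hF h k).trans ?_
  calc ∑ e, |h e - k e| ≤ ∑ _e : E, dist h k := Finset.sum_le_sum fun e _ => by
        rw [← Real.dist_eq]; exact dist_le_pi_dist h k e
    _ = _ := by simp

lemma ExpBounded.of_lipschitz {F : (E → ℝ) → ℝ}
    (hF : ∀ h k, |F h - F k| ≤ ∑ e, |h e - k e|) : ExpBounded F := by
  refine .of_linear (continuous_of_abs_sub_le_sum hF).measurable |F 0| 1 fun h => ?_
  have h1 := hF h 0
  have h2 := abs_add_le (F h - F 0) (F 0)
  simp only [sub_add_cancel, Pi.zero_apply, sub_zero] at h1 h2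
  linarith

lemma ExpBounded.exp_of_lipschitz {F : (E → ℝ) → ℝ}
    (hF : ∀ h k, |F h - F k| ≤ ∑ e, |h e - k e|) (t c : ℝ) :
    ExpBounded (fun h => Real.exp (t * (F h - c))) := by
  have hm := (continuous_of_abs_sub_le_sum hF).measurable
  refine .exp (by fun_prop) (|t| * (|F 0| + |c|)) |t| fun h => (le_abs_self _).trans ?_
  rw [abs_mul, ← mul_add]
  refine mul_le_mul_of_nonneg_left ?_ (abs_nonneg t)
  have h1 := hF h 0
  have h2 := abs_add_le (F h - F 0) (F 0)
  have h3 := abs_sub (F h) c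
  simp only [sub_add_cancel, Pi.zero_apply, sub_zero] at h1 h2
  linarith

/-- The martingale argument: integrating out one coordinate preserves the Lipschitz bound and costs
one factor of the one-dimensional estimate. -/
lemma integral_exp_le_of_dependsOn [DecidableEq E] (m : E → ℝ) (v : E → ℝ≥0) (t : ℝ)
    (s : Finset E) : ∀ {F : (E → ℝ) → ℝ}, (∀ h k, |F h - F k| ≤ ∑ e, |h e - k e|) →
      DependsOn F (s : Set E) →
      ∫ h, Real.exp (t * (F h - ∫ k, F k ∂gaussianPi m v)) ∂gaussianPi m v
        ≤ Real.exp (t ^ 2 * ∑ e ∈ s, (v e : ℝ)) := by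
  induction s using Finset.induction_on with
  | empty =>
    intro F _ hd
    have hc : ∀ h, F h = F 0 := fun h => hd (by simp)
    have : ∀ h, F h - ∫ k, F k ∂gaussianPi m v = 0 := fun h => by
      simp_rw [hc]
      simp
    simp [this]
  | insert e s he ih =>
    intro F hF hd
    have hupd : ∀ h x y, |F (Function.update h e x) - F (Function.update h e y)| ≤ |x - y| := by
      intro h x y
      refine (hF _ _).trans (le_of_eq ?_)
      rw [Finset.sum_eq_single e]
      · simp
      · intro e' _ h'; simp [h']
      · simp
    have hupd' : ∀ h k x, |F (Function.update h e x) - F (Function.update k e x)|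
        ≤ ∑ e, |h e - k e| := by
      intro h k x
      refine (hF _ _).trans (Finset.sum_le_sum fun e' _ => ?_)
      by_cases h' : e' = e
      · subst h'; simp
      · simp [h']
    set G : (E → ℝ) → ℝ := fun h => ∫ z, F (Function.update h e z) ∂gaussianReal (m e) (v e)
      with hG
    have hFi : ∀ h, Integrable (fun z => F (Function.update h e z)) (gaussianReal (m e) (v e)) := by
      intro h
      have hb : ∀ x, |F (Function.update h e x)| ≤ |F (Function.update h e 0)| + |x| := fun x => by
        have h1 := hupd h x 0
        have h2 := abs_add_le (F (Function.update h e x) - F (Function.update h e 0))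
          (F (Function.update h e 0))
        simp only [sub_add_cancel, sub_zero] at h1 h2
        linarith
      have hid : Integrable (fun x : ℝ => x) (gaussianReal (m e) (v e)) :=
        (memLp_id_gaussianReal (μ := m e) (v := v e) 1).integrable (by simp)
      refine ((integrable_const |F (Function.update h e 0)|).add hid.abs).mono' ?_
        (ae_of_all _ hb)
      have := (continuous_of_abs_sub_le_sum hF).comp
        (continuous_const.update e continuous_id (f := fun _ : ℝ => h))
      exact this.measurable.aestronglyMeasurable
    have hGL : ∀ h k, |G h - G k| ≤ ∑ e, |h e - k e| := by
      intro h k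
      rw [hG, ← integral_sub (hFi h) (hFi k)]
      refine (abs_integral_le_integral_abs).trans ?_
      refine (integral_mono ((hFi h).sub (hFi k)).abs (integrable_const _)
        (fun x => hupd' h k x)).trans ?_
      simp
    have hGd : DependsOn G (s : Set E) := by
      intro h k hhk
      refine integral_congr_ae (ae_of_all _ fun z => ?_)
      refine hd fun i hi => ?_
      by_cases h' : i = e
      · subst h'; simp
      · have : i ∈ s := by simpa [h'] using hi
        simpa [h'] using hhk i this
    have hFG : ∫ k, F k ∂gaussianPi m v = ∫ k, G k ∂gaussianPi m v :=
      integral_update m v e ((ExpBounded.of_lipschitz hF).integrable m v)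
    set c := ∫ k, G k ∂gaussianPi m v with hc
    rw [hFG, integral_update m v e ((ExpBounded.exp_of_lipschitz hF t c).integrable m v)]
    have key : ∀ h, ∫ z, Real.exp (t * (F (Function.update h e z) - c)) ∂gaussianReal (m e) (v e)
        ≤ Real.exp (t * (G h - c)) * Real.exp (t ^ 2 * v e) := by
      intro h
      have h1 : ∀ z, Real.exp (t * (F (Function.update h e z) - c))
          = Real.exp (t * (G h - c)) * Real.exp (t * (F (Function.update h e z) - G h)) := by
        intro z; rw [← Real.exp_add]; ring_nf
      simp_rw [h1]
      rw [integral_const_mul]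
      exact mul_le_mul_of_nonneg_left
        (integral_exp_sub_integral_gaussianReal_le (m e) (v e) (hupd h) t) (Real.exp_pos _).le
    have hint := (ExpBounded.exp_of_lipschitz hGL t c).integrable m v
    calc _ ≤ ∫ h, Real.exp (t * (G h - c)) * Real.exp (t ^ 2 * v e) ∂gaussianPi m v := by
          refine integral_mono_of_nonneg (ae_of_all _ fun h =>
            integral_nonneg fun _ => (Real.exp_pos _).le) (hint.mul_const _) (ae_of_all _ key)
      _ ≤ Real.exp (t ^ 2 * ∑ e ∈ s, (v e : ℝ)) * Real.exp (t ^ 2 * v e) := by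
          rw [integral_mul_const]
          exact mul_le_mul_of_nonneg_right (ih hGL hGd) (Real.exp_pos _).le
      _ = _ := by rw [← Real.exp_add, Finset.sum_insert he]; ring_nf

/-- Sub-Gaussian bound, with twice the optimal variance proxy, for functions that are
`1`-Lipschitz in each coordinate. -/
theorem integral_exp_sub_integral_le (m : E → ℝ) (v : E → ℝ≥0) (t : ℝ) {F : (E → ℝ) → ℝ}
    (hF : ∀ h k, |F h - F k| ≤ ∑ e, |h e - k e|) :
    ∫ h, Real.exp (t * (F h - ∫ k, F k ∂gaussianPi m v)) ∂gaussianPi m v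
      ≤ Real.exp (t ^ 2 * ∑ e, (v e : ℝ)) := by
  classical
  exact integral_exp_le_of_dependsOn m v t Finset.univ hF (fun _ _ h => by
    congr 1; ext i; exact h i (by simp))

end Concentration

/-! ### Finite Gibbs measures -/

section Gibbs

variable {Ω : Type*} [Fintype Ω]

/-- The logarithm of the partition function of the Boltzmann weights `exp (w σ)`. -/
noncomputable def logZ (w : Ω → ℝ) : ℝ := Real.log (∑ σ, Real.exp (w σ))

/-- The Gibbs average of `F` for the Boltzmann weights `exp (w σ)`. -/
noncomputable def gibbs (w F : Ω → ℝ) : ℝ :=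
  (∑ σ, F σ * Real.exp (w σ)) / ∑ σ, Real.exp (w σ)

lemma gibbs_add (w F G : Ω → ℝ) : gibbs w (fun σ => F σ + G σ) = gibbs w F + gibbs w G := by
  simp only [gibbs, add_mul, Finset.sum_add_distrib, add_div]

lemma gibbs_const_mul (w F : Ω → ℝ) (c : ℝ) : gibbs w (fun σ => c * F σ) = c * gibbs w F := by
  simp only [gibbs, mul_assoc, ← Finset.mul_sum, mul_div_assoc]

lemma gibbs_sum {ι : Type*} (s : Finset ι) (w : Ω → ℝ) (F : ι → Ω → ℝ) :
    gibbs w (fun σ => ∑ i ∈ s, F i σ) = ∑ i ∈ s, gibbs w (F i) := by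
  simp only [gibbs, Finset.sum_mul, ← Finset.sum_div]
  rw [Finset.sum_comm]

lemma hasDerivAt_sum_exp {w : ℝ → Ω → ℝ} {w' : Ω → ℝ} {r : ℝ} (F : Ω → ℝ)
    (hw : ∀ σ, HasDerivAt (fun r => w r σ) (w' σ) r) :
    HasDerivAt (fun r => ∑ σ, F σ * Real.exp (w r σ))
      (∑ σ, F σ * w' σ * Real.exp (w r σ)) r := by
  have := HasDerivAt.fun_sum (u := Finset.univ) fun σ _ => ((hw σ).exp.const_mul (F σ))
  refine this.congr_deriv (Finset.sum_congr rfl fun σ _ => by ring)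

variable [Nonempty Ω]

lemma sum_exp_pos (w : Ω → ℝ) : 0 < ∑ σ, Real.exp (w σ) :=
  Finset.sum_pos (fun _ _ => Real.exp_pos _) Finset.univ_nonempty

lemma gibbs_mono (w : Ω → ℝ) {F G : Ω → ℝ} (h : ∀ σ, F σ ≤ G σ) : gibbs w F ≤ gibbs w G := by
  unfold gibbs
  refine div_le_div_of_nonneg_right ?_ (sum_exp_pos w).le
  gcongr with σ
  exact h σ

lemma gibbs_const (w : Ω → ℝ) (c : ℝ) : gibbs w (fun _ => c) = c := by
  unfold gibbs
  rw [← Finset.mul_sum, mul_div_assoc, div_self (sum_exp_pos w).ne', mul_one]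

lemma abs_gibbs_le (w : Ω → ℝ) {F : Ω → ℝ} {C : ℝ} (h : ∀ σ, |F σ| ≤ C) : |gibbs w F| ≤ C := by
  rw [abs_le]
  constructor
  · have := gibbs_mono w (F := fun _ => -C) (G := F) fun σ => (abs_le.1 (h σ)).1
    rwa [gibbs_const] at this
  · have := gibbs_mono w (F := F) (G := fun _ => C) fun σ => (abs_le.1 (h σ)).2
    rwa [gibbs_const] at this

lemma hasDerivAt_logZ {w : ℝ → Ω → ℝ} {w' : Ω → ℝ} {r : ℝ}
    (hw : ∀ σ, HasDerivAt (fun r => w r σ) (w' σ) r) :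
    HasDerivAt (fun r => logZ (w r)) (gibbs (w r) w') r := by
  have h := hasDerivAt_sum_exp (fun _ => 1) hw
  simp only [one_mul] at h
  exact h.log (sum_exp_pos _).ne'

lemma hasDerivAt_gibbs {w : ℝ → Ω → ℝ} {w' : Ω → ℝ} {r : ℝ} (F : Ω → ℝ)
    (hw : ∀ σ, HasDerivAt (fun r => w r σ) (w' σ) r) :
    HasDerivAt (fun r => gibbs (w r) F)
      (gibbs (w r) (fun σ => F σ * w' σ) - gibbs (w r) F * gibbs (w r) w') r := by
  have h := hasDerivAt_sum_exp (fun _ => 1) hw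
  simp only [one_mul] at h
  have hz := (sum_exp_pos (w r)).ne'
  refine ((hasDerivAt_sum_exp F hw).div h hz).congr_deriv ?_
  simp only [gibbs]
  field_simp

lemma logZ_mono {w w' : Ω → ℝ} (h : ∀ σ, w σ ≤ w' σ) : logZ w ≤ logZ w' := by
  unfold logZ
  refine Real.log_le_log (sum_exp_pos w) ?_
  gcongr with σ
  exact h σ

lemma logZ_add_const (w : Ω → ℝ) (c : ℝ) : logZ (fun σ => w σ + c) = logZ w + c := by
  unfold logZ
  simp_rw [Real.exp_add]
  rw [← Finset.sum_mul, Real.log_mul (sum_exp_pos w).ne' (Real.exp_pos _).ne', Real.log_exp]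

lemma abs_logZ_sub_le {w w' : Ω → ℝ} {c : ℝ} (h : ∀ σ, |w σ - w' σ| ≤ c) :
    |logZ w - logZ w'| ≤ c := by
  rw [abs_le]
  constructor
  · have := logZ_mono (w := w') (w' := fun σ => w σ + c) fun σ => by linarith [(abs_le.1 (h σ)).1]
    rw [logZ_add_const] at this
    linarith
  · have := logZ_mono (w := w) (w' := fun σ => w' σ + c) fun σ => by linarith [(abs_le.1 (h σ)).2]
    rw [logZ_add_const] at this
    linarith

end Gibbs

/-! ### The derivative of a quenched free energy along a path of Gaussian energies -/

section Interpolation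

variable {Ω E : Type*} [Fintype Ω]

lemma measurable_logZ {w : (E → ℝ) → Ω → ℝ} (h : ∀ σ, Measurable fun g => w g σ) :
    Measurable fun g => logZ (w g) := by
  unfold logZ; fun_prop

lemma measurable_gibbs {w : (E → ℝ) → Ω → ℝ} (h : ∀ σ, Measurable fun g => w g σ) (F : Ω → ℝ) :
    Measurable fun g => gibbs (w g) F := by
  unfold gibbs; fun_prop

variable [Nonempty Ω] [Fintype E]

lemma expBounded_logZ (A : Ω → ℝ) (B : E → Ω → ℝ) :
    ExpBounded fun g => logZ fun σ => A σ + ∑ e, g e * B e σ := by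
  have hb : ∃ K, ∀ e σ, |B e σ| ≤ K := ⟨‖B‖, fun e σ => by
    rw [← Real.norm_eq_abs]; exact (norm_le_pi_norm (B e) σ).trans (norm_le_pi_norm B e)⟩
  obtain ⟨K, hK⟩ := hb
  refine .of_linear (measurable_logZ fun σ => by fun_prop) |logZ A| K fun g => ?_
  have h := abs_logZ_sub_le (w := fun σ => A σ + ∑ e, g e * B e σ) (w' := A)
    (c := K * ∑ e, |g e|) fun σ => by
      rw [add_sub_cancel_left, Finset.mul_sum]
      refine (Finset.abs_sum_le_sum_abs _ _).trans (Finset.sum_le_sum fun e _ => ?_)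
      rw [abs_mul, mul_comm]
      exact mul_le_mul_of_nonneg_right (hK e σ) (abs_nonneg _)
  have h2 := abs_add_le (logZ (fun σ => A σ + ∑ e, g e * B e σ) - logZ A) (logZ A)
  rw [sub_add_cancel] at h2
  linarith

/-- **Gaussian interpolation.** The derivative of the expected logarithm of a partition function
whose energies are Gaussian with smoothly varying mean and covariance. -/
theorem hasDerivAt_integral_logZ [DecidableEq E] {A A' : ℝ → Ω → ℝ} {B B' : ℝ → E → Ω → ℝ}
    (hA : ∀ r σ, HasDerivAt (fun r => A r σ) (A' r σ) r)
    (hB : ∀ r e σ, HasDerivAt (fun r => B r e σ) (B' r e σ) r)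
    (hA' : Continuous A') (hB' : Continuous B') (r : ℝ) :
    HasDerivAt (fun r => ∫ g, logZ (fun σ => A r σ + ∑ e, g e * B r e σ)
        ∂gaussianPi (fun _ : E => 0) (fun _ => 1))
      (∫ g, (gibbs (fun σ => A r σ + ∑ e, g e * B r e σ) (A' r)
          + ∑ e, (gibbs (fun σ => A r σ + ∑ e, g e * B r e σ) (fun σ => B' r e σ * B r e σ)
            - gibbs (fun σ => A r σ + ∑ e, g e * B r e σ) (B' r e)
              * gibbs (fun σ => A r σ + ∑ e, g e * B r e σ) (B r e)))
        ∂gaussianPi (fun _ : E => 0) (fun _ => 1)) r := by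
  obtain ⟨K₁, hK₁⟩ := (isCompact_Icc (a := r - 1) (b := r + 1)).exists_bound_of_continuousOn
    hA'.continuousOn
  obtain ⟨K₂, hK₂⟩ := (isCompact_Icc (a := r - 1) (b := r + 1)).exists_bound_of_continuousOn
    hB'.continuousOn
  set w : ℝ → (E → ℝ) → Ω → ℝ := fun r g σ => A r σ + ∑ e, g e * B r e σ with hw
  have hwm : ∀ r σ, Measurable fun g => w r g σ := fun r σ => by simp only [hw]; fun_prop
  have hd : ∀ r g, HasDerivAt (fun r => logZ (w r g))
      (gibbs (w r g) (fun σ => A' r σ + ∑ e, g e * B' r e σ)) r := fun r g =>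
    hasDerivAt_logZ fun σ => (hA r σ).add (HasDerivAt.fun_sum fun e _ => (hB r e σ).const_mul _)
  have hbound : ∀ g, ∀ x ∈ Set.Icc (r - 1) (r + 1),
      ‖gibbs (w x g) (fun σ => A' x σ + ∑ e, g e * B' x e σ)‖ ≤ K₁ + ∑ e, |g e| * K₂ := by
    intro g x hx
    refine abs_gibbs_le _ fun σ => (abs_add_le _ _).trans (add_le_add ?_ ?_)
    · exact (norm_le_pi_norm (A' x) σ).trans (hK₁ x hx)
    · refine (Finset.abs_sum_le_sum_abs _ _).trans (Finset.sum_le_sum fun e _ => ?_)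
      rw [abs_mul]
      exact mul_le_mul_of_nonneg_left (((norm_le_pi_norm (B' x e) σ).trans
        (norm_le_pi_norm (B' x) e)).trans (hK₂ x hx)) (abs_nonneg _)
  have hexp : ∀ x, (fun g => gibbs (w x g) (fun σ => A' x σ + ∑ e, g e * B' x e σ))
      = fun g => gibbs (w x g) (A' x) + ∑ e, g e * gibbs (w x g) (B' x e) := by
    intro x; ext g
    rw [gibbs_add, gibbs_sum]
    simp_rw [gibbs_const_mul]
  have hmeas : Measurable (fun g => gibbs (w r g) (fun σ => A' r σ + ∑ e, g e * B' r e σ)) := by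
    rw [hexp]
    have h1 := measurable_gibbs (hwm r) (A' r)
    have h2 := fun e => measurable_gibbs (hwm r) (B' r e)
    fun_prop
  have key := hasDerivAt_integral_of_dominated_loc_of_deriv_le
    (μ := gaussianPi (fun _ : E => 0) (fun _ => 1)) (F := fun r g => logZ (w r g))
    (F' := fun r g => gibbs (w r g) (fun σ => A' r σ + ∑ e, g e * B' r e σ))
    (bound := fun g => K₁ + ∑ e, |g e| * K₂) (x₀ := r)
    (Icc_mem_nhds (show r - 1 < r by linarith) (by linarith))
    (Eventually.of_forall fun x => (measurable_logZ (hwm x)).aestronglyMeasurable)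
    ((expBounded_logZ (A r) (B r)).integrable _ _) hmeas.aestronglyMeasurable
    (ae_of_all _ hbound)
    (((ExpBounded.const K₁).add (ExpBounded.sum _ fun e _ =>
      (ExpBounded.of_linear (F := fun g : E → ℝ => |g e| * K₂) (by fun_prop) 0 |K₂| fun g => by
        rw [abs_mul, abs_abs, mul_comm, zero_add]
        exact mul_le_mul_of_nonneg_left (abs_le_sum_abs g e) (abs_nonneg _)))).integrable _ _)
    (ae_of_all _ fun g x _ => hd x g)
  refine key.2.congr_deriv ?_
  have hbB : ∀ e σ, |B r e σ| ≤ ‖B r‖ := fun e σ =>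
    (norm_le_pi_norm (B r e) σ).trans (norm_le_pi_norm (B r) e)
  have hbB' : ∀ e σ, |B' r e σ| ≤ ‖B' r‖ := fun e σ =>
    (norm_le_pi_norm (B' r e) σ).trans (norm_le_pi_norm (B' r) e)
  have hb2 : ∀ e g, |gibbs (w r g) (fun σ => B' r e σ * B r e σ)
      - gibbs (w r g) (B' r e) * gibbs (w r g) (B r e)| ≤ 2 * (‖B' r‖ * ‖B r‖) := by
    intro e g
    refine (abs_sub _ _).trans ?_
    rw [two_mul, abs_mul]
    refine add_le_add (abs_gibbs_le _ fun σ => ?_) ?_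
    · rw [abs_mul]
      exact mul_le_mul (hbB' e σ) (hbB e σ) (abs_nonneg _) (norm_nonneg _)
    · exact mul_le_mul (abs_gibbs_le _ (hbB' e)) (abs_gibbs_le _ (hbB e)) (abs_nonneg _)
        (norm_nonneg _)
  have hm2 : ∀ e, Measurable fun g => gibbs (w r g) (fun σ => B' r e σ * B r e σ)
      - gibbs (w r g) (B' r e) * gibbs (w r g) (B r e) := fun e =>
    (measurable_gibbs (hwm r) _).sub
      ((measurable_gibbs (hwm r) _).mul (measurable_gibbs (hwm r) _))
  have hE1 : ExpBounded fun g => gibbs (w r g) (A' r) :=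
    .of_bounded (measurable_gibbs (hwm r) _) ‖A' r‖ fun g =>
      abs_gibbs_le _ fun σ => norm_le_pi_norm (A' r) σ
  have hE2 : ∀ e, ExpBounded fun g => g e * gibbs (w r g) (B' r e) := fun e =>
    (ExpBounded.eval e).mul (.of_bounded (measurable_gibbs (hwm r) _) ‖B' r‖ fun g =>
      abs_gibbs_le _ (hbB' e))
  have hE3 : ∀ e, ExpBounded fun g => gibbs (w r g) (fun σ => B' r e σ * B r e σ)
      - gibbs (w r g) (B' r e) * gibbs (w r g) (B r e) := fun e =>
    .of_bounded (hm2 e) _ (hb2 e)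
  rw [hexp r, integral_add (hE1.integrable _ _)
      ((ExpBounded.sum _ fun e _ => hE2 e).integrable _ _),
    integral_add (hE1.integrable _ _) ((ExpBounded.sum _ fun e _ => hE3 e).integrable _ _),
    integral_finsetSum _ fun e _ => (hE2 e).integrable _ _,
    integral_finsetSum _ fun e _ => (hE3 e).integrable _ _]
  congr 1
  refine Finset.sum_congr rfl fun e _ => ?_
  refine integral_eval_mul e (C := max ‖B' r‖ (2 * (‖B' r‖ * ‖B r‖))) ?_
    (measurable_gibbs (hwm r) _) (hm2 e)
    (fun g => (abs_gibbs_le _ (hbB' e)).trans (le_max_left _ _))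
    (fun g => (hb2 e g).trans (le_max_right _ _))
  intro h x
  refine hasDerivAt_gibbs (w := fun z => w r (Function.update h e z)) (B' r e) fun σ => ?_
  have : (fun z => w r (Function.update h e z) σ)
      = fun z => z * B r e σ + (A r σ + ∑ e' ∈ Finset.univ.erase e, h e' * B r e' σ) := by
    ext z
    simp only [hw]
    rw [← Finset.add_sum_erase _ _ (Finset.mem_univ e)]
    simp only [Function.update_self]
    rw [Finset.sum_congr rfl fun e' he' => by
      rw [Function.update_of_ne (Finset.ne_of_mem_erase he')]]
    ring
  rw [this]
  exact (((hasDerivAt_id x).mul_const (B r e σ)).add_const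
    (A r σ + ∑ e' ∈ Finset.univ.erase e, h e' * B r e' σ)).congr_deriv (one_mul _)

end Interpolation

/-! ### Change of measure for products of Gaussian measures -/

section ChangeOfMeasure

variable {E : Type*} [Fintype E]

/-- The law on the Nishimori line: independent Gaussian variables with mean and variance `τ e`. -/
noncomputable abbrev nishimoriLaw (τ : E → ℝ≥0) : Measure (E → ℝ) :=
  gaussianPi (fun e => (τ e : ℝ)) τ

/-- The law of independent centred Gaussian variables with variances `τ e`. -/
noncomputable abbrev centeredLaw (τ : E → ℝ≥0) : Measure (E → ℝ) := gaussianPi (fun _ => 0) τ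

/-- When mean and variance agree, the density of the shifted Gaussian involves no parameter but the
normalization; this is what makes the planted configuration a typical one of the Gibbs measure. -/
lemma gaussianReal_eq_withDensity (τ : ℝ≥0) :
    gaussianReal τ τ = (gaussianReal 0 τ).withDensity
      fun x => ENNReal.ofReal (Real.exp (x - τ / 2)) := by
  classical
  by_cases hτ : τ = 0
  · subst hτ
    simp only [NNReal.coe_zero, gaussianReal_zero_var]
    ext s hs
    rw [withDensity_apply _ hs, restrict_dirac' hs]
    split_ifs with h
    · rw [lintegral_dirac' _ (by fun_prop)]
      simp [hs, h]
    · simp [hs, h]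
  · have hτ' : (0 : ℝ) < τ := by positivity
    rw [gaussianReal_of_var_ne_zero _ hτ, gaussianReal_of_var_ne_zero _ hτ,
      ← withDensity_mul _ (measurable_gaussianPDF _ _) (by fun_prop)]
    congr 1
    ext x
    rw [Pi.mul_apply, gaussianPDF, gaussianPDF, ← ENNReal.ofReal_mul (gaussianPDFReal_nonneg _ _ _)]
    congr 1
    have h : Real.exp (-(x - τ) ^ 2 / (2 * τ))
        = Real.exp (-(x - 0) ^ 2 / (2 * τ)) * Real.exp (x - τ / 2) := by
      rw [← Real.exp_add]
      congr 1
      field_simp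
      ring
    rw [gaussianPDFReal, gaussianPDFReal, h]
    ring

lemma gaussianPi_eq_withDensity (τ : E → ℝ≥0) :
    nishimoriLaw τ = (centeredLaw τ).withDensity
      fun h => ENNReal.ofReal (Real.exp (∑ e, h e - (∑ e, (τ e : ℝ)) / 2)) := by
  unfold nishimoriLaw
  conv_lhs => unfold gaussianPi
  refine Measure.pi_eq fun s hs => ?_
  have h1 : ∀ h : E → ℝ, Real.exp (∑ e, h e - (∑ e, (τ e : ℝ)) / 2)
      = ∏ e, Real.exp (h e - τ e / 2) := fun h => by
    rw [← Real.exp_sum, Finset.sum_sub_distrib, Finset.sum_div]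
  have hint : ∀ e, Integrable (fun x => Real.exp (x - τ e / 2)) (gaussianReal 0 (τ e)) := fun e => by
    simp_rw [Real.exp_sub]
    have := integrable_exp_mul_gaussianReal (μ := 0) (v := τ e) 1
    simp only [one_mul] at this
    exact this.div_const _
  have h2 : ∀ e, gaussianReal (τ e) (τ e) (s e) = ENNReal.ofReal
      (∫ x, (s e).indicator (fun x => Real.exp (x - τ e / 2)) x ∂gaussianReal 0 (τ e)) := fun e => by
    rw [gaussianReal_eq_withDensity, withDensity_apply _ (hs e), integral_indicator (hs e),
      ofReal_integral_eq_lintegral_ofReal (hint e).integrableOn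
        (ae_of_all _ fun _ => (Real.exp_pos _).le)]
  simp_rw [h2]
  rw [← ENNReal.ofReal_prod_of_nonneg fun e _ => integral_nonneg fun x =>
      Set.indicator_nonneg (fun _ _ => (Real.exp_pos _).le) x,
    ← integral_fintype_prod_eq_prod (fun e x =>
      (s e).indicator (fun x => Real.exp (x - τ e / 2)) x),
    withDensity_apply _ (MeasurableSet.univ_pi hs)]
  have h3 : ∀ h : E → ℝ, ∏ e, (s e).indicator (fun x => Real.exp (x - τ e / 2)) (h e)
      = (Set.univ.pi s).indicator (fun h => ∏ e, Real.exp (h e - τ e / 2)) h := fun h => by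
    by_cases hh : h ∈ Set.univ.pi s
    · rw [Set.indicator_of_mem hh]
      exact Finset.prod_congr rfl fun e _ => Set.indicator_of_mem (hh e (Set.mem_univ e)) _
    · rw [Set.indicator_of_notMem hh]
      simp only [Set.mem_pi, Set.mem_univ, true_implies, not_forall] at hh
      obtain ⟨e, he⟩ := hh
      exact Finset.prod_eq_zero (Finset.mem_univ e) (Set.indicator_of_notMem he _)
  simp_rw [h3, h1]
  rw [integral_indicator (MeasurableSet.univ_pi hs), ofReal_integral_eq_lintegral_ofReal]
  · rfl
  · exact (Integrable.fintype_prod hint).integrableOn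
  · exact ae_of_all _ fun h => Finset.prod_nonneg fun e _ => (Real.exp_pos _).le

lemma integral_nishimoriLaw (τ : E → ℝ≥0) (F : (E → ℝ) → ℝ) :
    ∫ h, F h ∂nishimoriLaw τ
      = ∫ h, Real.exp (∑ e, h e - (∑ e, (τ e : ℝ)) / 2) * F h ∂centeredLaw τ := by
  rw [gaussianPi_eq_withDensity, integral_withDensity_eq_integral_toReal_smul (by fun_prop)
    (ae_of_all _ fun _ => ENNReal.ofReal_lt_top)]
  simp only [ENNReal.toReal_ofReal (Real.exp_pos _).le, smul_eq_mul]

lemma gaussianPi_map {m m' : E → ℝ} {v v' : E → ℝ≥0} (φ : E → ℝ → ℝ) (hφ : ∀ e, Measurable (φ e))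
    (h : ∀ e, (gaussianReal (m e) (v e)).map (φ e) = gaussianReal (m' e) (v' e)) :
    MeasurePreserving (fun (g : E → ℝ) e => φ e (g e)) (gaussianPi m v) (gaussianPi m' v') := by
  refine ⟨by fun_prop, ?_⟩
  unfold gaussianPi
  have : ∀ e, SigmaFinite ((gaussianReal (m e) (v e)).map (φ e)) := fun e => by
    rw [h e]; infer_instance
  rw [Measure.pi_map_pi (fun e => (hφ e).aemeasurable)]
  simp_rw [h]

lemma integral_centeredLaw_mul (τ : E → ℝ≥0) (s : E → ℝ) (hs : ∀ e, s e ^ 2 = 1)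
    {F : (E → ℝ) → ℝ} (hF : Measurable F) :
    ∫ h, F (fun e => h e * s e) ∂centeredLaw τ = ∫ h, F h ∂centeredLaw τ := by
  have hp := gaussianPi_map (m := fun _ => 0) (m' := fun _ => 0) (v := τ) (v' := τ)
    (fun e x => x * s e) (fun e => by fun_prop) fun e => by
      rw [gaussianReal_map_mul_const]
      congr 1
      · simp
      · ext; simp [hs e]
  exact (integral_of_measurePreserving hp hF).symm

lemma integral_nishimoriLaw_eq_std (τ : E → ℝ≥0) {F : (E → ℝ) → ℝ} (hF : Measurable F) :
    ∫ h, F h ∂nishimoriLaw τ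
      = ∫ g, F (fun e => (τ e : ℝ) + √(τ e : ℝ) * g e) ∂gaussianPi (fun _ => 0) (fun _ => 1) := by
  have hp := gaussianPi_map (m := fun _ : E => 0) (m' := fun e => (τ e : ℝ)) (v := fun _ => 1)
    (v' := τ) (fun e x => (τ e : ℝ) + √(τ e : ℝ) * x) (fun e => by fun_prop) fun e => by
      have : (fun x : ℝ => (τ e : ℝ) + √(τ e : ℝ) * x)
          = (fun x => (τ e : ℝ) + x) ∘ fun x => √(τ e : ℝ) * x := rfl
      rw [this, ← Measure.map_map (by fun_prop) (by fun_prop), gaussianReal_map_const_mul,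
        gaussianReal_map_const_add]
      congr 1
      · simp
      · ext; simp [Real.sq_sqrt]
  exact integral_of_measurePreserving hp hF

lemma measurePreserving_add (τ δ : E → ℝ≥0) :
    MeasurePreserving (fun p : (E → ℝ) × (E → ℝ) => p.1 + p.2)
      ((centeredLaw τ).prod (centeredLaw δ)) (centeredLaw (τ + δ)) := by
  have h1 := (measurePreserving_arrowProdEquivProdArrow ℝ ℝ E (fun e => gaussianReal 0 (τ e))
    (fun e => gaussianReal 0 (δ e))).symm
  have h2 : MeasurePreserving (fun (q : E → ℝ × ℝ) e => (q e).1 + (q e).2)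
      (Measure.pi fun e => (gaussianReal 0 (τ e)).prod (gaussianReal 0 (δ e)))
      (centeredLaw (τ + δ)) := by
    refine ⟨by fun_prop, ?_⟩
    have h3 : ∀ e, ((gaussianReal 0 (τ e)).prod (gaussianReal 0 (δ e))).map
        (fun q : ℝ × ℝ => q.1 + q.2) = gaussianReal 0 (τ e + δ e) := fun e => by
      have := gaussianReal_conv_gaussianReal (m₁ := 0) (m₂ := 0) (v₁ := τ e) (v₂ := δ e)
      rw [add_zero] at this
      exact this
    have : ∀ e, SigmaFinite (((gaussianReal 0 (τ e)).prod (gaussianReal 0 (δ e))).map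
        (fun q : ℝ × ℝ => q.1 + q.2)) := fun e => by rw [h3 e]; infer_instance
    rw [Measure.pi_map_pi (f := fun _ (q : ℝ × ℝ) => q.1 + q.2)
      (fun e => by fun_prop)]
    simp_rw [h3]
    rfl
  exact h2.comp h1

lemma integral_exp_centeredLaw (δ : E → ℝ≥0) (s : E → ℝ) (hs : ∀ e, s e ^ 2 = 1) :
    ∫ k, Real.exp (∑ e, k e * s e) ∂centeredLaw δ = Real.exp ((∑ e, (δ e : ℝ)) / 2) := by
  simp_rw [Real.exp_sum]
  have := integral_fintype_prod_eq_prod (μ := fun e => gaussianReal 0 (δ e))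
    (fun e x => Real.exp (x * s e))
  refine this.trans ?_
  rw [Finset.sum_div, Real.exp_sum]
  refine Finset.prod_congr rfl fun e _ => ?_
  have h := congrFun (mgf_fun_id_gaussianReal (μ := 0) (v := δ e)) (s e)
  simp only [mgf, hs e] at h
  simp_rw [mul_comm _ (s e)]
  rw [h]
  ring_nf

end ChangeOfMeasure

/-! ### Spin systems on the Nishimori line -/

section Nishimori

variable {Ω E : Type*} [CommGroup Ω] [Fintype E]

/-- The real value `±1` of a character of the group of configurations; products of spins are such
characters. -/
def ev (y : Ω →* ℤˣ) (σ : Ω) : ℝ := ((y σ : ℤˣ) : ℤ)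

lemma ev_eq_or (y : Ω →* ℤˣ) (σ : Ω) : ev y σ = 1 ∨ ev y σ = -1 := by
  unfold ev
  rcases Int.units_eq_one_or (y σ) with h | h <;> simp [h]

lemma ev_sq (y : Ω →* ℤˣ) (σ : Ω) : ev y σ ^ 2 = 1 := by
  rcases ev_eq_or y σ with h | h <;> simp [h]

lemma ev_mul_self (y : Ω →* ℤˣ) (σ : Ω) : ev y σ * ev y σ = 1 := by rw [← sq, ev_sq]

lemma abs_ev (y : Ω →* ℤˣ) (σ : Ω) : |ev y σ| = 1 := by
  rcases ev_eq_or y σ with h | h <;> simp [h]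

lemma ev_apply_mul (y : Ω →* ℤˣ) (ρ σ : Ω) : ev y (ρ * σ) = ev y ρ * ev y σ := by
  simp [ev]

lemma ev_mul_apply (y z : Ω →* ℤˣ) (σ : Ω) : ev (y * z) σ = ev y σ * ev z σ := by
  simp [ev]

/-- Minus the Hamiltonian: the couplings `h e` multiply the characters `χ e`. -/
def energy (χ : E → Ω →* ℤˣ) (h : E → ℝ) (σ : Ω) : ℝ := ∑ e, h e * ev (χ e) σ

lemma energy_gauge (χ : E → Ω →* ℤˣ) (h : E → ℝ) (ρ σ : Ω) :
    energy χ (fun e => h e * ev (χ e) ρ) σ = energy χ h (ρ * σ) := by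
  simp only [energy, ev_apply_mul, mul_assoc]

lemma measurable_energy (χ : E → Ω →* ℤˣ) (σ : Ω) : Measurable fun h => energy χ h σ := by
  unfold energy; fun_prop

lemma abs_energy_sub_le (χ : E → Ω →* ℤˣ) (h k : E → ℝ) (σ : Ω) :
    |energy χ h σ - energy χ k σ| ≤ ∑ e, |h e - k e| := by
  simp only [energy, ← Finset.sum_sub_distrib, ← sub_mul]
  refine (Finset.abs_sum_le_sum_abs _ _).trans (Finset.sum_le_sum fun e _ => ?_)
  rw [abs_mul, abs_ev, mul_one]

lemma abs_energy_le (χ : E → Ω →* ℤˣ) (h : E → ℝ) (σ : Ω) : |energy χ h σ| ≤ ∑ e, |h e| := by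
  have := abs_energy_sub_le χ h 0 σ
  simpa [energy] using this

lemma expBounded_exp_energy (χ : E → Ω →* ℤˣ) (ρ : Ω) :
    ExpBounded fun h => Real.exp (energy χ h ρ) :=
  .exp (measurable_energy χ ρ) 0 1 fun h => by
    simpa using (le_abs_self _).trans (abs_energy_le χ h ρ)

variable [Fintype Ω]

/-- The quenched average `𝔼⟨y⟩` on the Nishimori line, the coupling of the character `χ e` having
mean and variance `τ e` (the inverse temperature being absorbed in the couplings). -/
noncomputable def avg (χ : E → Ω →* ℤˣ) (τ : E → ℝ≥0) (y : Ω →* ℤˣ) : ℝ :=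
  ∫ h, gibbs (energy χ h) (ev y) ∂nishimoriLaw τ

/-- The quenched free energy `𝔼 log Z` on the Nishimori line. -/
noncomputable def freeEnergy (χ : E → Ω →* ℤˣ) (τ : E → ℝ≥0) : ℝ :=
  ∫ h, logZ (energy χ h) ∂nishimoriLaw τ

variable (χ : E → Ω →* ℤˣ)

lemma measurable_gibbs_energy (F : Ω → ℝ) : Measurable fun h => gibbs (energy χ h) F :=
  measurable_gibbs (measurable_energy χ) F

lemma abs_gibbs_ev_le (w : Ω → ℝ) (y : Ω →* ℤˣ) : |gibbs w (ev y)| ≤ 1 :=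
  abs_gibbs_le w fun σ => (abs_ev y σ).le

lemma expBounded_gibbs (y : Ω →* ℤˣ) : ExpBounded fun h => gibbs (energy χ h) (ev y) :=
  .of_bounded (measurable_gibbs_energy χ _) 1 fun _ => abs_gibbs_ev_le _ y

lemma expBounded_logZ_energy : ExpBounded fun h => logZ (energy χ h) :=
  .of_lipschitz fun h k => abs_logZ_sub_le (abs_energy_sub_le χ h k)

lemma avg_le_one (τ : E → ℝ≥0) (y : Ω →* ℤˣ) : avg χ τ y ≤ 1 := by
  unfold avg
  calc _ ≤ ∫ _, (1 : ℝ) ∂nishimoriLaw τ :=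
        integral_mono ((expBounded_gibbs χ y).integrable _ _) (integrable_const _)
          fun h => (abs_le.1 (abs_gibbs_ev_le (energy χ h) y)).2
    _ = 1 := by simp

/-- Gauge covariance: flipping the couplings by `ρ` translates the configurations by `ρ`. -/
lemma gibbs_gauge (h : E → ℝ) (ρ : Ω) (y : Ω →* ℤˣ) :
    gibbs (energy χ fun e => h e * ev (χ e) ρ) (ev y)
      = ev y ρ * gibbs (energy χ h) (ev y) := by
  have h1 : ∀ F : Ω → ℝ, ∑ σ, F (ρ * σ) = ∑ σ, F σ := fun F =>
    Fintype.sum_equiv (Equiv.mulLeft ρ) _ _ fun _ => rfl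
  simp only [gibbs, energy_gauge]
  rw [h1 fun σ => Real.exp (energy χ h σ), ← h1 fun σ => ev y σ * Real.exp (energy χ h σ),
    ← mul_div_assoc, Finset.mul_sum]
  congr 1
  refine Finset.sum_congr rfl fun σ _ => ?_
  rw [ev_apply_mul, ← mul_assoc, ← mul_assoc, ev_mul_self, one_mul]

/-- Gauge symmetrization: averages on the Nishimori line expressed through centred couplings, the
planted configuration `ρ` being chosen at random. -/
lemma card_mul_integral_nishimoriLaw (τ : E → ℝ≥0) {F : (E → ℝ) → ℝ} (hF : ExpBounded F) :
    (Fintype.card Ω : ℝ) * ∫ h, F h ∂nishimoriLaw τ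
      = Real.exp (-(∑ e, (τ e : ℝ)) / 2) * ∑ ρ : Ω, ∫ h, Real.exp (energy χ h ρ)
          * F (fun e => h e * ev (χ e) ρ) ∂centeredLaw τ := by
  have h1 : ∀ ρ : Ω, ∫ h, F h ∂nishimoriLaw τ = Real.exp (-(∑ e, (τ e : ℝ)) / 2) *
      ∫ h, Real.exp (energy χ h ρ) * F (fun e => h e * ev (χ e) ρ) ∂centeredLaw τ := by
    intro ρ
    have hFm := hF.1
    rw [integral_nishimoriLaw, ← integral_centeredLaw_mul τ (fun e => ev (χ e) ρ)
      (fun e => ev_sq _ _)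
      (F := fun h => Real.exp (∑ e, h e - (∑ e, (τ e : ℝ)) / 2) * F h) (by fun_prop),
      ← integral_const_mul]
    congr 1
    ext h
    rw [← mul_assoc, ← Real.exp_add]
    unfold energy
    ring_nf
  rw [Finset.mul_sum, ← Finset.sum_congr rfl fun ρ _ => h1 ρ]
  simp

lemma expBounded_partition :
    ExpBounded fun h => ∑ ρ, Real.exp (energy χ h ρ) :=
  ExpBounded.sum _ fun ρ _ => expBounded_exp_energy χ ρ

lemma expBounded_partition_mul_sq (y : Ω →* ℤˣ) : ExpBounded fun h =>
    (∑ ρ, Real.exp (energy χ h ρ)) * gibbs (energy χ h) (ev y) ^ 2 := by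
  have := (expBounded_gibbs χ y).mul (expBounded_gibbs χ y)
  simp only [← sq] at this
  exact (expBounded_partition χ).mul this

lemma card_mul_avg (τ : E → ℝ≥0) (y : Ω →* ℤˣ) :
    (Fintype.card Ω : ℝ) * avg χ τ y = Real.exp (-(∑ e, (τ e : ℝ)) / 2) *
      ∫ h, (∑ ρ, Real.exp (energy χ h ρ)) * gibbs (energy χ h) (ev y) ^ 2 ∂centeredLaw τ := by
  unfold avg
  rw [card_mul_integral_nishimoriLaw χ τ (expBounded_gibbs χ y), ← integral_finsetSum]
  · congr 2
    ext h
    have hz := (sum_exp_pos (energy χ h)).ne'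
    simp_rw [gibbs_gauge]
    rw [sq, ← mul_assoc]
    conv_rhs => rw [gibbs, mul_div_cancel₀ _ hz, Finset.sum_mul]
    exact Finset.sum_congr rfl fun σ _ => by rw [gibbs]; ring
  · intro ρ _
    simp_rw [gibbs_gauge]
    exact ((expBounded_exp_energy χ ρ).mul ((expBounded_gibbs χ y).const_mul _)).integrable _ _

/-- **The Nishimori identity** `𝔼⟨y⟩² = 𝔼⟨y⟩`. -/
theorem integral_gibbs_sq (τ : E → ℝ≥0) (y : Ω →* ℤˣ) :
    ∫ h, gibbs (energy χ h) (ev y) ^ 2 ∂nishimoriLaw τ = avg χ τ y := by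
  have hc : (Fintype.card Ω : ℝ) ≠ 0 := by simp
  refine mul_left_cancel₀ hc ?_
  have hb : ExpBounded fun h => gibbs (energy χ h) (ev y) ^ 2 := by
    simpa only [sq] using (expBounded_gibbs χ y).mul (expBounded_gibbs χ y)
  rw [card_mul_avg, card_mul_integral_nishimoriLaw χ τ hb, ← integral_finsetSum]
  · simp_rw [gibbs_gauge, mul_pow, ev_sq, one_mul, ← Finset.sum_mul]
  · intro ρ _
    simp_rw [gibbs_gauge, mul_pow, ev_sq, one_mul]
    exact ((expBounded_exp_energy χ ρ).mul hb).integrable _ _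

lemma avg_nonneg (τ : E → ℝ≥0) (y : Ω →* ℤˣ) : 0 ≤ avg χ τ y := by
  rw [← integral_gibbs_sq]
  exact integral_nonneg fun _ => sq_nonneg _

/-- Averages of characters increase with the signal-to-noise ratios of the couplings. The function
`Z ⟨y⟩²` is jointly convex in `(∑ y e^w, Z)`, and averaging over the additional
couplings multiplies both arguments by the same constant. -/
theorem avg_mono {τ τ' : E → ℝ≥0} (hτ : τ ≤ τ') (y : Ω →* ℤˣ) : avg χ τ y ≤ avg χ τ' y := by
  have hc : (0 : ℝ) < Fintype.card Ω := by exact_mod_cast Fintype.card_pos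
  refine le_of_mul_le_mul_left ?_ hc
  obtain ⟨δ, rfl⟩ : ∃ δ, τ' = τ + δ := ⟨τ' - τ, (add_tsub_cancel_of_le hτ).symm⟩
  rw [card_mul_avg, card_mul_avg]
  set P : (E → ℝ) → ℝ := fun h =>
    (∑ ρ, Real.exp (energy χ h ρ)) * gibbs (energy χ h) (ev y) ^ 2 with hP
  have hPb : ExpBounded P := expBounded_partition_mul_sq χ y
  have hp := measurePreserving_add τ δ
  have hPi : Integrable (fun p : (E → ℝ) × (E → ℝ) => P (p.1 + p.2))
      ((centeredLaw τ).prod (centeredLaw δ)) :=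
    hp.integrable_comp_of_integrable (hPb.integrable _ _)
  have h1 : ∫ h, P h ∂centeredLaw (τ + δ) = ∫ h, ∫ k, P (h + k) ∂centeredLaw δ ∂centeredLaw τ := by
    rw [integral_of_measurePreserving hp hPb.1, integral_prod _ hPi]
  have hadd : ∀ h k σ, energy χ (h + k) σ = energy χ h σ + energy χ k σ := fun h k σ => by
    simp only [energy, Pi.add_apply, add_mul, Finset.sum_add_distrib]
  -- The average over the new couplings of any linear combination of Boltzmann weights.
  have hlin : ∀ (h : E → ℝ) (F : Ω → ℝ),
      Integrable (fun k => ∑ ρ, F ρ * Real.exp (energy χ (h + k) ρ)) (centeredLaw δ) ∧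
      ∫ k, ∑ ρ, F ρ * Real.exp (energy χ (h + k) ρ) ∂centeredLaw δ
      = Real.exp ((∑ e, (δ e : ℝ)) / 2) * ∑ ρ, F ρ * Real.exp (energy χ h ρ) := by
    intro h F
    have hi : ∀ ρ ∈ Finset.univ, Integrable (fun k => F ρ * Real.exp (energy χ (h + k) ρ))
        (centeredLaw δ) := fun ρ _ => by
      simp_rw [hadd, Real.exp_add]
      exact (((expBounded_exp_energy χ ρ).const_mul _).const_mul _).integrable _ _
    refine ⟨integrable_finsetSum _ hi, ?_⟩
    rw [integral_finsetSum _ hi, Finset.mul_sum]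
    refine Finset.sum_congr rfl fun ρ _ => ?_
    simp_rw [hadd, Real.exp_add, ← mul_assoc]
    rw [integral_const_mul]
    have := integral_exp_centeredLaw δ (fun e => ev (χ e) ρ) (fun e => ev_sq _ _)
    unfold energy
    rw [this]
    ring
  have hUZ : ∀ h, (∑ ρ, Real.exp (energy χ h ρ)) * gibbs (energy χ h) (ev y)
      = ∑ ρ, ev y ρ * Real.exp (energy χ h ρ) := fun h =>
    mul_div_cancel₀ _ (sum_exp_pos (energy χ h)).ne'
  have h2 : ∀ h, Integrable (fun k => P (h + k)) (centeredLaw δ) →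
      Real.exp ((∑ e, (δ e : ℝ)) / 2) * P h ≤ ∫ k, P (h + k) ∂centeredLaw δ := by
    intro h hi
    -- The tangent at `c` of the convex function `x ^ 2`.
    set c := gibbs (energy χ h) (ev y) with hcdef
    have hL := hlin h fun ρ => 2 * c * ev y ρ - c ^ 2
    calc Real.exp ((∑ e, (δ e : ℝ)) / 2) * P h
        = ∫ k, ∑ ρ, (2 * c * ev y ρ - c ^ 2) * Real.exp (energy χ (h + k) ρ) ∂centeredLaw δ := by
          rw [hL.2]
          congr 1
          simp only [sub_mul, Finset.sum_sub_distrib, mul_assoc, ← Finset.mul_sum]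
          rw [← hUZ, hP, ← hcdef]
          simp only [← hcdef]
          ring
      _ ≤ _ := by
          refine integral_mono hL.1 hi fun k => ?_
          simp only [sub_mul, Finset.sum_sub_distrib, mul_assoc, ← Finset.mul_sum]
          rw [← hUZ]
          have hz := (sum_exp_pos (energy χ (h + k))).le
          simp only [hP]
          nlinarith [mul_nonneg hz (sq_nonneg (gibbs (energy χ (h + k)) (ev y) - c))]
  have h3 : Real.exp ((∑ e, (δ e : ℝ)) / 2) * ∫ h, P h ∂centeredLaw τ
      ≤ ∫ h, P h ∂centeredLaw (τ + δ) := by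
    rw [h1, ← integral_const_mul]
    refine integral_mono_ae ((hPb.integrable _ _).const_mul _) hPi.integral_prod_left ?_
    filter_upwards [hPi.prod_right_ae] with h hh
    exact h2 h hh
  have h4 : Real.exp (-(∑ e, (τ e : ℝ)) / 2)
      = Real.exp (-(∑ e, ((τ + δ) e : ℝ)) / 2) * Real.exp ((∑ e, (δ e : ℝ)) / 2) := by
    rw [← Real.exp_add]
    simp only [Pi.add_apply, NNReal.coe_add, Finset.sum_add_distrib]
    ring_nf
  rw [h4, mul_assoc]
  exact mul_le_mul_of_nonneg_left h3 (Real.exp_pos _).le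

end Nishimori

/-! ### Comparison of spin systems -/

section Comparison

variable {Ω Ω' E E' : Type*} [CommGroup Ω] [Fintype Ω] [CommGroup Ω'] [Fintype Ω']

/-- Gibbs averages of functions of a quotient of the configuration group. -/
lemma gibbs_comp (π : Ω →* Ω') (hπ : Function.Surjective π) (w F : Ω' → ℝ) :
    gibbs (fun σ => w (π σ)) (fun σ => F (π σ)) = gibbs w F := by
  classical
  obtain ⟨n, hn⟩ : ∃ n : ℕ, ∀ σ' : Ω', (Finset.univ.filter fun σ => π σ = σ').card = n :=
    ⟨_, fun σ' => MonoidHom.card_fiber_eq_of_mem_range π (hπ σ') (hπ 1)⟩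
  have hn0 : n ≠ 0 := by
    rw [← hn 1, Finset.card_ne_zero]
    exact ⟨1, by simp⟩
  have h : ∀ G : Ω' → ℝ, ∑ σ, G (π σ) = n * ∑ σ', G σ' := fun G => by
    rw [← Finset.sum_fiberwise Finset.univ π, Finset.mul_sum]
    refine Finset.sum_congr rfl fun σ' _ => ?_
    rw [Finset.sum_congr rfl (g := fun _ => G σ') fun σ hσ => by
      rw [(Finset.mem_filter.1 hσ).2], Finset.sum_const, hn, nsmul_eq_mul]
  unfold gibbs
  rw [h fun σ' => Real.exp (w σ'), h fun σ' => F σ' * Real.exp (w σ')]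
  exact mul_div_mul_left _ _ (by exact_mod_cast hn0)

variable [Fintype E] [Fintype E']

lemma measurePreserving_comp_injective {φ : E' → E} (hφ : Function.Injective φ) (m : E → ℝ)
    (v : E → ℝ≥0) : MeasurePreserving (fun (h : E → ℝ) e => h (φ e)) (gaussianPi m v)
      (gaussianPi (m ∘ φ) (v ∘ φ)) := by
  refine ⟨by fun_prop, ?_⟩
  unfold gaussianPi
  rw [← Measure.infinitePi_eq_pi, ← Measure.infinitePi_eq_pi]
  exact Measure.map_infinitePi_infinitePi_of_inj hφ

lemma ae_eq_zero_of_eq_zero (τ : E → ℝ≥0) : ∀ᵐ h ∂nishimoriLaw τ, ∀ e, τ e = 0 → h e = 0 := by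
  classical
  rw [ae_all_iff]
  intro e
  by_cases he : τ e = 0
  · have h1 : (nishimoriLaw τ).map (fun h => h e) = Measure.dirac 0 := by
      have := (measurePreserving_eval (fun e => gaussianReal (τ e) (τ e)) e).map_eq
      simp only [he, gaussianReal_zero_var, NNReal.coe_zero] at this
      exact this
    have h2 : ∀ᵐ x ∂(nishimoriLaw τ).map (fun h => h e), x = 0 := by
      rw [h1]
      exact (ae_dirac_iff (p := fun x : ℝ => x = 0) (measurableSet_singleton (0 : ℝ))).2 rfl
    filter_upwards [ae_of_ae_map (measurable_pi_apply e).aemeasurable h2] with h hh _ using hh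
  · exact ae_of_all _ fun h h' => absurd h' he

/-- Forgetting couplings and lowering signal-to-noise ratios decreases the averages of characters.
The smaller system, with labels `φ` and configurations `π`, is the larger one with the other
signal-to-noise ratios set to `0`. -/
theorem avg_le_avg {χ : E → Ω →* ℤˣ} {τ : E → ℝ≥0} {χ' : E' → Ω' →* ℤˣ} {τ' : E' → ℝ≥0}
    {φ : E' → E} (hφ : Function.Injective φ) {π : Ω →* Ω'} (hπ : Function.Surjective π)
    (hχ : ∀ e σ, χ (φ e) σ = χ' e (π σ)) (hτ : ∀ e, τ' e ≤ τ (φ e)) (y' : Ω' →* ℤˣ) :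
    avg χ' τ' y' ≤ avg χ τ (y'.comp π) := by
  classical
  set τ'' : E → ℝ≥0 := Function.extend φ τ' 0 with hτ''
  have h1 : τ'' ∘ φ = τ' := funext fun e => hφ.extend_apply _ _ _
  have h0 : ∀ e, e ∉ Set.range φ → τ'' e = 0 := fun e he =>
    Function.extend_apply' _ _ _ he
  have h2 : τ'' ≤ τ := by
    intro e
    by_cases he : e ∈ Set.range φ
    · obtain ⟨e', rfl⟩ := he
      exact (congrFun h1 e').le.trans (hτ e')
    · rw [h0 e he]; exact zero_le
  refine le_trans (le_of_eq ?_) (avg_mono χ h2 _)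
  have hp := measurePreserving_comp_injective hφ (fun e => (τ'' e : ℝ)) τ''
  have hm : (fun e => (τ'' e : ℝ)) ∘ φ = fun e => (τ' e : ℝ) := by rw [← h1]; rfl
  rw [hm, h1] at hp
  unfold avg
  rw [integral_of_measurePreserving hp (measurable_gibbs_energy χ' _)]
  refine integral_congr_ae ?_
  filter_upwards [ae_eq_zero_of_eq_zero τ''] with h hh
  rw [← gibbs_comp π hπ]
  have : ∀ σ, energy χ h σ = energy χ' (fun e => h (φ e)) (π σ) := fun σ => by
    unfold energy
    rw [← Finset.sum_subset (Finset.subset_univ (Finset.univ.image φ)),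
      Finset.sum_image fun a _ b _ hab => hφ hab]
    · refine Finset.sum_congr rfl fun e _ => ?_
      rw [ev, hχ]; rfl
    · intro e _ he
      rw [hh e (h0 e (by simpa using he)), zero_mul]
  have hw : energy χ h = fun σ => energy χ' (fun e => h (φ e)) (π σ) := funext this
  rw [hw]
  rfl

end Comparison

/-! ### The free energy as a function of the signal-to-noise ratio -/

section FreeEnergy

variable {Ω E : Type*} [CommGroup Ω] [Fintype Ω] [DecidableEq E]

/-- The signal-to-noise ratios `τ`, replaced by `T` on the couplings in `F`. -/
def raise (τ : E → ℝ≥0) (F : Finset E) (T : ℝ≥0) : E → ℝ≥0 := fun e => if e ∈ F then T else τ e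

lemma raise_mono (τ : E → ℝ≥0) (F : Finset E) {S T : ℝ≥0} (h : S ≤ T) :
    raise τ F S ≤ raise τ F T := fun e => by
  unfold raise; split_ifs <;> simp [h]

variable [Fintype E]

variable (χ : E → Ω →* ℤˣ) (τ : E → ℝ≥0) (F : Finset E)

/-- The derivative of the free energy in the amplitude `r`, the signal-to-noise ratio on `F`
being `r²`. Interpolation gives `r ∑ (1 + 2 𝔼⟨χ e⟩ - 𝔼⟨χ e⟩²)`, the square standing inside the
expectation, and the Nishimori identity simplifies it. The amplitude is used instead of the ratio
because the Gaussian energies are not differentiable in the latter at `0`. -/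
lemma exists_hasDerivAt_freeEnergy : ∃ Φ : ℝ → ℝ,
    (∀ r : ℝ≥0, Φ r = freeEnergy χ (raise τ F (r ^ 2))) ∧ Differentiable ℝ Φ ∧
    ∀ r : ℝ≥0, HasDerivAt Φ (r * ∑ e ∈ F, (1 + avg χ (raise τ F (r ^ 2)) (χ e))) r := by
  set s : ℝ → E → ℝ := fun r e => if e ∈ F then r else √(τ e : ℝ) with hs
  set s' : E → ℝ := fun e => if e ∈ F then 1 else 0 with hs'
  have hsd : ∀ r e, HasDerivAt (fun r => s r e) (s' e) r := fun r e => by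
    simp only [hs, hs']
    split_ifs
    · exact hasDerivAt_id r
    · exact hasDerivAt_const _ _
  have hsc : Continuous fun r => s r := by
    refine continuous_pi fun e => ?_
    exact continuous_iff_continuousAt.2 fun r => (hsd r e).continuousAt
  have hsc' : ∀ e, Continuous fun r => s r e := fun e => (continuous_apply e).comp hsc
  have hsq : ∀ (r : ℝ≥0) e, s r e ^ 2 = raise τ F (r ^ 2) e := fun r e => by
    simp only [hs, raise]
    split_ifs
    · simp
    · exact Real.sq_sqrt (NNReal.coe_nonneg _)
  have hsqrt : ∀ (r : ℝ≥0) e, √(raise τ F (r ^ 2) e : ℝ) = s r e := fun r e => by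
    rw [← hsq, Real.sqrt_sq]
    simp only [hs]
    split_ifs <;> positivity
  set A : ℝ → Ω → ℝ := fun r σ => ∑ e, s r e ^ 2 * ev (χ e) σ with hA
  set A' : ℝ → Ω → ℝ := fun r σ => ∑ e, 2 * s r e * s' e * ev (χ e) σ with hA'
  set B : ℝ → E → Ω → ℝ := fun r e σ => s r e * ev (χ e) σ with hB
  set B' : ℝ → E → Ω → ℝ := fun _ e σ => s' e * ev (χ e) σ with hB'
  have hen : ∀ (r : ℝ≥0) (g : E → ℝ), (fun σ => A r σ + ∑ e, g e * B r e σ)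
      = energy χ (fun e => (raise τ F (r ^ 2) e : ℝ) + √(raise τ F (r ^ 2) e : ℝ) * g e) := by
    intro r g
    ext σ
    simp only [hA, hB, energy, hsqrt]
    simp only [← hsq]
    rw [← Finset.sum_add_distrib]
    exact Finset.sum_congr rfl fun e _ => by ring
  have key := fun r => hasDerivAt_integral_logZ (A := A) (A' := A') (B := B) (B' := B')
    (fun r σ => by
      refine HasDerivAt.fun_sum fun e _ => ?_
      refine (((hsd r e).pow 2).mul_const _).congr_deriv ?_
      simp)
    (fun r e σ => (hsd r e).mul_const _)
    (continuous_pi fun σ => by simp only [hA']; fun_prop) continuous_const r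
  refine ⟨_, fun r => ?_, fun r => (key r).differentiableAt, fun r => (key r).congr_deriv ?_⟩
  · simp_rw [hen]
    exact (integral_nishimoriLaw_eq_std _ (expBounded_logZ_energy χ).1).symm
  · simp_rw [hen]
    have hb : ∀ e, ExpBounded fun h => gibbs (energy χ h) (ev (χ e)) ^ 2 := fun e => by
      simpa only [sq] using (expBounded_gibbs χ (χ e)).mul (expBounded_gibbs χ (χ e))
    have hval : ∀ h, gibbs (energy χ h) (A' r)
        + ∑ e, (gibbs (energy χ h) (fun σ => B' r e σ * B r e σ)
          - gibbs (energy χ h) (B' r e) * gibbs (energy χ h) (B r e))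
        = ∑ e ∈ F, r * (1 + 2 * gibbs (energy χ h) (ev (χ e))
          - gibbs (energy χ h) (ev (χ e)) ^ 2) := by
      intro h
      have h1 : ∀ e, (fun σ => B' r e σ * B r e σ) = fun _ => s' e * s r e := fun e => by
        ext σ
        simp only [hB, hB']
        rw [mul_mul_mul_comm, ev_mul_self, mul_one]
      simp_rw [h1, gibbs_const, hB, hB', hA', gibbs_const_mul, gibbs_sum, gibbs_const_mul]
      rw [← Finset.sum_add_distrib, ← Finset.sum_subset (Finset.subset_univ F)]
      · refine Finset.sum_congr rfl fun e he => ?_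
        simp only [hs, hs', he, if_true]
        ring
      · intro e _ he
        simp only [hs', he, if_false]
        ring
    simp_rw [hval]
    have hT : ∀ e ∈ F, ExpBounded fun h => (r : ℝ) * (1 + 2 * gibbs (energy χ h) (ev (χ e))
        - gibbs (energy χ h) (ev (χ e)) ^ 2) := fun e _ =>
      (((ExpBounded.const 1).add ((expBounded_gibbs χ _).const_mul 2)).sub (hb e)).const_mul _
    have hm : Measurable fun h => ∑ e ∈ F, (r : ℝ) * (1 + 2 * gibbs (energy χ h) (ev (χ e))
        - gibbs (energy χ h) (ev (χ e)) ^ 2) := (ExpBounded.sum F hT).1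
    rw [← integral_nishimoriLaw_eq_std _ hm,
      integral_finsetSum _ fun e he => (hT e he).integrable _ _, Finset.mul_sum]
    refine Finset.sum_congr rfl fun e _ => ?_
    have i1 := (expBounded_gibbs χ (χ e)).integrable (fun e => (raise τ F (r ^ 2) e : ℝ))
      (raise τ F (r ^ 2))
    rw [integral_const_mul, integral_sub (f := fun h => 1 + 2 * gibbs (energy χ h) (ev (χ e)))
      ((integrable_const _).add (i1.const_mul 2)) ((hb e).integrable _ _),
      integral_add (integrable_const _) (i1.const_mul 2), integral_const_mul, integral_gibbs_sq]
    simp only [integral_const, probReal_univ, smul_eq_mul, mul_one]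
    unfold avg
    ring

/-- Convexity of the free energy in the signal-to-noise ratio: upper bound by the final slope. -/
theorem freeEnergy_sub_le (T : ℝ≥0) :
    freeEnergy χ (raise τ F T) - freeEnergy χ (raise τ F 0)
      ≤ T / 2 * ∑ e ∈ F, (1 + avg χ (raise τ F T) (χ e)) := by
  obtain ⟨Φ, h1, h2, h3⟩ := exists_hasDerivAt_freeEnergy χ τ F
  set K := ∑ e ∈ F, (1 + avg χ (raise τ F T) (χ e)) with hK
  have hd : ∀ r : ℝ≥0, HasDerivAt (fun x => Φ x - x ^ 2 / 2 * K)
      (r * ∑ e ∈ F, (1 + avg χ (raise τ F (r ^ 2)) (χ e)) - r * K) r := fun r => by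
    refine (h3 r).sub ((((hasDerivAt_id (r : ℝ)).pow 2).div_const 2).mul_const K |>.congr_deriv ?_)
    simp
  have hanti : AntitoneOn (fun x => Φ x - x ^ 2 / 2 * K) (Set.Icc 0 (NNReal.sqrt T : ℝ)) := by
    refine antitoneOn_of_deriv_nonpos (convex_Icc _ _)
      (Continuous.continuousOn (h2.continuous.sub (by fun_prop))) (Differentiable.differentiableOn
        (h2.sub (by fun_prop))) fun x hx => ?_
    rw [interior_Icc] at hx
    lift x to ℝ≥0 using hx.1.le
    rw [(hd x).deriv, ← mul_sub]
    refine mul_nonpos_of_nonneg_of_nonpos x.2 (sub_nonpos.2 (Finset.sum_le_sum fun e _ => ?_))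
    gcongr
    refine avg_mono χ (raise_mono τ F ?_) _
    rw [← NNReal.sq_sqrt T]
    have : x ≤ NNReal.sqrt T := by exact_mod_cast hx.2.le
    gcongr
  have := hanti ⟨le_rfl, NNReal.coe_nonneg _⟩ ⟨NNReal.coe_nonneg _, le_rfl⟩ (NNReal.coe_nonneg _)
  have e1 := h1 (NNReal.sqrt T)
  have e0 := h1 0
  have e2 : ((NNReal.sqrt T : ℝ≥0) : ℝ) ^ 2 = T := by exact_mod_cast NNReal.sq_sqrt T
  rw [NNReal.sq_sqrt] at e1
  simp only [NNReal.coe_zero, ne_eq, OfNat.ofNat_ne_zero, not_false_eq_true, zero_pow] at e0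
  simp only [e1, e2, e0, ne_eq, OfNat.ofNat_ne_zero, not_false_eq_true, zero_pow, zero_div,
    zero_mul, sub_zero] at this
  linarith

/-- Convexity of the free energy in the signal-to-noise ratio: lower bound by the initial slope. -/
theorem le_freeEnergy_sub (T : ℝ≥0) :
    T / 2 * ∑ e ∈ F, (1 + avg χ (raise τ F 0) (χ e))
      ≤ freeEnergy χ (raise τ F T) - freeEnergy χ (raise τ F 0) := by
  obtain ⟨Φ, h1, h2, h3⟩ := exists_hasDerivAt_freeEnergy χ τ F
  set K := ∑ e ∈ F, (1 + avg χ (raise τ F 0) (χ e)) with hK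
  have hd : ∀ r : ℝ≥0, HasDerivAt (fun x => Φ x - x ^ 2 / 2 * K)
      (r * ∑ e ∈ F, (1 + avg χ (raise τ F (r ^ 2)) (χ e)) - r * K) r := fun r => by
    refine (h3 r).sub ((((hasDerivAt_id (r : ℝ)).pow 2).div_const 2).mul_const K |>.congr_deriv ?_)
    simp
  have hmono : MonotoneOn (fun x => Φ x - x ^ 2 / 2 * K) (Set.Icc 0 (NNReal.sqrt T : ℝ)) := by
    refine monotoneOn_of_deriv_nonneg (convex_Icc _ _)
      (Continuous.continuousOn (h2.continuous.sub (by fun_prop))) (Differentiable.differentiableOn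
        (h2.sub (by fun_prop))) fun x hx => ?_
    rw [interior_Icc] at hx
    lift x to ℝ≥0 using hx.1.le
    rw [(hd x).deriv, ← mul_sub]
    refine mul_nonneg x.2 (sub_nonneg.2 (Finset.sum_le_sum fun e _ => ?_))
    gcongr
    exact avg_mono χ (raise_mono τ F zero_le) _
  have := hmono ⟨le_rfl, NNReal.coe_nonneg _⟩ ⟨NNReal.coe_nonneg _, le_rfl⟩ (NNReal.coe_nonneg _)
  have e1 := h1 (NNReal.sqrt T)
  have e0 := h1 0
  have e2 : ((NNReal.sqrt T : ℝ≥0) : ℝ) ^ 2 = T := by exact_mod_cast NNReal.sq_sqrt T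
  rw [NNReal.sq_sqrt] at e1
  simp only [NNReal.coe_zero, ne_eq, OfNat.ofNat_ne_zero, not_false_eq_true, zero_pow] at e0
  simp only [e1, e2, e0, ne_eq, OfNat.ofNat_ne_zero, not_false_eq_true, zero_pow, zero_div,
    zero_mul, sub_zero] at this
  linarith

end FreeEnergy

/-! ### Comparison of the partition functions of two copies of a system -/

section Bins

/-- The soft maximum `t⁻¹ log ∑ exp (t d i)` bounds the maximum. -/
lemma le_inv_mul_logZ {ι : Type*} [Fintype ι] [Nonempty ι] (d : ι → ℝ) {t : ℝ} (ht : 0 < t)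
    (i : ι) : d i ≤ t⁻¹ * logZ fun i => t * d i := by
  rw [le_inv_mul_iff₀ ht, logZ, Real.le_log_iff_exp_le (sum_exp_pos _)]
  exact Finset.single_le_sum (f := fun i => Real.exp (t * d i)) (fun _ _ => (Real.exp_pos _).le)
    (Finset.mem_univ i)

variable {Ω ι : Type*} [Fintype Ω] [DecidableEq ι]

/-- The partition function restricted to the configurations with `bin σ = i`. -/
noncomputable def binZ (bin : Ω → ι) (w : Ω → ℝ) (i : ι) : ℝ :=
  ∑ σ with bin σ = i, Real.exp (w σ)

lemma binZ_nonneg (bin : Ω → ι) (w : Ω → ℝ) (i : ι) : 0 ≤ binZ bin w i :=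
  Finset.sum_nonneg fun _ _ => (Real.exp_pos _).le

lemma binZ_le_exp_mul (bin : Ω → ι) {w w' : Ω → ℝ} {c : ℝ} (h : ∀ σ, w σ ≤ w' σ + c) (i : ι) :
    binZ bin w i ≤ Real.exp c * binZ bin w' i := by
  unfold binZ
  rw [Finset.mul_sum]
  refine Finset.sum_le_sum fun σ _ => ?_
  rw [← Real.exp_add]
  exact Real.exp_le_exp.2 (by linarith [h σ])

lemma binZ_pos_or_eq_zero (bin : Ω → ι) (i : ι) :
    (∀ w : Ω → ℝ, 0 < binZ bin w i) ∨ ∀ w : Ω → ℝ, binZ bin w i = 0 := by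
  rcases (Finset.univ.filter fun σ => bin σ = i).eq_empty_or_nonempty with h | h
  · right; intro w; rw [binZ, h, Finset.sum_empty]
  · left; intro w; exact Finset.sum_pos (fun _ _ => Real.exp_pos _) h

/-- An empty bin contributes `log 0 = 0` on both sides. -/
lemma abs_log_binZ_sub_le (bin : Ω → ι) {w w' : Ω → ℝ} {c : ℝ} (hc : 0 ≤ c)
    (h : ∀ σ, |w σ - w' σ| ≤ c) (i : ι) :
    |Real.log (binZ bin w i) - Real.log (binZ bin w' i)| ≤ c := by
  rcases binZ_pos_or_eq_zero bin i with hp | h0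
  · have key : ∀ {w w' : Ω → ℝ}, (∀ σ, w σ ≤ w' σ + c) →
        Real.log (binZ bin w i) ≤ Real.log (binZ bin w' i) + c := fun {w w'} hw => by
      have := Real.log_le_log (hp w) (binZ_le_exp_mul bin hw i)
      rw [Real.log_mul (Real.exp_pos _).ne' (hp w').ne', Real.log_exp] at this
      linarith
    rw [abs_le]
    constructor
    · linarith [key (w := w') (w' := w) fun σ => by linarith [(abs_le.1 (h σ)).1]]
    · linarith [key (w := w) (w' := w') fun σ => by linarith [(abs_le.1 (h σ)).2]]
  · simpa [h0] using hc

variable [Fintype ι]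

lemma sum_binZ (bin : Ω → ι) (w : Ω → ℝ) : ∑ i, binZ bin w i = ∑ σ, Real.exp (w σ) :=
  Finset.sum_fiberwise Finset.univ bin fun σ => Real.exp (w σ)

lemma sum_binZ_mul_binZ (bin : Ω → ι) (w w' : Ω → ℝ) :
    ∑ i, binZ bin w i * binZ bin w' i
      = ∑ p : {p : Ω × Ω // bin p.1 = bin p.2}, Real.exp (w p.1.1 + w' p.1.2) := by
  rw [← Finset.sum_subtype (Finset.univ.filter fun p : Ω × Ω => bin p.1 = bin p.2) (by simp)
    (fun p => Real.exp (w p.1 + w' p.2)), Finset.sum_filter, Fintype.sum_prod_type]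
  simp only [binZ, Finset.sum_mul_sum, Finset.sum_filter]
  rw [Finset.sum_comm]
  refine Finset.sum_congr rfl fun σ _ => ?_
  rw [Finset.sum_eq_single (bin σ)]
  · simp [Real.exp_add, eq_comm]
  · intro i _ hi
    simp [hi.symm]
  · simp

/-- The product of two partition functions is dominated by its diagonal part, up to the number of
bins and to the fluctuation of the difference `d` of the free energies of the bins. By the
Cauchy-Schwarz inequality this costs half of `max d + max (-d)`; the maxima are replaced by smooth
upper bounds. -/
lemma logZ_add_logZ_le [Nonempty Ω] (bin : Ω → ι) (w w' : Ω → ℝ) {t : ℝ} (ht : 0 < t) :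
    logZ w + logZ w' ≤ Real.log (∑ p : {p : Ω × Ω // bin p.1 = bin p.2},
        Real.exp (w p.1.1 + w' p.1.2)) + Real.log (Fintype.card ι)
      + (t⁻¹ * logZ (fun i => t * (Real.log (binZ bin w i) - Real.log (binZ bin w' i)))
        + t⁻¹ * logZ (fun i => t * (Real.log (binZ bin w' i) - Real.log (binZ bin w i)))) / 2 := by
  have : Nonempty ι := ⟨bin (Classical.arbitrary Ω)⟩
  have : Nonempty {p : Ω × Ω // bin p.1 = bin p.2} :=
    ⟨(Classical.arbitrary Ω, Classical.arbitrary Ω), rfl⟩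
  set P := t⁻¹ * logZ (fun i => t * (Real.log (binZ bin w i) - Real.log (binZ bin w' i)))
  set N := t⁻¹ * logZ (fun i => t * (Real.log (binZ bin w' i) - Real.log (binZ bin w i)))
  have key : ∀ (w w' : Ω → ℝ) (P : ℝ),
      (∀ i, Real.log (binZ bin w i) - Real.log (binZ bin w' i) ≤ P) → ∀ i,
      binZ bin w i ≤ Real.exp (P / 2) * √(binZ bin w i * binZ bin w' i) := by
    intro w w' P hP i
    rcases binZ_pos_or_eq_zero bin i with hp | h0
    · have h1 : binZ bin w i ≤ Real.exp P * binZ bin w' i := by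
        rw [← Real.log_le_log_iff (hp w) (mul_pos (Real.exp_pos _) (hp w')),
          Real.log_mul (Real.exp_pos _).ne' (hp w').ne', Real.log_exp]
        linarith [hP i]
      have h2 : Real.exp (P / 2) = √(Real.exp P) := by
        rw [Real.exp_half]
      rw [h2, ← Real.sqrt_mul (Real.exp_pos _).le]
      refine Real.le_sqrt_of_sq_le ?_
      nlinarith [hp w]
    · simp [h0]
  have hA := key w w' P (le_inv_mul_logZ _ ht)
  have hB := key w' w N (le_inv_mul_logZ _ ht)
  set Q := ∑ i, binZ bin w i * binZ bin w' i with hQ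
  have hQp : 0 < Q := by
    rw [hQ, sum_binZ_mul_binZ]
    exact sum_exp_pos fun p : {p : Ω × Ω // bin p.1 = bin p.2} => w p.1.1 + w' p.1.2
  rw [← sum_binZ_mul_binZ, ← hQ]
  set q := ∑ i, √(binZ bin w i * binZ bin w' i) with hq
  have hq0 : 0 ≤ q := Finset.sum_nonneg fun _ _ => Real.sqrt_nonneg _
  have h1 : ∑ σ, Real.exp (w σ) ≤ Real.exp (P / 2) * q := by
    rw [← sum_binZ bin, hq, Finset.mul_sum]
    exact Finset.sum_le_sum fun i _ => hA i
  have h2 : ∑ σ, Real.exp (w' σ) ≤ Real.exp (N / 2) * q := by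
    rw [← sum_binZ bin, hq, Finset.mul_sum]
    refine Finset.sum_le_sum fun i _ => ?_
    rw [mul_comm (binZ bin w i)]
    exact hB i
  have h3 : q ^ 2 ≤ Fintype.card ι * Q := by
    have := sq_sum_le_card_mul_sum_sq (s := Finset.univ)
      (f := fun i => √(binZ bin w i * binZ bin w' i))
    refine this.trans (le_of_eq ?_)
    rw [hQ, Finset.card_univ]
    congr 1
    exact Finset.sum_congr rfl fun i _ =>
      Real.sq_sqrt (mul_nonneg (binZ_nonneg _ _ _) (binZ_nonneg _ _ _))
  have h4 : (∑ σ, Real.exp (w σ)) * ∑ σ, Real.exp (w' σ)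
      ≤ Real.exp ((P + N) / 2) * (Fintype.card ι * Q) := by
    calc _ ≤ (Real.exp (P / 2) * q) * (Real.exp (N / 2) * q) :=
          mul_le_mul h1 h2 (sum_exp_pos w').le (mul_nonneg (Real.exp_pos _).le hq0)
      _ = Real.exp ((P + N) / 2) * q ^ 2 := by
          rw [add_div, Real.exp_add]; ring
      _ ≤ _ := mul_le_mul_of_nonneg_left h3 (Real.exp_pos _).le
  have hcard : (0 : ℝ) < Fintype.card ι := by exact_mod_cast Fintype.card_pos
  have h5 := Real.log_le_log (mul_pos (sum_exp_pos w) (sum_exp_pos w')) h4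
  rw [Real.log_mul (sum_exp_pos w).ne' (sum_exp_pos w').ne',
    Real.log_mul (Real.exp_pos _).ne' (mul_pos hcard hQp).ne', Real.log_exp,
    Real.log_mul hcard.ne' hQp.ne'] at h5
  simp only [logZ] at h5 ⊢
  linarith

end Bins

/-! ### Overlaps of two replicas -/

section Overlap

variable {Ω V : Type*} [Fintype Ω] [Fintype V]

/-- Squares of Gibbs averages of products, written with two replicas `p`, `q`. -/
lemma sum_sq_gibbs (w : Ω → ℝ) (a b : V → Ω → ℝ) :
    ∑ i, ∑ j, gibbs w (fun p => a i p * b j p) ^ 2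
      = ∑ p, ∑ q, (Real.exp (w p) / ∑ r, Real.exp (w r)) * (Real.exp (w q) / ∑ r, Real.exp (w r))
          * ((∑ i, a i p * a i q) * ∑ j, b j p * b j q) := by
  set W : Ω → ℝ := fun p => Real.exp (w p) / ∑ r, Real.exp (w r) with hW
  have h : ∀ F : Ω → ℝ, gibbs w F = ∑ p, W p * F p := fun F => by
    rw [gibbs, Finset.sum_div]
    exact Finset.sum_congr rfl fun p _ => by simp only [hW]; ring
  have hl : ∀ i j, gibbs w (fun p => a i p * b j p) ^ 2
      = ∑ p, ∑ q, W p * W q * ((a i p * a i q) * (b j p * b j q)) := fun i j => by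
    rw [h, sq, Finset.sum_mul_sum]
    exact Finset.sum_congr rfl fun p _ => Finset.sum_congr rfl fun q _ => by ring
  have hr : ∀ p q, W p * W q * ((∑ i, a i p * a i q) * ∑ j, b j p * b j q)
      = ∑ i, ∑ j, W p * W q * ((a i p * a i q) * (b j p * b j q)) := fun p q => by
    simp only [Finset.sum_mul_sum, Finset.mul_sum (a := W p * W q)]
  change _ = ∑ p, ∑ q, W p * W q * ((∑ i, a i p * a i q) * ∑ j, b j p * b j q)
  simp_rw [hl, hr]
  have h1 : ∀ G : V → V → Ω → Ω → ℝ, ∑ i, ∑ j, ∑ p, ∑ q, G i j p q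
      = ∑ p, ∑ q, ∑ i, ∑ j, G i j p q := fun G => by
    calc _ = ∑ x : V × V, ∑ y : Ω × Ω, G x.1 x.2 y.1 y.2 := by simp only [Fintype.sum_prod_type]
      _ = ∑ y : Ω × Ω, ∑ x : V × V, G x.1 x.2 y.1 y.2 := Finset.sum_comm
      _ = _ := by simp only [Fintype.sum_prod_type]
  exact h1 _

/-- The overlap form of Guerra's comparison: with `X`, `Y` the overlaps of two replicas in either
block, the difference of the two sides is the average of `(X - Y)²`. -/
lemma two_mul_sum_sq_gibbs_le (w : Ω → ℝ) (a b : V → Ω → ℝ) :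
    2 * ∑ i, ∑ j, gibbs w (fun p => a i p * b j p) ^ 2
      ≤ ∑ i, ∑ j, gibbs w (fun p => a i p * a j p) ^ 2
        + ∑ i, ∑ j, gibbs w (fun p => b i p * b j p) ^ 2 := by
  rw [sum_sq_gibbs, sum_sq_gibbs, sum_sq_gibbs, Finset.mul_sum, ← Finset.sum_add_distrib]
  refine Finset.sum_le_sum fun p _ => ?_
  rw [Finset.mul_sum, ← Finset.sum_add_distrib]
  refine Finset.sum_le_sum fun q _ => ?_
  set X := ∑ i, a i p * a i q
  set Y := ∑ i, b i p * b i q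
  have hz : 0 ≤ (Real.exp (w p) / ∑ r, Real.exp (w r)) * (Real.exp (w q) / ∑ r, Real.exp (w r)) := by
    positivity
  nlinarith [mul_nonneg hz (sq_nonneg (X - Y))]

end Overlap

/-! ### Two blocks with couplings between all pairs of sites -/

lemma logZ_subtype_le {Ω : Type*} [Fintype Ω] {P : Ω → Prop} [DecidablePred P]
    [Nonempty {σ // P σ}] (w : Ω → ℝ) : logZ (fun σ : {σ // P σ} => w σ.1) ≤ logZ w := by
  refine Real.log_le_log (sum_exp_pos _) ?_
  rw [← Finset.sum_subtype (Finset.univ.filter P) (by simp) fun σ => Real.exp (w σ)]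
  exact Finset.sum_le_sum_of_subset_of_nonneg (Finset.subset_univ _)
    fun _ _ _ => (Real.exp_pos _).le

section Doubling

variable {Ω V E : Type*} [CommGroup Ω]

/-- The couplings of a block: the given ones, and one for each ordered pair of sites. -/
def blockChar (χ : E → Ω →* ℤˣ) (s : V → Ω →* ℤˣ) : E ⊕ (V × V) → Ω →* ℤˣ :=
  Sum.elim χ fun q => s q.1 * s q.2

/-- The signal-to-noise ratios `τ` for the given couplings of a block, `T` for those between pairs
of sites. -/
def blockSnr (τ : E → ℝ≥0) (T : ℝ≥0) : E ⊕ (V × V) → ℝ≥0 := Sum.elim τ fun _ => T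

/-- The product of a spin of the left block and a spin of the right block. -/
def crossChar (s : V → Ω →* ℤˣ) (q : V × V) : Ω × Ω →* ℤˣ :=
  (s q.1).comp (MonoidHom.fst Ω Ω) * (s q.2).comp (MonoidHom.snd Ω Ω)

/-- The couplings of two blocks: those within either block, and two for each pair consisting of a
site of the left block and a site of the right block. -/
def pairChar (χ : E → Ω →* ℤˣ) (s : V → Ω →* ℤˣ) :
    (E ⊕ E) ⊕ ((V × V) ⊕ (V × V)) → Ω × Ω →* ℤˣ :=
  Sum.elim (Sum.elim (fun e => (χ e).comp (MonoidHom.fst Ω Ω))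
    fun e => (χ e).comp (MonoidHom.snd Ω Ω)) (Sum.elim (crossChar s) (crossChar s))

/-- The signal-to-noise ratios `τ` within either block, `U` between the blocks. -/
def pairSnr (τ : E → ℝ≥0) (U : ℝ≥0) : (E ⊕ E) ⊕ ((V × V) ⊕ (V × V)) → ℝ≥0 :=
  Sum.elim (Sum.elim τ τ) fun _ => U

lemma ev_crossChar (s : V → Ω →* ℤˣ) (q : V × V) (p : Ω × Ω) :
    ev (crossChar s q) p = ev (s q.1) p.1 * ev (s q.2) p.2 := ev_mul_apply _ _ _

variable [Fintype V]

/-- The total spin of a block. -/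
def totalSpin (s : V → Ω →* ℤˣ) (σ : Ω) : ℝ := ∑ v, ev (s v) σ

lemma sum_ev_mul_ev (s : V → Ω →* ℤˣ) (σ σ' : Ω) :
    ∑ q : V × V, ev (s q.1) σ * ev (s q.2) σ' = totalSpin s σ * totalSpin s σ' := by
  rw [totalSpin, totalSpin, Finset.sum_mul_sum, Fintype.sum_prod_type]

variable [Fintype E]

lemma energy_pairChar (χ : E → Ω →* ℤˣ) (s : V → Ω →* ℤˣ)
    (h : (E ⊕ E) ⊕ ((V × V) ⊕ (V × V)) → ℝ) (p : Ω × Ω) :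
    energy (pairChar χ s) h p = energy χ (fun e => h (.inl (.inl e))) p.1
      + energy χ (fun e => h (.inl (.inr e))) p.2
      + ∑ q, (h (.inr (.inl q)) + h (.inr (.inr q))) * (ev (s q.1) p.1 * ev (s q.2) p.2) := by
  simp only [energy, Fintype.sum_sum_type, pairChar, Sum.elim_inl, Sum.elim_inr, ev_crossChar,
    add_mul, Finset.sum_add_distrib]
  rfl

lemma energy_blockChar (χ : E → Ω →* ℤˣ) (s : V → Ω →* ℤˣ) (h : E ⊕ (V × V) → ℝ) (σ : Ω) :
    energy (blockChar χ s) h σ = energy χ (fun e => h (.inl e)) σ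
      + ∑ q, h (.inr q) * (ev (s q.1) σ * ev (s q.2) σ) := by
  simp only [energy, Fintype.sum_sum_type, blockChar, Sum.elim_inl, Sum.elim_inr, ev_mul_apply]

lemma energy_pairChar_ae (χ : E → Ω →* ℤˣ) (s : V → Ω →* ℤˣ) (τ : E → ℝ≥0) :
    ∀ᵐ h ∂nishimoriLaw (pairSnr (V := V) τ 0), ∀ p, energy (pairChar χ s) h p
      = energy χ (fun e => h (.inl (.inl e))) p.1 + energy χ (fun e => h (.inl (.inr e))) p.2 := by
  filter_upwards [ae_eq_zero_of_eq_zero (pairSnr (V := V) τ 0)] with h hh p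
  rw [energy_pairChar]
  simp [hh _ (show pairSnr (V := V) τ 0 (.inr _) = 0 from rfl)]

lemma measurePreserving_pairSnr_left (τ : E → ℝ≥0) (U : ℝ≥0) :
    MeasurePreserving (fun (h : (E ⊕ E) ⊕ ((V × V) ⊕ (V × V)) → ℝ) e => h (.inl (.inl e)))
      (nishimoriLaw (pairSnr (V := V) τ U)) (nishimoriLaw τ) :=
  measurePreserving_comp_injective (φ := fun e : E => Sum.inl (Sum.inl e))
    (Sum.inl_injective.comp Sum.inl_injective) _ (pairSnr (V := V) τ U)

lemma measurePreserving_pairSnr_right (τ : E → ℝ≥0) (U : ℝ≥0) :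
    MeasurePreserving (fun (h : (E ⊕ E) ⊕ ((V × V) ⊕ (V × V)) → ℝ) e => h (.inl (.inr e)))
      (nishimoriLaw (pairSnr (V := V) τ U)) (nishimoriLaw τ) :=
  measurePreserving_comp_injective (φ := fun e : E => Sum.inl (Sum.inr e))
    (Sum.inl_injective.comp Sum.inr_injective) _ (pairSnr (V := V) τ U)

variable [Fintype Ω]

lemma integral_logZ_left (χ : E → Ω →* ℤˣ) (τ : E → ℝ≥0) (U : ℝ≥0) :
    Integrable (fun h => logZ (energy χ fun e => h (.inl (.inl e))))
      (nishimoriLaw (pairSnr (V := V) τ U)) ∧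
    ∫ h, logZ (energy χ fun e => h (.inl (.inl e))) ∂nishimoriLaw (pairSnr (V := V) τ U)
      = freeEnergy χ τ :=
  ⟨(measurePreserving_pairSnr_left τ U).integrable_comp_of_integrable
    ((expBounded_logZ_energy χ).integrable _ _),
  (integral_of_measurePreserving (measurePreserving_pairSnr_left τ U)
    (expBounded_logZ_energy χ).1).symm⟩

lemma integral_logZ_right (χ : E → Ω →* ℤˣ) (τ : E → ℝ≥0) (U : ℝ≥0) :
    Integrable (fun h => logZ (energy χ fun e => h (.inl (.inr e))))
      (nishimoriLaw (pairSnr (V := V) τ U)) ∧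
    ∫ h, logZ (energy χ fun e => h (.inl (.inr e))) ∂nishimoriLaw (pairSnr (V := V) τ U)
      = freeEnergy χ τ :=
  ⟨(measurePreserving_pairSnr_right τ U).integrable_comp_of_integrable
    ((expBounded_logZ_energy χ).integrable _ _),
  (integral_of_measurePreserving (measurePreserving_pairSnr_right τ U)
    (expBounded_logZ_energy χ).1).symm⟩

/-- Without couplings between them, the two blocks are independent. -/
lemma freeEnergy_pairChar (χ : E → Ω →* ℤˣ) (s : V → Ω →* ℤˣ) (τ : E → ℝ≥0) :
    freeEnergy (pairChar χ s) (pairSnr τ 0) = 2 * freeEnergy χ τ := by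
  have h1 := integral_logZ_left (V := V) χ τ 0
  have h2 := integral_logZ_right (V := V) χ τ 0
  rw [two_mul]
  conv_rhs => rw [← h1.2]
  nth_rewrite 2 [h1.2]
  rw [← h2.2, ← integral_add h1.1 h2.1]
  refine integral_congr_ae ?_
  filter_upwards [energy_pairChar_ae χ s τ] with h hh
  rw [funext hh, logZ, logZ, logZ,
    ← Real.log_mul (sum_exp_pos _).ne' (sum_exp_pos _).ne', Finset.sum_mul_sum,
    Fintype.sum_prod_type]
  simp only [Real.exp_add]

lemma expBounded_logZ_subtype {P : Ω → Prop} [DecidablePred P] [Nonempty {σ // P σ}]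
    (χ : E → Ω →* ℤˣ) : ExpBounded fun h => logZ fun σ : {σ // P σ} => energy χ h σ.1 :=
  .of_lipschitz fun h k => abs_logZ_sub_le fun σ => abs_energy_sub_le χ h k σ.1

variable [DecidableEq V] [DecidableEq E]

/-- **Guerra interpolation** between the couplings joining two blocks and couplings within either
block. On pairs of configurations whose total spins almost agree, replacing the former by the latter
changes the mean of the energy by at most `c`, and it lowers the free energy because the variances
are the same but the covariances of distinct configurations increase. -/
theorem integral_logZ_subtype_sub_le (χ : E → Ω →* ℤˣ) (s : V → Ω →* ℤˣ) (τ : E → ℝ≥0) (T : ℝ≥0)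
    {P : Ω × Ω → Prop} [DecidablePred P] [Nonempty {p // P p}] {c : ℝ}
    (hc : ∀ p, P p → T * (totalSpin s p.1 - totalSpin s p.2) ^ 2 ≤ c) :
    ∫ h, logZ (fun p : {p // P p} => energy (pairChar (blockChar χ s) s) h p.1)
        ∂nishimoriLaw (pairSnr (blockSnr τ T) 0) - c
      ≤ ∫ h, logZ (fun p : {p // P p} => energy (pairChar (blockChar χ s) s) h p.1)
        ∂nishimoriLaw (pairSnr (blockSnr τ 0) T) := by
  set X := pairChar (blockChar χ s) s with hX
  set τC : ((E ⊕ V × V) ⊕ (E ⊕ V × V)) ⊕ ((V × V) ⊕ (V × V)) → ℝ≥0 :=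
    pairSnr (blockSnr τ 0) T with hτC
  set τS : ((E ⊕ V × V) ⊕ (E ⊕ V × V)) ⊕ ((V × V) ⊕ (V × V)) → ℝ≥0 :=
    pairSnr (blockSnr τ T) 0 with hτS
  -- The amplitudes along the path: `cos θ` within either block, `sin θ` between the blocks.
  set blk : ℝ → E ⊕ (V × V) → ℝ := fun θ =>
    Sum.elim (fun e => √(τ e : ℝ)) fun _ => Real.cos θ * √(T : ℝ) with hblk
  set blk' : ℝ → E ⊕ (V × V) → ℝ := fun θ =>
    Sum.elim (fun _ => 0) fun _ => -Real.sin θ * √(T : ℝ) with hblk'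
  set a : ℝ → ((E ⊕ V × V) ⊕ (E ⊕ V × V)) ⊕ ((V × V) ⊕ (V × V)) → ℝ := fun θ =>
    Sum.elim (Sum.elim (blk θ) (blk θ)) fun _ => Real.sin θ * √(T : ℝ) with ha
  set a' : ℝ → ((E ⊕ V × V) ⊕ (E ⊕ V × V)) ⊕ ((V × V) ⊕ (V × V)) → ℝ := fun θ =>
    Sum.elim (Sum.elim (blk' θ) (blk' θ)) fun _ => Real.cos θ * √(T : ℝ) with ha'
  have had : ∀ θ e, HasDerivAt (fun θ => a θ e) (a' θ e) θ := by
    rintro θ (((e | q) | (e | q)) | q)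
    · exact hasDerivAt_const _ _
    · exact (Real.hasDerivAt_cos θ).mul_const _
    · exact hasDerivAt_const _ _
    · exact (Real.hasDerivAt_cos θ).mul_const _
    · exact (Real.hasDerivAt_sin θ).mul_const _
  have hac' : ∀ e, Continuous fun θ => a' θ e := by
    rintro (((e | q) | (e | q)) | q)
    · exact continuous_const
    · exact Real.continuous_sin.neg.mul continuous_const
    · exact continuous_const
    · exact Real.continuous_sin.neg.mul continuous_const
    · exact Real.continuous_cos.mul continuous_const
  -- The mean of the energy is kept fixed along the path, at its value for coupled blocks.
  set A : {p // P p} → ℝ := fun p => energy X (fun e => (τC e : ℝ)) p.1 with hA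
  have key := fun θ => hasDerivAt_integral_logZ (Ω := {p // P p})
    (E := ((E ⊕ V × V) ⊕ (E ⊕ V × V)) ⊕ ((V × V) ⊕ (V × V)))
    (A := fun _ => A) (A' := fun _ _ => 0) (B := fun θ e p => a θ e * ev (X e) p.1)
    (B' := fun θ e p => a' θ e * ev (X e) p.1) (fun _ _ => hasDerivAt_const _ _)
    (fun θ e p => (had θ e).mul_const _) continuous_const
    (continuous_pi fun e => continuous_pi fun p => (hac' e).mul continuous_const) θ
  set w : ℝ → (((E ⊕ V × V) ⊕ (E ⊕ V × V)) ⊕ ((V × V) ⊕ (V × V)) → ℝ) → {p // P p} → ℝ :=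
    fun θ g p => A p + ∑ e, g e * (a θ e * ev (X e) p.1) with hw
  set Φ : ℝ → ℝ := fun θ => ∫ g, logZ (w θ g)
    ∂gaussianPi (fun _ : ((E ⊕ V × V) ⊕ (E ⊕ V × V)) ⊕ ((V × V) ⊕ (V × V)) => 0) (fun _ => 1)
    with hΦ
  have hmono : MonotoneOn Φ (Set.Icc 0 (Real.pi / 2)) := by
    refine monotoneOn_of_deriv_nonneg (convex_Icc _ _)
      (fun θ _ => (key θ).continuousAt.continuousWithinAt)
      (fun θ _ => (key θ).differentiableAt.differentiableWithinAt) fun θ hθ => ?_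
    rw [interior_Icc] at hθ
    rw [(key θ).deriv]
    refine integral_nonneg fun g => ?_
    have hBB : ∀ e, (fun p : {p // P p} => a' θ e * ev (X e) p.1 * (a θ e * ev (X e) p.1))
        = fun _ => a' θ e * a θ e := fun e => by
      ext p
      rw [mul_mul_mul_comm, ev_mul_self, mul_one]
    simp only [hBB, gibbs_const, gibbs_const_mul, Pi.zero_apply, zero_add]
    have hsum : ∑ e, (a' θ e * a θ e - a' θ e * gibbs (w θ g) (fun p => ev (X e) p.1)
          * (a θ e * gibbs (w θ g) (fun p => ev (X e) p.1)))
        = Real.sin θ * Real.cos θ * T *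
          ((∑ q : V × V, gibbs (w θ g) (fun p => ev (s q.1) p.1.1 * ev (s q.2) p.1.1) ^ 2
            + ∑ q : V × V, gibbs (w θ g) (fun p => ev (s q.1) p.1.2 * ev (s q.2) p.1.2) ^ 2)
            - 2 * ∑ q : V × V,
              gibbs (w θ g) (fun p => ev (s q.1) p.1.1 * ev (s q.2) p.1.2) ^ 2) := by
      have hTT : √(T : ℝ) * √(T : ℝ) = T := Real.mul_self_sqrt T.2
      simp only [Fintype.sum_sum_type, ha, ha', hblk, hblk', Sum.elim_inl, Sum.elim_inr, hX,
        pairChar, blockChar, ev_crossChar, zero_mul, sub_zero, Finset.sum_const_zero, zero_add]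
      have e1 : ∀ q : V × V, (fun p : {p // P p} =>
          ev ((s q.1 * s q.2).comp (MonoidHom.fst Ω Ω)) p.1)
          = fun p => ev (s q.1) p.1.1 * ev (s q.2) p.1.1 := fun q => by
        ext p; exact ev_mul_apply _ _ _
      have e2 : ∀ q : V × V, (fun p : {p // P p} =>
          ev ((s q.1 * s q.2).comp (MonoidHom.snd Ω Ω)) p.1)
          = fun p => ev (s q.1) p.1.2 * ev (s q.2) p.1.2 := fun q => by
        ext p; exact ev_mul_apply _ _ _
      simp only [e1, e2]
      rw [two_mul, mul_sub, mul_add, mul_add]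
      simp only [Finset.mul_sum, ← Finset.sum_add_distrib, ← Finset.sum_sub_distrib]
      refine Finset.sum_congr rfl fun q _ => ?_
      generalize √(T : ℝ) = r at hTT ⊢
      rw [← hTT]
      ring
    rw [hsum]
    refine mul_nonneg (mul_nonneg (mul_nonneg (Real.sin_nonneg_of_nonneg_of_le_pi hθ.1.le
      (by linarith [hθ.2, Real.pi_pos])) (Real.cos_nonneg_of_mem_Icc
        ⟨by linarith [hθ.1, Real.pi_pos], hθ.2.le⟩)) T.2) (sub_nonneg.2 ?_)
    simp only [Fintype.sum_prod_type]
    exact two_mul_sum_sq_gibbs_le (w θ g) (fun i p => ev (s i) p.1.1) fun i p => ev (s i) p.1.2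
  have h01 := hmono ⟨le_rfl, by positivity⟩ ⟨by positivity, le_rfl⟩
    (show (0 : ℝ) ≤ Real.pi / 2 by positivity)
  have hstd : ∀ (τ' : ((E ⊕ V × V) ⊕ (E ⊕ V × V)) ⊕ ((V × V) ⊕ (V × V)) → ℝ≥0) (θ : ℝ),
      (∀ e, a θ e = √(τ' e : ℝ)) → ∀ g, (fun p : {p // P p} =>
        energy X (fun e => (τ' e : ℝ) + √(τ' e : ℝ) * g e) p.1)
        = fun p => w θ g p + (energy X (fun e => (τ' e : ℝ)) p.1 - A p) := by
    intro τ' θ h g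
    ext p
    simp only [hw, ← h]
    simp only [energy, add_mul, Finset.sum_add_distrib]
    have : ∑ e, a θ e * g e * ev (X e) p.1 = ∑ e, g e * (a θ e * ev (X e) p.1) :=
      Finset.sum_congr rfl fun e _ => by ring
    rw [this]
    ring
  have h1 : Φ (Real.pi / 2) = ∫ h, logZ (fun p : {p // P p} => energy X h p.1)
      ∂nishimoriLaw τC := by
    rw [integral_nishimoriLaw_eq_std τC (expBounded_logZ_subtype X).1]
    simp_rw [hstd τC (Real.pi / 2) (by
      rintro (((e | q) | (e | q)) | q) <;> simp [ha, hblk, hτC, pairSnr, blockSnr])]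
    simp only [hA, sub_self, add_zero, hΦ]
  have h0 : ∫ h, logZ (fun p : {p // P p} => energy X h p.1) ∂nishimoriLaw τS - c ≤ Φ 0 := by
    rw [integral_nishimoriLaw_eq_std τS (expBounded_logZ_subtype X).1]
    simp_rw [hstd τS 0 (by
      rintro (((e | q) | (e | q)) | q) <;> simp [ha, hblk, hτS, pairSnr, blockSnr])]
    have hdiff : ∀ p : {p // P p}, energy X (fun e => (τS e : ℝ)) p.1 - A p
        = T * (totalSpin s p.1.1 - totalSpin s p.1.2) ^ 2 := fun p => by
      simp only [hA, hX, energy_pairChar, energy_blockChar, hτS, hτC, pairSnr, blockSnr,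
        Sum.elim_inl, Sum.elim_inr, NNReal.coe_zero, zero_mul, add_zero, Finset.sum_const_zero,
        ← Finset.mul_sum, sum_ev_mul_ev]
      ring
    have hle : ∀ g, logZ (fun p => w 0 g p + (energy X (fun e => (τS e : ℝ)) p.1 - A p))
        ≤ logZ (w 0 g) + c := fun g => by
      rw [← logZ_add_const]
      refine logZ_mono fun p => ?_
      rw [hdiff]
      linarith [hc p.1 p.2]
    have hi : ∀ b : {p // P p} → ℝ, Integrable (fun g => logZ fun p => w 0 g p + b p)
        (gaussianPi (fun _ : ((E ⊕ V × V) ⊕ (E ⊕ V × V)) ⊕ ((V × V) ⊕ (V × V)) => 0)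
          (fun _ => 1)) := fun b => by
      have := expBounded_logZ (fun p => A p + b p) (fun e p => a 0 e * ev (X e) p.1)
      refine (this.integrable _ _).congr (ae_of_all _ fun g => ?_)
      simp only [hw]
      congr 1
      ext p
      ring
    have hi0 := hi 0
    simp only [Pi.zero_apply, add_zero] at hi0
    have := integral_mono (hi _) (hi0.add (integrable_const c)) hle
    simp only [Pi.add_apply] at this
    rw [integral_add (f := fun g => logZ (w 0 g)) (g := fun _ => c) hi0 (integrable_const c)]
      at this
    simp only [integral_const, probReal_univ, smul_eq_mul, one_mul] at this
    linarith
  linarith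

end Doubling

/-! ### Soft maxima of functions of Gaussian variables -/

lemma integral_log_le_log {α : Type*} {mα : MeasurableSpace α} {μ : Measure α}
    [IsProbabilityMeasure μ] {X : α → ℝ} (hX : ∀ a, 0 < X a) (hi : Integrable X μ)
    (hl : Integrable (fun a => Real.log (X a)) μ) {c : ℝ} (hc : 0 < c) (h : ∫ a, X a ∂μ ≤ c) :
    ∫ a, Real.log (X a) ∂μ ≤ Real.log c := by
  have h1 : ∀ a, Real.log (X a) ≤ Real.log c + (X a / c - 1) := fun a => by
    have := Real.log_le_sub_one_of_pos (div_pos (hX a) hc)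
    rw [Real.log_div (hX a).ne' hc.ne'] at this
    linarith
  calc _ ≤ ∫ a, (Real.log c + (X a / c - 1)) ∂μ :=
        integral_mono hl ((integrable_const _).add ((hi.div_const _).sub (integrable_const _))) h1
    _ = Real.log c + ((∫ a, X a ∂μ) / c - 1) := by
        rw [integral_add (g := fun a => X a / c - 1) (integrable_const _)
            ((hi.div_const _).sub (integrable_const _)),
          integral_sub (hi.div_const _) (integrable_const _), integral_div]
        simp
    _ ≤ Real.log c := by
        have := (div_le_one hc).2 h
        linarith

section Softmax

variable {E ι : Type*} [Fintype E] [Fintype ι] [Nonempty ι]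

lemma abs_inv_mul_logZ_sub_le {d d' : ι → ℝ} {t c : ℝ} (ht : 0 < t) (h : ∀ i, |d i - d' i| ≤ c) :
    |(t⁻¹ * logZ fun i => t * d i) - t⁻¹ * logZ fun i => t * d' i| ≤ c := by
  rw [← mul_sub, abs_mul, abs_of_pos (inv_pos.2 ht), inv_mul_le_iff₀ ht]
  refine abs_logZ_sub_le fun i => ?_
  rw [← mul_sub, abs_mul, abs_of_pos ht]
  exact mul_le_mul_of_nonneg_left (h i) ht.le

/-- A bound on the expected soft maximum of finitely many centred Lipschitz functions of independent Gaussian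
variables. -/
lemma integral_inv_mul_logZ_le (m : E → ℝ) (v : E → ℝ≥0) {d : ι → (E → ℝ) → ℝ}
    (hd : ∀ i h k, |d i h - d i k| ≤ ∑ e, |h e - k e|) (h0 : ∀ i, ∫ h, d i h ∂gaussianPi m v = 0)
    {t : ℝ} (ht : 0 < t) :
    ∫ h, t⁻¹ * logZ (fun i => t * d i h) ∂gaussianPi m v
      ≤ t⁻¹ * (Real.log (Fintype.card ι) + t ^ 2 * ∑ e, (v e : ℝ)) := by
  have hcard : (0 : ℝ) < Fintype.card ι := by exact_mod_cast Fintype.card_pos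
  have hb : ∀ i, ExpBounded fun h => Real.exp (t * d i h) := fun i => by
    simpa using ExpBounded.exp_of_lipschitz (hd i) t 0
  have hL : Integrable (fun h => logZ fun i => t * d i h) (gaussianPi m v) := by
    have := ((ExpBounded.of_lipschitz (F := fun h => t⁻¹ * logZ fun i => t * d i h) fun h k =>
      abs_inv_mul_logZ_sub_le ht fun i => hd i h k).const_mul t).integrable m v
    simpa [← mul_assoc, mul_inv_cancel₀ ht.ne'] using this
  rw [integral_const_mul]
  refine mul_le_mul_of_nonneg_left ?_ (inv_pos.2 ht).le
  refine (integral_log_le_log (c := Fintype.card ι * Real.exp (t ^ 2 * ∑ e, (v e : ℝ)))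
    (fun h => sum_exp_pos _) ((ExpBounded.sum _ fun i _ => hb i).integrable m v) hL
    (mul_pos hcard (Real.exp_pos _)) ?_).trans (le_of_eq ?_)
  · rw [integral_finsetSum _ fun i _ => (hb i).integrable m v]
    refine (Finset.sum_le_card_nsmul _ _ (Real.exp (t ^ 2 * ∑ e, (v e : ℝ))) fun i _ => ?_).trans
      (le_of_eq (by rw [nsmul_eq_mul, Finset.card_univ]))
    have := integral_exp_sub_integral_le m v t (hd i)
    simpa only [h0 i, sub_zero] using this
  · rw [Real.log_mul hcard.ne' (Real.exp_pos _).ne', Real.log_exp]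

end Softmax

/-! ### The order of a pair of blocks -/

section Doubling

variable {Ω V E ι : Type*} [CommGroup Ω] [Fintype Ω] [Fintype V] [Fintype E] [Fintype ι]
  [DecidableEq ι]

lemma sum_pairSnr_zero (τ : E → ℝ≥0) :
    ∑ e, (pairSnr (V := V) τ 0 e : ℝ) = 2 * ∑ e, (τ e : ℝ) := by
  simp [Fintype.sum_sum_type, pairSnr, two_mul]

/-- For two independent blocks, little free energy is lost by restricting to pairs of configurations
in the same bin. -/
theorem two_mul_freeEnergy_le (χ : E → Ω →* ℤˣ) (s : V → Ω →* ℤˣ) (τ : E → ℝ≥0) (bin : Ω → ι)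
    {t : ℝ} (ht : 0 < t) :
    2 * freeEnergy χ τ
      ≤ ∫ h, logZ (fun p : {p : Ω × Ω // bin p.1 = bin p.2} => energy (pairChar χ s) h p.1)
          ∂nishimoriLaw (pairSnr τ 0) + Real.log (Fintype.card ι)
        + t⁻¹ * (Real.log (Fintype.card ι) + 2 * t ^ 2 * ∑ e, (τ e : ℝ)) := by
  have : Nonempty ι := ⟨bin 1⟩
  have : Nonempty {p : Ω × Ω // bin p.1 = bin p.2} := ⟨(1, 1), rfl⟩
  set X := fun e => (pairSnr (V := V) τ 0 e : ℝ)
  set L : ((E ⊕ E) ⊕ ((V × V) ⊕ (V × V)) → ℝ) → ι → ℝ := fun h i =>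
    Real.log (binZ bin (energy χ fun e => h (.inl (.inl e))) i) with hL
  set R : ((E ⊕ E) ⊕ ((V × V) ⊕ (V × V)) → ℝ) → ι → ℝ := fun h i =>
    Real.log (binZ bin (energy χ fun e => h (.inl (.inr e))) i) with hR
  have hblip : ∀ i (h k : E → ℝ), |Real.log (binZ bin (energy χ h) i)
      - Real.log (binZ bin (energy χ k) i)| ≤ ∑ e, |h e - k e| := fun i h k =>
    abs_log_binZ_sub_le bin (Finset.sum_nonneg fun _ _ => abs_nonneg _)
      (fun σ => abs_energy_sub_le χ h k σ) i
  have hLlip : ∀ i h k, |L h i - L k i|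
      ≤ ∑ e, |h (.inl (.inl e)) - k (.inl (.inl e))| := fun i h k =>
    hblip i (fun e => h (.inl (.inl e))) fun e => k (.inl (.inl e))
  have hRlip : ∀ i h k, |R h i - R k i|
      ≤ ∑ e, |h (.inl (.inr e)) - k (.inl (.inr e))| := fun i h k =>
    hblip i (fun e => h (.inl (.inr e))) fun e => k (.inl (.inr e))
  have hsum : ∀ h k : (E ⊕ E) ⊕ ((V × V) ⊕ (V × V)) → ℝ,
      ∑ e, |h (.inl (.inl e)) - k (.inl (.inl e))| + ∑ e, |h (.inl (.inr e)) - k (.inl (.inr e))|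
        ≤ ∑ e, |h e - k e| := fun h k => by
    rw [Fintype.sum_sum_type (fun e => |h e - k e|), Fintype.sum_sum_type]
    exact le_add_of_nonneg_right (Finset.sum_nonneg fun _ _ => abs_nonneg _)
  have hLR : ∀ i h k, |(L h i - R h i) - (L k i - R k i)| ≤ ∑ e, |h e - k e| := fun i h k => by
    refine le_trans ?_ ((add_le_add (hLlip i h k) (hRlip i h k)).trans (hsum h k))
    rw [sub_sub_sub_comm]
    exact abs_sub _ _
  have hRL : ∀ i h k, |(R h i - L h i) - (R k i - L k i)| ≤ ∑ e, |h e - k e| := fun i h k => by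
    rw [← abs_neg]
    refine le_trans (le_of_eq ?_) (hLR i h k)
    congr 1
    ring
  -- The free energies of a bin have the same law in both blocks.
  have hLint : ∀ i, Integrable (fun h => L h i) (nishimoriLaw (pairSnr τ 0)) := fun i =>
    (ExpBounded.of_lipschitz fun h k => (hLlip i h k).trans ((le_add_of_nonneg_right
      (Finset.sum_nonneg fun _ _ => abs_nonneg _)).trans (hsum h k))).integrable _ _
  have hRint : ∀ i, Integrable (fun h => R h i) (nishimoriLaw (pairSnr τ 0)) := fun i =>
    (ExpBounded.of_lipschitz fun h k => (hRlip i h k).trans ((le_add_of_nonneg_left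
      (Finset.sum_nonneg fun _ _ => abs_nonneg _)).trans (hsum h k))).integrable _ _
  have hLReq : ∀ i, ∫ h, L h i ∂nishimoriLaw (pairSnr (V := V) τ 0)
      = ∫ h, R h i ∂nishimoriLaw (pairSnr (V := V) τ 0) := fun i => by
    rw [← integral_of_measurePreserving (measurePreserving_pairSnr_left τ 0)
        (ExpBounded.of_lipschitz (hblip i)).1,
      ← integral_of_measurePreserving (measurePreserving_pairSnr_right τ 0)
        (ExpBounded.of_lipschitz (hblip i)).1]
  have hP := integral_inv_mul_logZ_le X (pairSnr (V := V) τ 0) (d := fun i h => L h i - R h i) hLR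
    (fun i => by rw [integral_sub (hLint i) (hRint i), hLReq, sub_self]) ht
  have hN := integral_inv_mul_logZ_le X (pairSnr (V := V) τ 0) (d := fun i h => R h i - L h i) hRL
    (fun i => by rw [integral_sub (hRint i) (hLint i), hLReq, sub_self]) ht
  have hPi : Integrable (fun h => t⁻¹ * logZ fun i => t * (L h i - R h i))
      (nishimoriLaw (pairSnr τ 0)) := (ExpBounded.of_lipschitz fun h k =>
    abs_inv_mul_logZ_sub_le ht fun i => hLR i h k).integrable _ _
  have hNi : Integrable (fun h => t⁻¹ * logZ fun i => t * (R h i - L h i))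
      (nishimoriLaw (pairSnr τ 0)) := (ExpBounded.of_lipschitz fun h k =>
    abs_inv_mul_logZ_sub_le ht fun i => hRL i h k).integrable _ _
  have h1 := integral_logZ_left (V := V) χ τ 0
  have h2 := integral_logZ_right (V := V) χ τ 0
  have hD := (expBounded_logZ_subtype (P := fun p : Ω × Ω => bin p.1 = bin p.2)
    (pairChar χ s)).integrable (fun e => (pairSnr τ 0 e : ℝ)) (pairSnr τ 0)
  have hDc : Integrable (fun h => logZ (fun p : {p : Ω × Ω // bin p.1 = bin p.2} =>
      energy (pairChar χ s) h p.1) + Real.log (Fintype.card ι)) (nishimoriLaw (pairSnr τ 0)) :=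
    hD.add (integrable_const _)
  have key := integral_mono_ae (h1.1.add h2.1) (hDc.add ((hPi.add hNi).div_const 2)) (by
    filter_upwards [energy_pairChar_ae χ s τ] with h hh
    have := logZ_add_logZ_le bin (energy χ fun e => h (.inl (.inl e)))
      (energy χ fun e => h (.inl (.inr e))) ht
    simp only [← hh] at this
    exact this)
  simp only [Pi.add_apply] at key
  rw [integral_add h1.1 h2.1, h1.2, h2.2,
    integral_add hDc (g := fun h => (t⁻¹ * logZ (fun i => t * (L h i - R h i))
      + t⁻¹ * logZ (fun i => t * (R h i - L h i))) / 2) ((hPi.add hNi).div_const 2),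
    integral_add hD (integrable_const _), integral_div, integral_add hPi hNi] at key
  simp only [integral_const, probReal_univ, smul_eq_mul, one_mul] at key
  rw [sum_pairSnr_zero] at hP hN
  have e : t ^ 2 * (2 * ∑ e, (τ e : ℝ)) = 2 * t ^ 2 * ∑ e, (τ e : ℝ) := by ring
  rw [e] at hP hN
  linarith

variable [DecidableEq V] [DecidableEq E]

/-- **Doubling a block.** Coupling two blocks by signal-to-noise ratio `T` on all pairs of sites
makes their total spins as correlated as the spins within one block, up to the resolution `c` of the
bins for the total spin, the logarithm of their number, and the fluctuation of the free energies. -/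
theorem sum_avg_block_le (χ : E → Ω →* ℤˣ) (s : V → Ω →* ℤˣ) (τ : E → ℝ≥0) (T : ℝ≥0) (bin : Ω → ι)
    {c : ℝ} (hc : ∀ σ σ', bin σ = bin σ' → T * (totalSpin s σ - totalSpin s σ') ^ 2 ≤ c)
    {t : ℝ} (ht : 0 < t) :
    T * ∑ q : V × V, avg (blockChar χ s) (blockSnr τ 0) (s q.1 * s q.2)
      ≤ T * ∑ q : V × V,
          avg (pairChar (blockChar χ s) s) (pairSnr (blockSnr τ 0) T) (crossChar s q)
        + (c + Real.log (Fintype.card ι) + t⁻¹ * (Real.log (Fintype.card ι)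
          + 2 * t ^ 2 * ∑ e, (blockSnr (V := V) τ T e : ℝ))) := by
  have : Nonempty {p : Ω × Ω // bin p.1 = bin p.2} := ⟨(1, 1), rfl⟩
  -- Switching on the couplings between the blocks.
  have h1 := freeEnergy_sub_le (pairChar (blockChar χ s) s) (pairSnr (blockSnr τ 0) 0)
    (Finset.univ.map Function.Embedding.inr) T
  have hr : ∀ U, raise (pairSnr (V := V) (blockSnr τ 0) 0) (Finset.univ.map Function.Embedding.inr) U
      = pairSnr (blockSnr (V := V) τ 0) U := fun U => by
    ext e
    rcases e with e | e <;> simp [raise, pairSnr]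
  rw [hr, hr, freeEnergy_pairChar, Finset.sum_map, Fintype.sum_sum_type] at h1
  -- Switching on couplings between all pairs of sites of one block.
  have h2 := le_freeEnergy_sub (blockChar χ s) (blockSnr τ 0)
    (Finset.univ.map Function.Embedding.inr) T
  have hr2 : ∀ U, raise (blockSnr (V := V) τ 0) (Finset.univ.map Function.Embedding.inr) U
      = blockSnr (V := V) τ U := fun U => by
    ext e
    rcases e with e | e <;> simp [raise, blockSnr]
  rw [hr2, hr2, Finset.sum_map] at h2
  have h3 := integral_logZ_subtype_sub_le χ s τ T (P := fun p : Ω × Ω => bin p.1 = bin p.2)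
    (fun p hp => hc p.1 p.2 hp)
  have h4 := two_mul_freeEnergy_le (blockChar χ s) s (blockSnr τ T) bin ht
  have h5 : ∫ h, logZ (fun p : {p : Ω × Ω // bin p.1 = bin p.2} =>
        energy (pairChar (blockChar χ s) s) h p.1) ∂nishimoriLaw (pairSnr (blockSnr τ 0) T)
      ≤ freeEnergy (pairChar (blockChar χ s) s) (pairSnr (blockSnr τ 0) T) :=
    integral_mono ((expBounded_logZ_subtype _).integrable _ _)
      ((expBounded_logZ_energy _).integrable _ _) fun h => logZ_subtype_le _
  simp only [Function.Embedding.inr_apply, pairChar, blockChar, Sum.elim_inl, Sum.elim_inr,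
    Finset.sum_add_distrib] at h1 h2 h3 h4 h5 ⊢
  linarith

end Doubling

/-! ### The hierarchical model as a spin system on the Nishimori line -/

section Hierarchical

open DysonNishimori

/-- The sites `1, …, 2 ^ N`. -/
abbrev Site (N : ℕ) : Type := ↥(Finset.Ioc 0 (2 ^ N))

/-- The spin at the site `i`, as a character of the group of configurations (`1` at labels that are
not sites). -/
def spinChar (N i : ℕ) : Config N →* ℤˣ :=
  if h : i ∈ Finset.Ioc 0 (2 ^ N) then Pi.evalMonoidHom (fun _ : Site N => ℤˣ) ⟨i, h⟩ else 1

/-- The labels of the couplings of the model with `2 ^ N` sites: the level and a pair of sites in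
the same block of this level. -/
def edgeSet (N : ℕ) : Finset (ℕ × ℕ × ℕ) :=
  (Finset.Icc 1 N ×ˢ Finset.Ioc 0 (2 ^ N) ×ˢ Finset.Ioc 0 (2 ^ N)).filter fun e =>
    (e.2.1 - 1) / 2 ^ e.1 = (e.2.2 - 1) / 2 ^ e.1

/-- The couplings of the model with `2 ^ N` sites. -/
abbrev Edge (N : ℕ) : Type := ↥(edgeSet N)

/-- The pair of spins multiplied by a coupling. -/
def edgeChar (N : ℕ) (e : Edge N) : Config N →* ℤˣ := spinChar N e.1.2.1 * spinChar N e.1.2.2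

/-- The signal-to-noise ratio of a coupling of level `l`: the mean and the variance of `β J`. -/
noncomputable def levelSnr (α β : ℝ) (l : ℕ) : ℝ≥0 := Real.toNNReal (β ^ 2 * (b α l / 2 ^ (2 * l)))

/-- The signal-to-noise ratios of the couplings. -/
noncomputable def edgeSnr (α β : ℝ) (N : ℕ) (e : Edge N) : ℝ≥0 := levelSnr α β e.1.1

/-- The correlation `𝔼⟨σ_i σ_j⟩` in the model with `2 ^ N` sites. -/
noncomputable def corr (α β : ℝ) (N i j : ℕ) : ℝ :=
  avg (edgeChar N) (edgeSnr α β N) (spinChar N i * spinChar N j)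

lemma spinChar_apply {N i : ℕ} (h : i ∈ Finset.Ioc 0 (2 ^ N)) (s : Config N) :
    spinChar N i s = s ⟨i, h⟩ := by
  unfold spinChar; rw [dif_pos h]; rfl

lemma ev_spinChar {N i : ℕ} (h : i ∈ Finset.Ioc 0 (2 ^ N)) (s : Config N) :
    ev (spinChar N i) s = s.spin i := by
  unfold ev Config.spin
  rw [dif_pos h, spinChar_apply h]

lemma mem_edgeSet {N l i j : ℕ} : (l, i, j) ∈ edgeSet N ↔ (1 ≤ l ∧ l ≤ N) ∧
    (0 < i ∧ i ≤ 2 ^ N) ∧ (0 < j ∧ j ≤ 2 ^ N) ∧ (i - 1) / 2 ^ l = (j - 1) / 2 ^ l := by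
  simp [edgeSet, and_assoc]

lemma div_two_pow_eq {N k i : ℕ} (hi : i ∈ Finset.Ioc (k * 2 ^ N) (k * 2 ^ N + 2 ^ N)) :
    (i - 1) / 2 ^ N = k := by
  rw [Finset.mem_Ioc] at hi
  refine Nat.div_eq_of_lt_le (by lia) ?_
  rw [add_mul, one_mul]; lia

lemma div_two_pow_mono {l N x y : ℕ} (h : l ≤ N) (hxy : x / 2 ^ l = y / 2 ^ l) :
    x / 2 ^ N = y / 2 ^ N := by
  obtain ⟨d, rfl⟩ := Nat.exists_eq_add_of_le h
  rw [pow_add, ← Nat.div_div_eq_div_mul, ← Nat.div_div_eq_div_mul, hxy]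

/-- The recursion unfolded: at level `l` all pairs of sites in a common block of level `l`. -/
lemma blockHamiltonian_eq (J : Disorder) (σ : ℕ → ℝ) (N m : ℕ) :
    blockHamiltonian J σ N (m * 2 ^ N) = -∑ l ∈ Finset.Icc 1 N,
      ∑ i ∈ Finset.Ioc (m * 2 ^ N) (m * 2 ^ N + 2 ^ N),
        ∑ j ∈ Finset.Ioc (m * 2 ^ N) (m * 2 ^ N + 2 ^ N),
          if (i - 1) / 2 ^ l = (j - 1) / 2 ^ l then J (l, i, j) * σ i * σ j else 0 := by
  induction N generalizing m with
  | zero => simp [blockHamiltonian]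
  | succ N ih =>
    have e1 : m * 2 ^ (N + 1) = (2 * m) * 2 ^ N := by ring
    have e2 : (2 * m) * 2 ^ N + 2 ^ N = (2 * m + 1) * 2 ^ N := by ring
    have e3 : (2 * m) * 2 ^ N + 2 ^ (N + 1) = (2 * m + 1) * 2 ^ N + 2 ^ N := by ring
    have htop : ∀ i ∈ Finset.Ioc (m * 2 ^ (N + 1)) (m * 2 ^ (N + 1) + 2 ^ (N + 1)),
        ∀ j ∈ Finset.Ioc (m * 2 ^ (N + 1)) (m * 2 ^ (N + 1) + 2 ^ (N + 1)),
        (if (i - 1) / 2 ^ (N + 1) = (j - 1) / 2 ^ (N + 1) then J (N + 1, i, j) * σ i * σ j else 0)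
          = J (N + 1, i, j) * σ i * σ j := fun i hi j hj => by
      rw [div_two_pow_eq hi, div_two_pow_eq hj, if_pos rfl]
    rw [Finset.sum_Icc_succ_top (by lia),
      Finset.sum_congr rfl fun i hi => Finset.sum_congr rfl fun j hj => htop i hi j hj, neg_add,
      ← sub_eq_add_neg, blockHamiltonian]
    congr 1
    rw [e1, ih, e2, ih, ← neg_add, ← Finset.sum_add_distrib]
    congr 1
    refine Finset.sum_congr rfl fun l hl => ?_
    have hl' : l ≤ N := (Finset.mem_Icc.mp hl).2
    have hsplit : ∀ g : ℕ → ℝ, ∑ i ∈ Finset.Ioc (2 * m * 2 ^ N) (2 * m * 2 ^ N + 2 ^ (N + 1)), g i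
        = ∑ i ∈ Finset.Ioc (2 * m * 2 ^ N) ((2 * m + 1) * 2 ^ N), g i
          + ∑ i ∈ Finset.Ioc ((2 * m + 1) * 2 ^ N) ((2 * m + 1) * 2 ^ N + 2 ^ N), g i := fun g => by
      rw [e3, Finset.sum_Ioc_consecutive _ (by lia) (by lia)]
    rw [hsplit]
    -- Sites of different halves are never in the same block of level `l ≤ N`.
    have hne : ∀ i ∈ Finset.Ioc (2 * m * 2 ^ N) ((2 * m + 1) * 2 ^ N),
        ∀ j ∈ Finset.Ioc ((2 * m + 1) * 2 ^ N) ((2 * m + 1) * 2 ^ N + 2 ^ N),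
        (i - 1) / 2 ^ l ≠ (j - 1) / 2 ^ l := fun i hi j hj h => by
      rw [← e2] at hi
      have := div_two_pow_mono hl' h
      rw [div_two_pow_eq hi, div_two_pow_eq hj] at this
      lia
    congr 1
    · refine Finset.sum_congr rfl fun i hi => ?_
      rw [hsplit, Finset.sum_eq_zero (s := Finset.Ioc ((2 * m + 1) * 2 ^ N) _) fun j hj =>
        if_neg (hne i hi j hj), add_zero]
    · refine Finset.sum_congr rfl fun i hi => ?_
      rw [hsplit, Finset.sum_eq_zero (s := Finset.Ioc (2 * m * 2 ^ N) _) fun j hj =>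
        if_neg (hne j hj i hi).symm, zero_add]

lemma hamiltonian_eq (β : ℝ) (J : Disorder) (N : ℕ) (s : Config N) :
    -β * hamiltonian J N s.spin = energy (edgeChar N) (fun e => β * J e.1) s := by
  have h0 := blockHamiltonian_eq J s.spin N 0
  rw [zero_mul, zero_add] at h0
  rw [hamiltonian, h0, neg_mul_neg, energy, Finset.mul_sum]
  have h1 : ∀ e : Edge N, β * J e.1 * ev (edgeChar N e) s
      = (fun e : ℕ × ℕ × ℕ => β * (J e * s.spin e.2.1 * s.spin e.2.2)) e.1 := fun ⟨⟨l, i, j⟩, he⟩ => by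
    rw [mem_edgeSet] at he
    simp only [edgeChar]
    rw [ev_mul_apply, ev_spinChar (by simpa using he.2.1), ev_spinChar (by simpa using he.2.2.1)]
    ring
  simp only [h1]
  rw [Finset.sum_coe_sort (edgeSet N) (fun e => β * (J e * s.spin e.2.1 * s.spin e.2.2)), edgeSet,
    Finset.sum_filter, Finset.sum_product]
  simp only [Finset.sum_product, Finset.mul_sum, mul_ite, mul_zero]

lemma thermalAverage_eq (β : ℝ) (N : ℕ) (J : Disorder) (F : (ℕ → ℝ) → ℝ) :
    thermalAverage β N J F
      = gibbs (energy (edgeChar N) fun e => β * J e.1) fun s => F s.spin := by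
  simp only [thermalAverage, gibbs, hamiltonian_eq]

lemma b_pos (α : ℝ) (N : ℕ) : 0 < b α N := Real.rpow_pos_of_pos two_pos _

lemma coe_levelSnr (α β : ℝ) (l : ℕ) : (levelSnr α β l : ℝ) = β ^ 2 * (b α l / 2 ^ (2 * l)) :=
  Real.coe_toNNReal _ (by have := b_pos α l; positivity)

/-- Multiplication by `β` equates the mean and the variance of the couplings. -/
lemma measurePreserving_disorderLaw (α β : ℝ) (N : ℕ) :
    MeasurePreserving (fun (J : Disorder) (e : Edge N) => β * J e.1) (disorderLaw α β)
      (nishimoriLaw (edgeSnr α β N)) := by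
  refine ⟨by fun_prop, ?_⟩
  have h1 : (fun (J : Disorder) (e : Edge N) => β * J e.1)
      = (fun (h : Edge N → ℝ) e => β * h e) ∘ fun J e => J e.1 := rfl
  rw [h1, ← Measure.map_map (by fun_prop) (by fun_prop), disorderLaw]
  have h2 := Measure.map_infinitePi_infinitePi_of_inj
    (Subtype.val_injective : Function.Injective (Subtype.val : Edge N → _))
    (P := fun e : ℕ × ℕ × ℕ => gaussianReal (β * b α e.1 / 2 ^ (2 * e.1))
      (Real.toNNReal (b α e.1 / 2 ^ (2 * e.1))))
  rw [h2, Measure.infinitePi_eq_pi]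
  refine (gaussianPi_map (m := fun e : Edge N => β * b α e.1.1 / 2 ^ (2 * e.1.1))
    (v := fun e => Real.toNNReal (b α e.1.1 / 2 ^ (2 * e.1.1)))
    (fun _ x => β * x) (fun _ => by fun_prop) fun e => ?_).map_eq
  rw [gaussianReal_map_const_mul]
  have hb := b_pos α e.1.1
  congr 1
  · rw [edgeSnr, coe_levelSnr]; ring
  · ext
    rw [edgeSnr, coe_levelSnr, NNReal.coe_mul, Real.coe_toNNReal _ (by positivity)]
    rfl

lemma quenchedAverage_eq (α β : ℝ) (N : ℕ) (F : (ℕ → ℝ) → ℝ) :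
    quenchedAverage α β N F
      = ∫ h, gibbs (energy (edgeChar N) h) (fun s => F s.spin) ∂nishimoriLaw (edgeSnr α β N) := by
  simp only [quenchedAverage, thermalAverage_eq]
  exact (integral_of_measurePreserving (measurePreserving_disorderLaw α β N)
    (measurable_gibbs_energy (χ := edgeChar N) fun s => F s.spin)).symm

lemma quenchedAverage_mul (α β : ℝ) {N i j : ℕ} (hi : i ∈ Finset.Ioc 0 (2 ^ N))
    (hj : j ∈ Finset.Ioc 0 (2 ^ N)) : quenchedAverage α β N (fun σ => σ i * σ j) = corr α β N i j := by
  rw [quenchedAverage_eq, corr, avg]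
  simp only [← ev_spinChar hi, ← ev_spinChar hj, ← ev_mul_apply]

/-- `2 ^ (2 p) f_N(p)` for the block of `2 ^ p` sites following the site `a`. -/
noncomputable def blockSum (α β : ℝ) (N p a : ℕ) : ℝ :=
  ∑ i ∈ Finset.Ioc a (a + 2 ^ p), ∑ j ∈ Finset.Ioc a (a + 2 ^ p), corr α β N i j

lemma quenchedAverage_blockSpin_sq (α β : ℝ) {N p r : ℕ} (hp : p ≤ N) (hr : 1 ≤ r)
    (hr' : r ≤ 2 ^ (N - p)) :
    quenchedAverage α β N (fun σ => blockSpin p r σ ^ 2)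
      = blockSum α β N p ((r - 1) * 2 ^ p) := by
  have e1 : r * 2 ^ p = (r - 1) * 2 ^ p + 2 ^ p := by
    obtain ⟨k, rfl⟩ := Nat.exists_eq_add_of_le' hr
    simp [add_mul]
  have hsub : ∀ i ∈ Finset.Ioc ((r - 1) * 2 ^ p) ((r - 1) * 2 ^ p + 2 ^ p),
      i ∈ Finset.Ioc 0 (2 ^ N) := fun i hi => by
    have h1 : r * 2 ^ p ≤ 2 ^ (N - p) * 2 ^ p := Nat.mul_le_mul_right _ hr'
    rw [← pow_add, Nat.sub_add_cancel hp] at h1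
    rw [Finset.mem_Ioc] at hi ⊢
    lia
  rw [quenchedAverage_eq, blockSum]
  have h2 : ∀ h, gibbs (energy (edgeChar N) h) (fun s => blockSpin p r s.spin ^ 2)
      = ∑ i ∈ Finset.Ioc ((r - 1) * 2 ^ p) ((r - 1) * 2 ^ p + 2 ^ p),
        ∑ j ∈ Finset.Ioc ((r - 1) * 2 ^ p) ((r - 1) * 2 ^ p + 2 ^ p),
          gibbs (energy (edgeChar N) h) (ev (spinChar N i * spinChar N j)) := fun h => by
    simp_rw [← gibbs_sum]
    congr 1
    ext s
    rw [blockSpin, e1, sq, Finset.sum_mul_sum]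
    refine Finset.sum_congr rfl fun i hi => Finset.sum_congr rfl fun j hj => ?_
    rw [ev_mul_apply, ev_spinChar (hsub i hi), ev_spinChar (hsub j hj)]
  have hint : ∀ i j, Integrable (fun h => gibbs (energy (edgeChar N) h)
      (ev (spinChar N i * spinChar N j))) (nishimoriLaw (edgeSnr α β N)) := fun i j =>
    (expBounded_gibbs _ _).integrable _ _
  simp_rw [h2]
  rw [integral_finsetSum _ fun i _ => integrable_finsetSum _ fun j _ => hint i j]
  refine Finset.sum_congr rfl fun i _ => ?_
  rw [integral_finsetSum _ fun j _ => hint i j]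
  rfl

/-! ### Comparison of correlations -/

/-- A map of sites gives a homomorphism of configurations, by composition. -/
def relabel {N M : ℕ} {g : ℕ → ℕ} (hg : ∀ i ∈ Finset.Ioc 0 (2 ^ N), g i ∈ Finset.Ioc 0 (2 ^ M)) :
    Config M →* Config N where
  toFun s i := s ⟨g i, hg i i.2⟩
  map_one' := rfl
  map_mul' _ _ := rfl

lemma relabel_surjective {N M : ℕ} {g : ℕ → ℕ}
    (hg : ∀ i ∈ Finset.Ioc 0 (2 ^ N), g i ∈ Finset.Ioc 0 (2 ^ M)) (hinj : Function.Injective g) :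
    Function.Surjective (relabel hg : Config M →* Config N) := by
  have h : Function.Injective fun i : Site N => (⟨g i, hg i i.2⟩ : Site M) := fun i j hij =>
    Subtype.ext (hinj (congrArg Subtype.val hij))
  exact h.surjective_comp_right

lemma spinChar_relabel {N M : ℕ} {g : ℕ → ℕ}
    (hg : ∀ i ∈ Finset.Ioc 0 (2 ^ N), g i ∈ Finset.Ioc 0 (2 ^ M)) {i : ℕ}
    (hi : i ∈ Finset.Ioc 0 (2 ^ N)) (s : Config M) :
    spinChar N i (relabel hg s) = spinChar M (g i) s := by
  rw [spinChar_apply hi, spinChar_apply (hg i hi)]; rfl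

/-- A map of sites that preserves the blocks does not decrease correlations. -/
lemma corr_le_corr (α β : ℝ) {N M : ℕ} (hNM : N ≤ M) {g : ℕ → ℕ} (hinj : Function.Injective g)
    (hg : ∀ i ∈ Finset.Ioc 0 (2 ^ N), g i ∈ Finset.Ioc 0 (2 ^ M))
    (hblock : ∀ l i j, 0 < i → 0 < j → (i - 1) / 2 ^ l = (j - 1) / 2 ^ l →
      (g i - 1) / 2 ^ l = (g j - 1) / 2 ^ l) {i j : ℕ}
    (hi : i ∈ Finset.Ioc 0 (2 ^ N)) (hj : j ∈ Finset.Ioc 0 (2 ^ N)) :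
    corr α β N i j ≤ corr α β M (g i) (g j) := by
  have hmem : ∀ e : Edge N, (e.1.1, g e.1.2.1, g e.1.2.2) ∈ edgeSet M := fun ⟨⟨l, i, j⟩, he⟩ => by
    rw [mem_edgeSet] at he ⊢
    have h1 := hg i (by simpa using he.2.1)
    have h2 := hg j (by simpa using he.2.2.1)
    rw [Finset.mem_Ioc] at h1 h2
    exact ⟨⟨he.1.1, he.1.2.trans hNM⟩, h1, h2, hblock l i j he.2.1.1 he.2.2.1.1 he.2.2.2⟩
  have key := avg_le_avg (χ := edgeChar M) (τ := edgeSnr α β M) (χ' := edgeChar N)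
    (τ' := edgeSnr α β N) (φ := fun e => ⟨_, hmem e⟩) (fun e e' h => by
      have h : (e.1.1, g e.1.2.1, g e.1.2.2) = (e'.1.1, g e'.1.2.1, g e'.1.2.2) :=
        congrArg Subtype.val h
      simp only [Prod.mk.injEq] at h
      exact Subtype.ext (Prod.ext h.1 (Prod.ext (hinj h.2.1) (hinj h.2.2))))
    (relabel_surjective hg hinj) (fun ⟨⟨l, i, j⟩, he⟩ s => by
      rw [mem_edgeSet] at he
      simp only [edgeChar, MonoidHom.mul_apply]
      rw [spinChar_relabel hg (by simpa using he.2.1), spinChar_relabel hg (by simpa using he.2.2.1)])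
    (fun e => le_rfl) (spinChar N i * spinChar N j)
  have e1 : (spinChar N i * spinChar N j).comp (relabel hg) = spinChar M (g i) * spinChar M (g j) := by
    refine MonoidHom.ext fun s => ?_
    simp only [MonoidHom.comp_apply, MonoidHom.mul_apply, spinChar_relabel hg hi,
      spinChar_relabel hg hj]
  rw [e1] at key
  exact key

/-- Correlations increase with the system. -/
lemma corr_succ_le (α β : ℝ) {N i j : ℕ} (hi : i ∈ Finset.Ioc 0 (2 ^ N))
    (hj : j ∈ Finset.Ioc 0 (2 ^ N)) : corr α β N i j ≤ corr α β (N + 1) i j :=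
  corr_le_corr α β (Nat.le_succ N) (g := id) Function.injective_id (fun i hi => by
    rw [Finset.mem_Ioc] at hi ⊢
    exact ⟨hi.1, hi.2.trans (Nat.pow_le_pow_right two_pos (Nat.le_succ N))⟩)
    (fun _ _ _ _ _ h => h) hi hj

lemma corr_comm (α β : ℝ) (N i j : ℕ) : corr α β N i j = corr α β N j i := by
  rw [corr, mul_comm, corr]

lemma mem_block_iff {p m i : ℕ} : i ∈ Finset.Ioc (m * 2 ^ p) (m * 2 ^ p + 2 ^ p) ↔
    0 < i ∧ (i - 1) / 2 ^ p = m := by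
  refine ⟨fun h => ⟨by rw [Finset.mem_Ioc] at h; lia, div_two_pow_eq h⟩, fun ⟨h0, h⟩ => ?_⟩
  rw [Nat.div_eq_iff (Nat.two_pow_pos p), add_comm] at h
  rw [Finset.mem_Ioc]
  have := Nat.two_pow_pos p
  lia

/-- Exchanging the halves of the blocks of the levels given by the binary digits of `c`. The label
`0`, which is not a site, is fixed, so that this is an involution of `ℕ`. -/
def flip (c i : ℕ) : ℕ := if i = 0 then 0 else ((i - 1) ^^^ c) + 1

lemma flip_of_pos (c : ℕ) {i : ℕ} (hi : 0 < i) : flip c i = ((i - 1) ^^^ c) + 1 := if_neg hi.ne'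

lemma flip_flip (c i : ℕ) : flip c (flip c i) = i := by
  rcases Nat.eq_zero_or_pos i with rfl | hi
  · rfl
  · rw [flip_of_pos c hi, flip_of_pos c (Nat.succ_pos _), Nat.succ_sub_one, Nat.xor_assoc,
      Nat.xor_self, Nat.xor_zero, Nat.sub_add_cancel hi]

lemma flip_mem {N c i : ℕ} (hc : c < 2 ^ N) (hi : i ∈ Finset.Ioc 0 (2 ^ N)) :
    flip c i ∈ Finset.Ioc 0 (2 ^ N) := by
  rw [Finset.mem_Ioc] at hi ⊢
  rw [flip_of_pos c hi.1]
  exact ⟨Nat.succ_pos _, Nat.xor_lt_two_pow (by lia) hc⟩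

lemma flip_div (c l : ℕ) {i : ℕ} (hi : 0 < i) :
    (flip c i - 1) / 2 ^ l = (i - 1) / 2 ^ l ^^^ c / 2 ^ l := by
  rw [flip_of_pos c hi, Nat.add_sub_cancel, Nat.xor_div_two_pow]

lemma corr_flip (α β : ℝ) {N c i j : ℕ} (hc : c < 2 ^ N) (hi : i ∈ Finset.Ioc 0 (2 ^ N))
    (hj : j ∈ Finset.Ioc 0 (2 ^ N)) : corr α β N (flip c i) (flip c j) = corr α β N i j := by
  have key : ∀ {i j}, i ∈ Finset.Ioc 0 (2 ^ N) → j ∈ Finset.Ioc 0 (2 ^ N) →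
      corr α β N i j ≤ corr α β N (flip c i) (flip c j) := fun hi hj =>
    corr_le_corr α β le_rfl (Function.LeftInverse.injective (flip_flip c))
      (fun i hi => flip_mem hc hi)
      (fun l i j hi hj h => by rw [flip_div c l hi, flip_div c l hj, h]) hi hj
  refine le_antisymm ?_ (key hi hj)
  have := key (flip_mem hc hi) (flip_mem hc hj)
  rwa [flip_flip, flip_flip] at this

/-- All blocks of the same size have the same order parameter. -/
lemma blockSum_eq (α β : ℝ) {N p m : ℕ} (hm : m * 2 ^ p + 2 ^ p ≤ 2 ^ N) :
    blockSum α β N p (m * 2 ^ p) = blockSum α β N p 0 := by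
  have hp := Nat.two_pow_pos p
  have hmaps : ∀ k, ∀ i ∈ Finset.Ioc (k * 2 ^ p) (k * 2 ^ p + 2 ^ p),
      flip (m * 2 ^ p) i ∈ Finset.Ioc ((k ^^^ m) * 2 ^ p) ((k ^^^ m) * 2 ^ p + 2 ^ p) :=
    fun k i hi => by
      rw [mem_block_iff] at hi ⊢
      refine ⟨?_, by rw [flip_div _ _ hi.1, hi.2, Nat.mul_div_cancel _ hp]⟩
      rw [flip_of_pos _ hi.1]; exact Nat.succ_pos _
  have h1 : ∀ i ∈ Finset.Ioc (m * 2 ^ p) (m * 2 ^ p + 2 ^ p),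
      flip (m * 2 ^ p) i ∈ Finset.Ioc 0 (0 + 2 ^ p) := fun i hi => by
    have := hmaps m i hi
    rwa [Nat.xor_self, zero_mul] at this
  have h2 : ∀ i ∈ Finset.Ioc 0 (0 + 2 ^ p),
      flip (m * 2 ^ p) i ∈ Finset.Ioc (m * 2 ^ p) (m * 2 ^ p + 2 ^ p) := fun i hi => by
    have := hmaps 0 i (by rwa [zero_mul])
    rwa [Nat.zero_xor] at this
  have hN : ∀ i ∈ Finset.Ioc (m * 2 ^ p) (m * 2 ^ p + 2 ^ p), i ∈ Finset.Ioc 0 (2 ^ N) :=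
    fun i hi => by rw [Finset.mem_Ioc] at hi ⊢; lia
  refine Finset.sum_nbij' (flip (m * 2 ^ p)) (flip (m * 2 ^ p)) h1 h2
    (fun i _ => flip_flip _ i) (fun i _ => flip_flip _ i) fun i hi => ?_
  refine Finset.sum_nbij' (flip (m * 2 ^ p)) (flip (m * 2 ^ p)) h1 h2
    (fun i _ => flip_flip _ i) (fun i _ => flip_flip _ i) fun j hj => ?_
  exact (corr_flip α β (by lia) (hN i hi) (hN j hj)).symm

lemma blockOrder_eq (α β : ℝ) {N p r : ℕ} (hp : p ≤ N) (hr : 1 ≤ r) (hr' : r ≤ 2 ^ (N - p)) :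
    blockOrder α β N p r = 1 / 2 ^ (2 * p) * blockSum α β N p 0 := by
  rw [blockOrder, quenchedAverage_blockSpin_sq α β hp hr hr', blockSum_eq]
  have h1 : r * 2 ^ p ≤ 2 ^ (N - p) * 2 ^ p := Nat.mul_le_mul_right _ hr'
  rw [← pow_add, Nat.sub_add_cancel hp] at h1
  obtain ⟨k, rfl⟩ := Nat.exists_eq_add_of_le' hr
  rw [add_mul, one_mul] at h1
  simpa using h1

lemma f_eq (α β : ℝ) {N p : ℕ} (hp : p ≤ N) :
    f α β N p = 1 / 2 ^ (2 * p) * blockSum α β N p 0 :=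
  blockOrder_eq α β hp le_rfl Nat.one_le_two_pow

lemma sum_Ioc_two_pow_succ (p : ℕ) (g : ℕ → ℝ) : ∑ i ∈ Finset.Ioc 0 (0 + 2 ^ (p + 1)), g i
    = ∑ i ∈ Finset.Ioc 0 (0 + 2 ^ p), g i + ∑ i ∈ Finset.Ioc (1 * 2 ^ p) (1 * 2 ^ p + 2 ^ p), g i := by
  rw [zero_add, zero_add, one_mul, Finset.sum_Ioc_consecutive _ (by lia) (by lia)]
  congr 2
  ring

lemma blockSum_succ (α β : ℝ) {N p : ℕ} (hp : p + 1 ≤ N) :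
    blockSum α β N (p + 1) 0 = 2 * blockSum α β N p 0 + 2 * ∑ i ∈ Finset.Ioc 0 (2 ^ p),
      ∑ j ∈ Finset.Ioc 0 (2 ^ p), corr α β N i (j + 2 ^ p) := by
  have h2 : 1 * 2 ^ p + 2 ^ p ≤ 2 ^ N := by
    have := Nat.pow_le_pow_right two_pos hp
    rw [pow_succ] at this
    lia
  have h3 : ∀ i, ∑ j ∈ Finset.Ioc 0 (2 ^ p), corr α β N i (j + 2 ^ p)
      = ∑ j ∈ Finset.Ioc (1 * 2 ^ p) (1 * 2 ^ p + 2 ^ p), corr α β N i j := fun i => by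
    rw [one_mul, ← zero_add (2 ^ p), add_right_comm, ← Finset.map_add_right_Ioc, Finset.sum_map]
    simp
  have h4 := blockSum_eq α β h2
  have h5 : ∑ i ∈ Finset.Ioc (1 * 2 ^ p) (1 * 2 ^ p + 2 ^ p), ∑ j ∈ Finset.Ioc 0 (0 + 2 ^ p),
      corr α β N i j = ∑ i ∈ Finset.Ioc 0 (2 ^ p), ∑ j ∈ Finset.Ioc (1 * 2 ^ p) (1 * 2 ^ p + 2 ^ p),
      corr α β N i j := by
    rw [Finset.sum_comm, zero_add]
    exact Finset.sum_congr rfl fun i _ => Finset.sum_congr rfl fun j _ => corr_comm α β N j i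
  rw [blockSum, sum_Ioc_two_pow_succ]
  simp only [sum_Ioc_two_pow_succ, Finset.sum_add_distrib, h3]
  rw [h5]
  rw [blockSum] at h4
  simp only [blockSum] at h4 ⊢
  rw [h4]
  simp only [zero_add]
  ring

/-- The order of a block increases with the system around it. -/
lemma blockSum_le_succ (α β : ℝ) {N p : ℕ} (hp : p ≤ N) :
    blockSum α β N p 0 ≤ blockSum α β (N + 1) p 0 := by
  have h : ∀ i ∈ Finset.Ioc 0 (0 + 2 ^ p), i ∈ Finset.Ioc 0 (2 ^ N) := fun i hi => by
    have := Nat.pow_le_pow_right two_pos hp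
    rw [Finset.mem_Ioc] at hi ⊢
    lia
  exact Finset.sum_le_sum fun i hi => Finset.sum_le_sum fun j hj => corr_succ_le α β (h i hi) (h j hj)

lemma blockSum_nonneg (α β : ℝ) (N p a : ℕ) : 0 ≤ blockSum α β N p a :=
  Finset.sum_nonneg fun _ _ => Finset.sum_nonneg fun _ _ => avg_nonneg _ _ _

lemma blockSum_le (α β : ℝ) (N p a : ℕ) : blockSum α β N p a ≤ 2 ^ (2 * p) := by
  calc blockSum α β N p a ≤ ∑ i ∈ Finset.Ioc a (a + 2 ^ p), ∑ j ∈ Finset.Ioc a (a + 2 ^ p), (1 : ℝ) :=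
        Finset.sum_le_sum fun _ _ => Finset.sum_le_sum fun _ _ => avg_le_one _ _ _
    _ = 2 ^ (2 * p) := by simp [two_mul, pow_add]

end Hierarchical

/-! ### Doubling in the hierarchical model -/

section HierarchicalDoubling

open DysonNishimori

lemma corr_le_avg_blockChar (α β : ℝ) (p i j : ℕ) :
    corr α β p i j ≤ avg (blockChar (edgeChar p) fun v : Site p => spinChar p v)
      (blockSnr (edgeSnr α β p) 0) (spinChar p i * spinChar p j) :=
  avg_le_avg (χ := blockChar (edgeChar p) fun v : Site p => spinChar p v)
    (τ := blockSnr (edgeSnr α β p) 0) (χ' := edgeChar p) (τ' := edgeSnr α β p) (π := MonoidHom.id _)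
    Sum.inl_injective Function.surjective_id (fun _ _ => rfl)
    (fun _ => le_rfl) (spinChar p i * spinChar p j)

/-- The labels in the model with `2 ^ (p + 1)` sites of the couplings within and between its two
halves. The couplings of level `p + 1` within a half have signal-to-noise ratio `0` in the systems
compared below, and the two couplings between a pair of sites correspond to its two orderings. -/
def pairLabel (p : ℕ) : ((Edge p ⊕ (Site p × Site p)) ⊕ (Edge p ⊕ (Site p × Site p)))
    ⊕ ((Site p × Site p) ⊕ (Site p × Site p)) → ℕ × ℕ × ℕ :=
  Sum.elim
    (Sum.elim
      (Sum.elim (fun e => e.1) fun q => (p + 1, q.1, q.2))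
      (Sum.elim (fun e => (e.1.1, e.1.2.1 + 2 ^ p, e.1.2.2 + 2 ^ p))
        fun q => (p + 1, q.1 + 2 ^ p, q.2 + 2 ^ p)))
    (Sum.elim (fun q => (p + 1, q.1, q.2 + 2 ^ p)) fun q => (p + 1, q.2 + 2 ^ p, q.1))

lemma site_bounds {p : ℕ} (v : Site p) : 0 < v.1 ∧ v.1 ≤ 2 ^ p := Finset.mem_Ioc.mp v.2

lemma edge_bounds {p : ℕ} (e : Edge p) : 1 ≤ e.1.1 ∧ e.1.1 ≤ p ∧ 0 < e.1.2.1 ∧ e.1.2.1 ≤ 2 ^ p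
    ∧ 0 < e.1.2.2 ∧ e.1.2.2 ≤ 2 ^ p ∧ (e.1.2.1 - 1) / 2 ^ e.1.1 = (e.1.2.2 - 1) / 2 ^ e.1.1 := by
  obtain ⟨⟨l, i, j⟩, he⟩ := e
  have := mem_edgeSet.mp he
  tauto

lemma pairLabel_injective (p : ℕ) : Function.Injective (pairLabel p) := by
  rintro (((e | ⟨i, j⟩) | (e | ⟨i, j⟩)) | (⟨i, j⟩ | ⟨i, j⟩))
    (((e' | ⟨i', j'⟩) | (e' | ⟨i', j'⟩)) | (⟨i', j'⟩ | ⟨i', j'⟩)) h <;>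
    simp only [pairLabel, Sum.elim_inl, Sum.elim_inr, Sum.inl.injEq, Sum.inr.injEq,
      Subtype.ext_iff, Prod.ext_iff, reduceCtorEq] at h ⊢ <;>
    (try have := edge_bounds e) <;> (try have := edge_bounds e') <;>
    (try have := site_bounds i) <;> (try have := site_bounds j) <;>
    (try have := site_bounds i') <;> (try have := site_bounds j') <;>
    omega

lemma pairLabel_mem (p : ℕ) (e) : pairLabel p e ∈ edgeSet (p + 1) := by
  have hp := Nat.two_pow_pos p
  have hpow : 2 ^ (p + 1) = 2 ^ p + 2 ^ p := by ring
  have htop : ∀ i j, 0 < i → i ≤ 2 ^ p + 2 ^ p → 0 < j → j ≤ 2 ^ p + 2 ^ p →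
      (p + 1, i, j) ∈ edgeSet (p + 1) := fun i j h0 hi h0' hj => by
    rw [mem_edgeSet, Nat.div_eq_of_lt (by omega), Nat.div_eq_of_lt (by omega)]
    omega
  rcases e with ((e | ⟨i, j⟩) | (e | ⟨i, j⟩)) | (⟨i, j⟩ | ⟨i, j⟩) <;>
    simp only [pairLabel, Sum.elim_inl, Sum.elim_inr] <;>
    (try have hi := site_bounds i) <;> (try have hj := site_bounds j)
  · obtain ⟨h1, h2, h3, h4, h5, h6, h7⟩ := edge_bounds e
    exact (mem_edgeSet (l := e.1.1) (i := e.1.2.1) (j := e.1.2.2)).mpr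
      ⟨by omega, by omega, by omega, h7⟩
  · exact htop _ _ (by omega) (by omega) (by omega) (by omega)
  · obtain ⟨h1, h2, h3, h4, h5, h6, h7⟩ := edge_bounds e
    refine mem_edgeSet.mpr ⟨by omega, by omega, by omega, ?_⟩
    obtain ⟨d, hd⟩ := Nat.exists_eq_add_of_le h2
    have e1 : ∀ i, 0 < i → (i + 2 ^ p - 1) / 2 ^ e.1.1 = (i - 1) / 2 ^ e.1.1 + 2 ^ d := fun i hi => by
      have e2 : 2 ^ e.1.1 * 2 ^ d = 2 ^ p := by rw [← pow_add, ← hd]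
      rw [show i + 2 ^ p - 1 = i - 1 + 2 ^ e.1.1 * 2 ^ d by omega,
        Nat.add_mul_div_left _ _ (Nat.two_pow_pos _)]
    rw [e1 _ h3, e1 _ h5, h7]
  all_goals exact htop _ _ (by omega) (by omega) (by omega) (by omega)

lemma left_mem {p i : ℕ} (hi : i ∈ Finset.Ioc 0 (2 ^ p)) : i ∈ Finset.Ioc 0 (2 ^ (p + 1)) := by
  rw [pow_succ]; rw [Finset.mem_Ioc] at *; lia

lemma right_mem {p i : ℕ} (hi : i ∈ Finset.Ioc 0 (2 ^ p)) :
    i + 2 ^ p ∈ Finset.Ioc 0 (2 ^ (p + 1)) := by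
  rw [pow_succ]; rw [Finset.mem_Ioc] at *; lia

/-- The two halves of a configuration. -/
def halves (p : ℕ) : Config (p + 1) →* Config p × Config p :=
  (relabel (g := id) fun _ => left_mem).prod (relabel (g := (· + 2 ^ p)) fun _ => right_mem)

lemma halves_surjective (p : ℕ) : Function.Surjective (halves p) := by
  rintro ⟨x, y⟩
  refine ⟨fun i => if h : i.1 ≤ 2 ^ p then x ⟨i.1, Finset.mem_Ioc.mpr ⟨(site_bounds i).1, h⟩⟩
    else y ⟨i.1 - 2 ^ p, Finset.mem_Ioc.mpr (by have := site_bounds i; omega)⟩, ?_⟩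
  refine Prod.ext (funext fun ⟨i, hi⟩ => ?_) (funext fun ⟨i, hi⟩ => ?_)
  · exact dif_pos (Finset.mem_Ioc.mp hi).2
  · rw [Finset.mem_Ioc] at hi
    refine (dif_neg (by simp; omega)).trans ?_
    simp

lemma spinChar_halves_fst {p i : ℕ} (hi : i ∈ Finset.Ioc 0 (2 ^ p)) (s : Config (p + 1)) :
    spinChar p i (halves p s).1 = spinChar (p + 1) i s := spinChar_relabel _ hi s

lemma spinChar_halves_snd {p i : ℕ} (hi : i ∈ Finset.Ioc 0 (2 ^ p)) (s : Config (p + 1)) :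
    spinChar p i (halves p s).2 = spinChar (p + 1) (i + 2 ^ p) s :=
  spinChar_relabel (g := (· + 2 ^ p)) _ hi s

lemma avg_pairChar_le_corr (α β : ℝ) (p : ℕ) (q : Site p × Site p) :
    avg (pairChar (blockChar (edgeChar p) fun v : Site p => spinChar p v)
        fun v : Site p => spinChar p v)
      (pairSnr (blockSnr (edgeSnr α β p) 0) (levelSnr α β (p + 1)))
      (crossChar (fun v : Site p => spinChar p v) q)
      ≤ corr α β (p + 1) q.1 (q.2 + 2 ^ p) := by
  have key := avg_le_avg (χ := edgeChar (p + 1)) (τ := edgeSnr α β (p + 1))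
    (χ' := pairChar (blockChar (edgeChar p) fun v : Site p => spinChar p v)
        fun v : Site p => spinChar p v)
    (τ' := pairSnr (blockSnr (edgeSnr α β p) 0) (levelSnr α β (p + 1)))
    (φ := fun e => ⟨_, pairLabel_mem p e⟩)
    (fun e e' h => pairLabel_injective p (congrArg Subtype.val h)) (halves_surjective p)
    (fun e s => ?_) (fun e => ?_) (crossChar (fun v : Site p => spinChar p v) q)
  · refine key.trans_eq ?_
    rw [corr]
    congr 1
    refine MonoidHom.ext fun s => ?_
    simp only [crossChar, MonoidHom.comp_apply, MonoidHom.mul_apply, MonoidHom.coe_fst,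
      MonoidHom.coe_snd, spinChar_halves_fst q.1.2, spinChar_halves_snd q.2.2]
  · rcases e with ((⟨⟨l, i, j⟩, he⟩ | ⟨⟨i, hi⟩, ⟨j, hj⟩⟩) | (⟨⟨l, i, j⟩, he⟩ | ⟨⟨i, hi⟩, ⟨j, hj⟩⟩)) |
      (⟨⟨i, hi⟩, ⟨j, hj⟩⟩ | ⟨⟨i, hi⟩, ⟨j, hj⟩⟩)
    · rw [mem_edgeSet] at he
      have hi : i ∈ Finset.Ioc 0 (2 ^ p) := by simpa using he.2.1
      have hj : j ∈ Finset.Ioc 0 (2 ^ p) := by simpa using he.2.2.1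
      simp only [pairLabel, pairChar, blockChar, edgeChar, Sum.elim_inl, MonoidHom.mul_apply,
        MonoidHom.comp_apply, MonoidHom.coe_fst, spinChar_halves_fst hi, spinChar_halves_fst hj]
    · simp only [pairLabel, pairChar, blockChar, edgeChar, Sum.elim_inl, Sum.elim_inr,
        MonoidHom.mul_apply, MonoidHom.comp_apply, MonoidHom.coe_fst, spinChar_halves_fst hi,
        spinChar_halves_fst hj]
    · rw [mem_edgeSet] at he
      have hi : i ∈ Finset.Ioc 0 (2 ^ p) := by simpa using he.2.1
      have hj : j ∈ Finset.Ioc 0 (2 ^ p) := by simpa using he.2.2.1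
      simp only [pairLabel, pairChar, blockChar, edgeChar, Sum.elim_inl, Sum.elim_inr,
        MonoidHom.mul_apply, MonoidHom.comp_apply, MonoidHom.coe_snd, spinChar_halves_snd hi,
        spinChar_halves_snd hj]
    · simp only [pairLabel, pairChar, blockChar, edgeChar, Sum.elim_inl, Sum.elim_inr,
        MonoidHom.mul_apply, MonoidHom.comp_apply, MonoidHom.coe_snd, spinChar_halves_snd hi,
        spinChar_halves_snd hj]
    · simp only [pairLabel, pairChar, crossChar, edgeChar, Sum.elim_inl, Sum.elim_inr,
        MonoidHom.mul_apply, MonoidHom.comp_apply, MonoidHom.coe_fst, MonoidHom.coe_snd,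
        spinChar_halves_fst hi, spinChar_halves_snd hj]
    · simp only [pairLabel, pairChar, crossChar, edgeChar, Sum.elim_inr,
        MonoidHom.mul_apply, MonoidHom.comp_apply, MonoidHom.coe_fst, MonoidHom.coe_snd,
        spinChar_halves_fst hi, spinChar_halves_snd hj]
      exact mul_comm _ _
  · rcases e with ((e | e) | (e | e)) | (e | e)
    · exact le_rfl
    · exact zero_le
    · exact le_rfl
    · exact zero_le
    · exact le_rfl
    · exact le_rfl

lemma sum_site_prod (p : ℕ) (g : ℕ → ℕ → ℝ) : ∑ q : Site p × Site p, g q.1 q.2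
    = ∑ i ∈ Finset.Ioc 0 (2 ^ p), ∑ j ∈ Finset.Ioc 0 (2 ^ p), g i j := by
  rw [Fintype.sum_prod_type, ← Finset.sum_coe_sort (Finset.Ioc 0 (2 ^ p))]
  refine Finset.sum_congr rfl fun i _ => ?_
  rw [← Finset.sum_coe_sort (Finset.Ioc 0 (2 ^ p))]

/-- The spins of the two halves of a block of level `p + 1` are almost as correlated as the spins of
the isolated half. -/
theorem blockSum_doubling (α β : ℝ) (p : ℕ) {ι : Type*} [Fintype ι] [DecidableEq ι]
    (bin : Config p → ι) {c : ℝ}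
    (hc : ∀ σ σ', bin σ = bin σ' → levelSnr α β (p + 1)
      * (totalSpin (fun v : Site p => spinChar p v) σ
        - totalSpin (fun v : Site p => spinChar p v) σ') ^ 2 ≤ c)
    {t : ℝ} (ht : 0 < t) :
    levelSnr α β (p + 1) * blockSum α β p p 0
      ≤ levelSnr α β (p + 1) * ∑ i ∈ Finset.Ioc 0 (2 ^ p), ∑ j ∈ Finset.Ioc 0 (2 ^ p),
          corr α β (p + 1) i (j + 2 ^ p)
        + (c + Real.log (Fintype.card ι) + t⁻¹ * (Real.log (Fintype.card ι) + 2 * t ^ 2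
          * (∑ e, (edgeSnr α β p e : ℝ) + 2 ^ (2 * p) * levelSnr α β (p + 1)))) := by
  have h1 := sum_avg_block_le (edgeChar p) (fun v : Site p => spinChar p v) (edgeSnr α β p)
    (levelSnr α β (p + 1)) bin hc ht
  have h2 : ∑ e, (blockSnr (V := Site p) (edgeSnr α β p) (levelSnr α β (p + 1)) e : ℝ)
      = ∑ e, (edgeSnr α β p e : ℝ) + 2 ^ (2 * p) * levelSnr α β (p + 1) := by
    rw [Fintype.sum_sum_type]
    simp [blockSnr, two_mul, pow_add]
  rw [h2] at h1
  refine le_trans ?_ (h1.trans ?_)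
  · refine mul_le_mul_of_nonneg_left ?_ (NNReal.coe_nonneg _)
    rw [blockSum, zero_add, ← sum_site_prod]
    exact Finset.sum_le_sum fun q _ => corr_le_avg_blockChar α β p _ _
  · gcongr
    rw [← sum_site_prod p fun i j => corr α β (p + 1) i (j + 2 ^ p)]
    exact Finset.sum_le_sum fun q _ => avg_pairChar_le_corr α β p q

end HierarchicalDoubling

/-! ### The loss of order in one doubling -/

section Loss

open DysonNishimori

/-- A partition of `[-n, n]` into `M` intervals of the same length. The last interval is closed,
whence the minimum with `M - 1`. -/
lemma exists_bin {Ω : Type*} (X : Ω → ℝ) {n : ℝ} (hn : 0 < n) (hX : ∀ σ, |X σ| ≤ n) {M : ℕ}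
    (hM : 0 < M) : ∃ bin : Ω → Fin M, ∀ σ σ', bin σ = bin σ' → |X σ - X σ'| ≤ 2 * n / M := by
  have hM' : (0 : ℝ) < M := by exact_mod_cast hM
  set u : Ω → ℝ := fun σ => (X σ + n) * M / (2 * n) with hu
  have hu0 : ∀ σ, 0 ≤ u σ := fun σ => by
    have := neg_le_of_abs_le (hX σ)
    have : 0 ≤ X σ + n := by linarith
    positivity
  have huM : ∀ σ, u σ ≤ M := fun σ => by
    have := le_of_abs_le (hX σ)
    rw [hu, div_le_iff₀ (by positivity)]
    nlinarith
  refine ⟨fun σ => ⟨min ⌊u σ⌋₊ (M - 1), by lia⟩, fun σ σ' h => ?_⟩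
  have hb : ∀ σ, ((min ⌊u σ⌋₊ (M - 1) : ℕ) : ℝ) ≤ u σ ∧ u σ ≤ (min ⌊u σ⌋₊ (M - 1) : ℕ) + 1 := by
    intro σ
    refine ⟨(Nat.cast_le.mpr (min_le_left _ _)).trans (Nat.floor_le (hu0 σ)), ?_⟩
    rcases min_cases ⌊u σ⌋₊ (M - 1) with h | h
    · rw [h.1]; exact (Nat.lt_floor_add_one _).le
    · rw [h.1, ← Nat.cast_add_one, Nat.sub_add_cancel hM]; exact huM σ
  have h1 := hb σ
  have h2 := hb σ'
  rw [show min ⌊u σ⌋₊ (M - 1) = min ⌊u σ'⌋₊ (M - 1) from congrArg Fin.val h] at h1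
  have h3 : |u σ - u σ'| ≤ 1 := by rw [abs_le]; constructor <;> linarith
  have h4 : X σ - X σ' = (u σ - u σ') * (2 * n / M) := by simp only [hu]; field_simp; ring
  rw [h4, abs_mul, abs_of_pos (show 0 < 2 * n / M by positivity)]
  exact mul_le_of_le_one_left (by positivity) h3

lemma abs_totalSpin_le (p : ℕ) (σ : Config p) :
    |totalSpin (fun v : Site p => spinChar p v) σ| ≤ 2 ^ p := by
  refine (Finset.abs_sum_le_sum_abs _ _).trans ?_
  simp [abs_ev]

lemma rpow_two_mul_nat (c : ℝ) (l : ℕ) : (2 : ℝ) ^ (c * l) = ((2 : ℝ) ^ c) ^ l :=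
  Real.rpow_mul_natCast two_pos.le c l

lemma b_div_two_pow (α : ℝ) (l : ℕ) : b α l / 2 ^ l = ((2 : ℝ) ^ (1 - α)) ^ l := by
  rw [b, rpow_two_mul_nat, ← div_pow, show (2 : ℝ) - α = 1 - α + 1 by ring, Real.rpow_add_one two_ne_zero,
    mul_div_assoc, div_self two_ne_zero, mul_one]

lemma sum_b_div_le {α : ℝ} (hα : 1 < α) (k : ℕ) : ∑ l ∈ Finset.Icc 1 k, b α l / 2 ^ l ≤ R α := by
  set x : ℝ := (2 : ℝ) ^ (1 - α) with hx
  have hx0 : 0 < x := Real.rpow_pos_of_pos two_pos _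
  have hx1 : x < 1 := Real.rpow_lt_one_of_one_lt_of_neg one_lt_two (by linarith)
  have hxα : x * (2 : ℝ) ^ α = 2 := by
    rw [hx, ← Real.rpow_add two_pos, sub_add_cancel, Real.rpow_one]
  have h1 : ∑ l ∈ Finset.Icc 1 k, b α l / 2 ^ l = x * ∑ l ∈ Finset.range k, x ^ l := by
    rw [Finset.mul_sum, Finset.range_eq_Ico, ← Finset.Ico_add_one_right_eq_Icc,
      Finset.sum_Ico_eq_sum_range, Finset.sum_Ico_eq_sum_range]
    refine Finset.sum_congr (by simp) fun l _ => ?_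
    rw [b_div_two_pow, pow_add, pow_one, zero_add]
  have h2 : ∑ l ∈ Finset.range k, x ^ l ≤ (1 - x)⁻¹ :=
    (Summable.sum_le_tsum _ (fun _ _ => by positivity) (summable_geometric_of_lt_one hx0.le hx1)).trans_eq
      (tsum_geometric_of_lt_one hx0.le hx1)
  have h3 : R α = x * (1 - x)⁻¹ := by
    have ha : (2 : ℝ) ^ α = 2 / x := by field_simp; linarith
    have : 1 - x ≠ 0 := by linarith
    rw [R, ha]
    field_simp
  rw [h1, h3]
  gcongr

/-- Bound on the signal-to-noise ratios of the couplings of `2 ^ p` sites, together with couplings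
of level `p + 1` between all pairs of them. -/
lemma sum_edgeSnr_le {α : ℝ} (hα : 1 < α) (β : ℝ) (p : ℕ) :
    2 * (∑ e, (edgeSnr α β p e : ℝ) + 2 ^ (2 * p) * levelSnr α β (p + 1))
      ≤ β ^ 2 * 2 ^ (p + 1) * R α := by
  have h1 : ∑ e, (edgeSnr α β p e : ℝ) ≤ β ^ 2 * 2 ^ p * ∑ l ∈ Finset.Icc 1 p, b α l / 2 ^ l := by
    have e1 : ∑ e, (edgeSnr α β p e : ℝ) = ∑ e ∈ edgeSet p, (levelSnr α β e.1 : ℝ) :=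
      Finset.sum_coe_sort (edgeSet p) fun e => (levelSnr α β e.1 : ℝ)
    rw [e1, edgeSet, Finset.sum_filter, Finset.sum_product, Finset.mul_sum]
    refine Finset.sum_le_sum fun l _ => ?_
    rw [Finset.sum_product]
    have e2 : ∀ i ∈ Finset.Ioc 0 (2 ^ p), ∑ j ∈ Finset.Ioc 0 (2 ^ p),
        (if (i - 1) / 2 ^ l = (j - 1) / 2 ^ l then (levelSnr α β l : ℝ) else 0)
          ≤ 2 ^ l * levelSnr α β l := fun i _ => by
      rw [← Finset.sum_filter, Finset.sum_const, nsmul_eq_mul]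
      gcongr
      have hcard : ((Finset.Ioc 0 (2 ^ p)).filter fun j => (i - 1) / 2 ^ l = (j - 1) / 2 ^ l).card
          ≤ (Finset.Ioc ((i - 1) / 2 ^ l * 2 ^ l) ((i - 1) / 2 ^ l * 2 ^ l + 2 ^ l)).card := by
        refine Finset.card_le_card fun j hj => ?_
        rw [Finset.mem_filter, Finset.mem_Ioc] at hj
        exact mem_block_iff.mpr ⟨hj.1.1, hj.2.symm⟩
      rw [Nat.card_Ioc, Nat.add_sub_cancel_left] at hcard
      exact_mod_cast hcard
    refine (Finset.sum_le_sum e2).trans_eq ?_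
    rw [Finset.sum_const, Nat.card_Ioc, coe_levelSnr, nsmul_eq_mul, two_mul l, pow_add]
    field_simp
    simp
    ring
  have h2 : (2 : ℝ) ^ (2 * p) * levelSnr α β (p + 1)
      ≤ β ^ 2 * 2 ^ p * (b α (p + 1) / 2 ^ (p + 1)) := by
    rw [coe_levelSnr]
    have hb := b_pos α (p + 1)
    have : β ^ 2 * 2 ^ p * (b α (p + 1) / 2 ^ (p + 1))
      = 2 * ((2 : ℝ) ^ (2 * p) * (β ^ 2 * (b α (p + 1) / 2 ^ (2 * (p + 1))))) := by
      rw [two_mul (p + 1), two_mul p]; simp only [pow_add]; field_simp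
    rw [this]
    have : 0 ≤ (2 : ℝ) ^ (2 * p) * (β ^ 2 * (b α (p + 1) / 2 ^ (2 * (p + 1)))) := by positivity
    linarith
  have h3 := sum_b_div_le hα (p + 1)
  rw [Finset.sum_Icc_succ_top (by lia)] at h3
  calc _ ≤ 2 * (β ^ 2 * 2 ^ p * (∑ l ∈ Finset.Icc 1 p, b α l / 2 ^ l + b α (p + 1) / 2 ^ (p + 1))) := by
        linarith
    _ ≤ 2 * (β ^ 2 * 2 ^ p * R α) := by gcongr
    _ = _ := by ring

lemma R_pos {α : ℝ} (hα : 1 < α) : 0 < R α := by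
  have : (2 : ℝ) ^ (1 : ℝ) < (2 : ℝ) ^ α := Real.rpow_lt_rpow_of_exponent_lt one_lt_two hα
  rw [Real.rpow_one] at this
  exact div_pos two_pos (by linarith)

/-- A bound on the loss of order when a block of `2 ^ (k - 1)` sites is doubled. The first term
comes from the number of bins for the total spin, the second one from the fluctuation of the free
energy of a bin. -/
noncomputable def loss (α β : ℝ) (k : ℕ) : ℝ :=
  ((2 : ℝ) ^ (α - 2)) ^ k * (2 * (1 + Real.log β) + ((2 - α) * k + 2) * Real.log 2) / β ^ 2
    + ((2 : ℝ) ^ (α - 3 / 2)) ^ k * √(R α) * (((2 - α) * k + 2) * Real.log 2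
      + 2 * Real.log (β + β * √(2 * Real.pi * Real.exp 1))) / β

/-- The constant `√(2 π e)` only enters through `e ≤ 1 + √(2 π e)`. -/
lemma one_add_log_le {β : ℝ} (hβ : 0 < β) :
    1 + Real.log β ≤ Real.log (β + β * √(2 * Real.pi * Real.exp 1)) := by
  have h1 : Real.exp 1 ≤ 1 + √(2 * Real.pi * Real.exp 1) := by
    have h2 := Real.exp_one_lt_d9
    have h3 := Real.exp_one_gt_d9
    have h4 := Real.pi_gt_three
    have : 2 ≤ √(2 * Real.pi * Real.exp 1) := Real.le_sqrt_of_sq_le (by nlinarith)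
    linarith
  rw [show β + β * √(2 * Real.pi * Real.exp 1) = (1 + √(2 * Real.pi * Real.exp 1)) * β by ring,
    Real.log_mul (by positivity) hβ.ne']
  have := Real.log_le_log (Real.exp_pos 1) h1
  rw [Real.log_exp] at this
  linarith

lemma one_le_mul_sqrt_b {α β : ℝ} (hα : α < 2) (hβ : (2 : ℝ) ^ ((α - 2) / 2) ≤ β) {k : ℕ}
    (hk : 1 ≤ k) : 1 ≤ β * √(b α k) := by
  have h1 : √(b α k) = (2 : ℝ) ^ ((2 - α) * k / 2) := by
    rw [b, Real.sqrt_eq_rpow, ← Real.rpow_mul two_pos.le]; congr 1; ring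
  have hk' : (1 : ℝ) ≤ k := by exact_mod_cast hk
  calc (1 : ℝ) = (2 : ℝ) ^ ((α - 2) / 2) * (2 : ℝ) ^ ((2 - α) / 2) := by
        rw [← Real.rpow_add two_pos]; ring_nf; simp
    _ ≤ β * √(b α k) := by
        rw [h1]
        have h0 : (0 : ℝ) < (2 : ℝ) ^ ((α - 2) / 2) := Real.rpow_pos_of_pos two_pos _
        exact mul_le_mul hβ (Real.rpow_le_rpow_of_exponent_le one_le_two (by nlinarith))
          (Real.rpow_nonneg two_pos.le _) (h0.le.trans hβ)

/-- **Doubling a block** of the hierarchical model costs at most `loss` in the order parameter. -/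
lemma blockSum_step {α β : ℝ} (hα : 1 < α) (hα' : α < 2) (hβ : (2 : ℝ) ^ ((α - 2) / 2) ≤ β) (p : ℕ) :
    1 / 2 ^ (2 * p) * blockSum α β p p 0 - loss α β (p + 1)
      ≤ 1 / 2 ^ (2 * (p + 1)) * blockSum α β (p + 1) (p + 1) 0 := by
  have hβ0 : 0 < β := (Real.rpow_pos_of_pos two_pos _).trans_le hβ
  have hb := b_pos α (p + 1)
  have hR := R_pos hα
  set k := p + 1 with hk
  set X := β * √(b α k) with hX
  have hX1 : 1 ≤ X := one_le_mul_sqrt_b hα' hβ (Nat.succ_pos p)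
  have hXsq : X ^ 2 = β ^ 2 * b α k := by rw [hX, mul_pow, Real.sq_sqrt hb.le]
  -- With this number of bins, spins in the same bin satisfy the hypothesis of
  -- `blockSum_doubling` with `c = 1`.
  set M := ⌈X⌉₊ with hM
  have hM0 : 0 < M := Nat.ceil_pos.mpr (by linarith)
  have hMX : X ≤ M := Nat.le_ceil X
  have hM2 : (M : ℝ) ≤ 2 * X := by
    have := Nat.ceil_lt_add_one (show 0 ≤ X by linarith)
    linarith
  have hM0' : (0 : ℝ) < M := by exact_mod_cast hM0
  obtain ⟨bin, hbin⟩ := exists_bin (totalSpin (fun v : Site p => spinChar p v))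
    (n := 2 ^ p) (by positivity) (abs_totalSpin_le p) hM0
  -- A bound on the variance of the free energies; the choice `t = V ^ (-1 / 2)` balances the
  -- fluctuation terms.
  set V := β ^ 2 * 2 ^ k * R α with hV
  have hV0 : 0 < V := by positivity
  have hT0 : (0 : ℝ) < levelSnr α β k := by rw [coe_levelSnr]; positivity
  have h4 : (2 : ℝ) ^ (2 * k) = 4 * 2 ^ (2 * p) := by rw [hk, mul_add, pow_add]; norm_num; ring
  have key := blockSum_doubling α β p bin (c := 1) (fun σ σ' h => by
    have h1 := hbin σ σ' h
    have h2 : (totalSpin (fun v : Site p => spinChar p v) σ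
        - totalSpin (fun v : Site p => spinChar p v) σ') ^ 2 ≤ (2 * 2 ^ p / M) ^ 2 := by
      rw [← sq_abs]; gcongr
    calc _ ≤ (levelSnr α β k : ℝ) * (2 * 2 ^ p / M) ^ 2 := by gcongr
      _ = X ^ 2 / M ^ 2 := by
          rw [coe_levelSnr, hXsq, h4, div_pow, mul_pow, ← pow_mul, mul_comm p 2]
          field_simp
          ring
      _ ≤ 1 := by rw [div_le_one (by positivity)]; gcongr) (t := (√V)⁻¹) (by positivity)
  rw [Fintype.card_fin] at key
  set C := ∑ i ∈ Finset.Ioc 0 (2 ^ p), ∑ j ∈ Finset.Ioc 0 (2 ^ p), corr α β (p + 1) i (j + 2 ^ p)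
    with hC
  -- The logarithm of the number of bins.
  set L := Real.log 2 + Real.log β + (2 - α) * k / 2 * Real.log 2 with hL
  have hlogM : Real.log M ≤ L := by
    refine (Real.log_le_log hM0' hM2).trans_eq ?_
    rw [hX, Real.log_mul two_ne_zero (by positivity), Real.log_mul hβ0.ne' (by positivity),
      Real.log_sqrt hb.le, b, Real.log_rpow two_pos, hL]
    ring
  have herr : 1 + Real.log M + ((√V)⁻¹)⁻¹ * (Real.log M + 2 * (√V)⁻¹ ^ 2
      * (∑ e, (edgeSnr α β p e : ℝ) + 2 ^ (2 * p) * levelSnr α β k)) ≤ 1 + L + √V * (L + 1) := by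
    have h1 : 2 * (√V)⁻¹ ^ 2 * (∑ e, (edgeSnr α β p e : ℝ) + 2 ^ (2 * p) * levelSnr α β k) ≤ 1 := by
      rw [inv_pow, Real.sq_sqrt hV0.le]
      have := sum_edgeSnr_le hα β p
      calc _ = V⁻¹ * (2 * (∑ e, (edgeSnr α β p e : ℝ) + 2 ^ (2 * p) * levelSnr α β k)) := by ring
        _ ≤ V⁻¹ * V := by gcongr
        _ = 1 := inv_mul_cancel₀ hV0.ne'
    rw [inv_inv]
    gcongr
  have hcross : blockSum α β p p 0 - (1 + L + √V * (L + 1)) / levelSnr α β k ≤ C := by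
    rw [sub_le_iff_le_add, ← sub_le_iff_le_add', le_div_iff₀ hT0]
    linarith
  have hsucc := blockSum_succ α β (le_refl (p + 1))
  have hmono := blockSum_le_succ α β (le_refl p)
  have hloss : 2 * ((1 + L + √V * (L + 1)) / levelSnr α β k) / 2 ^ (2 * k) ≤ loss α β k := by
    have hx : ((2 : ℝ) ^ (α - 2)) ^ k = (b α k)⁻¹ := by
      rw [b, ← rpow_two_mul_nat, ← Real.rpow_neg two_pos.le]; congr 1; ring
    have hy : ((2 : ℝ) ^ (α - 3 / 2)) ^ k = √(2 ^ k) * (b α k)⁻¹ := by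
      rw [← hx, Real.sqrt_eq_rpow, ← Real.rpow_natCast_mul two_pos.le, ← rpow_two_mul_nat,
        ← rpow_two_mul_nat, ← Real.rpow_add two_pos]
      congr 1; ring
    have hsV : √V = β * √(2 ^ k) * √(R α) := by
      rw [hV, Real.sqrt_mul (by positivity), Real.sqrt_mul (by positivity), Real.sqrt_sq hβ0.le]
    have h1 := one_add_log_le hβ0
    calc 2 * ((1 + L + √V * (L + 1)) / levelSnr α β k) / 2 ^ (2 * k)
        = (b α k)⁻¹ * (2 * (1 + L)) / β ^ 2
          + √(2 ^ k) * (b α k)⁻¹ * √(R α) * (2 * (L + 1)) / β := by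
          rw [coe_levelSnr, hsV]; field_simp
      _ ≤ loss α β k := by
          rw [loss, hx, hy]
          refine add_le_add (le_of_eq ?_) ?_
          · rw [hL]; ring
          · gcongr
            rw [hL]; linarith
  have h6 : 1 / 2 ^ (2 * k) * (4 * blockSum α β p p 0
        - 2 * ((1 + L + √V * (L + 1)) / levelSnr α β k)) ≤ 1 / 2 ^ (2 * k) * blockSum α β k k 0 := by
    gcongr
    rw [hsucc]
    linarith
  refine le_trans ?_ h6
  have h7 : 1 / 2 ^ (2 * k) * (4 * blockSum α β p p 0) = 1 / 2 ^ (2 * p) * blockSum α β p p 0 := by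
    rw [h4]; field_simp
  rw [mul_sub, h7]
  have h8 : 1 / 2 ^ (2 * k) * (2 * ((1 + L + √V * (L + 1)) / levelSnr α β k))
      = 2 * ((1 + L + √V * (L + 1)) / levelSnr α β k) / 2 ^ (2 * k) := by ring
  rw [h8]
  linarith

end Loss

/-! ### The limits defining the order parameter -/

section Limits

open DysonNishimori

lemma f_le_succ (α β : ℝ) {N p : ℕ} (hp : p ≤ N) : f α β N p ≤ f α β (N + 1) p := by
  rw [f_eq α β hp, f_eq α β (hp.trans (Nat.le_succ N))]
  have := blockSum_le_succ α β hp
  gcongr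

lemma f_nonneg (α β : ℝ) {N p : ℕ} (hp : p ≤ N) : 0 ≤ f α β N p := by
  rw [f_eq α β hp]
  have := blockSum_nonneg α β N p 0
  positivity

lemma f_le_one (α β : ℝ) {N p : ℕ} (hp : p ≤ N) : f α β N p ≤ 1 := by
  rw [f_eq α β hp, one_div, inv_mul_le_one₀ (by positivity)]
  exact blockSum_le α β N p 0

lemma integrable_gibbs (N : ℕ) (α β : ℝ) (F : Config N → ℝ) :
    Integrable (fun h => gibbs (energy (edgeChar N) h) F) (nishimoriLaw (edgeSnr α β N)) := by
  refine .of_bound (C := ∑ s, |F s|) (measurable_gibbs_energy (χ := edgeChar N) F).aestronglyMeasurable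
    (ae_of_all _ fun h => ?_)
  exact abs_gibbs_le _ fun s => Finset.single_le_sum (f := fun s => |F s|)
    (fun _ _ => abs_nonneg _) (Finset.mem_univ s)

/-- Passing to larger blocks decreases the order: `(S₁ + S₂)² ≤ 2 S₁² + 2 S₂²` for the spins of the
two halves, which have the same law. -/
lemma f_succ_le (α β : ℝ) {N p : ℕ} (hp : p + 1 ≤ N) : f α β N (p + 1) ≤ f α β N p := by
  have hN : 2 ≤ 2 ^ (N - p) := by
    calc 2 = 2 ^ 1 := rfl
      _ ≤ 2 ^ (N - p) := Nat.pow_le_pow_right two_pos (by lia)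
  have h1 := quenchedAverage_blockSpin_sq α β (p := p) (r := 1) (by lia : p ≤ N) le_rfl (by lia)
  have h2 := quenchedAverage_blockSpin_sq α β (p := p) (r := 2) (by lia : p ≤ N) (by lia) hN
  have h3 := quenchedAverage_blockSpin_sq α β (p := p + 1) (r := 1) hp le_rfl Nat.one_le_two_pow
  have e2 : blockSum α β N p ((2 - 1) * 2 ^ p) = blockSum α β N p 0 := by
    refine blockSum_eq α β ?_
    have : 2 ^ p * 2 ≤ 2 ^ p * 2 ^ (N - p) := Nat.mul_le_mul_left _ hN
    rw [← pow_add, Nat.add_sub_cancel' (by lia)] at this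
    lia
  rw [e2] at h2
  simp only [Nat.sub_self, zero_mul] at h1 h3
  rw [f_eq α β hp, f_eq α β (by lia : p ≤ N), ← h3]
  have hspin : ∀ σ, blockSpin (p + 1) 1 σ = blockSpin p 1 σ + blockSpin p 2 σ := fun σ => by
    simp only [blockSpin]
    rw [show 2 - 1 = 1 from rfl, Nat.sub_self, zero_mul, zero_mul,
      Finset.sum_Ioc_consecutive _ (by lia) (by lia)]
    congr 2
    ring
  have key : quenchedAverage α β N (fun σ => blockSpin (p + 1) 1 σ ^ 2)
      ≤ 2 * blockSum α β N p 0 + 2 * blockSum α β N p 0 := by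
    nth_rewrite 1 [← h1]
    rw [← h2]
    simp only [quenchedAverage_eq]
    rw [← integral_const_mul, ← integral_const_mul,
      ← integral_add ((integrable_gibbs N α β _).const_mul 2) ((integrable_gibbs N α β _).const_mul 2)]
    refine integral_mono (integrable_gibbs N α β _)
      (((integrable_gibbs N α β _).const_mul 2).add ((integrable_gibbs N α β _).const_mul 2)) fun h => ?_
    dsimp only
    rw [← gibbs_const_mul, ← gibbs_const_mul, ← gibbs_add]
    refine gibbs_mono _ fun s => ?_
    rw [hspin]
    nlinarith [sq_nonneg (blockSpin p 1 s.spin - blockSpin p 2 s.spin)]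
  calc _ ≤ 1 / 2 ^ (2 * (p + 1)) * (2 * blockSum α β N p 0 + 2 * blockSum α β N p 0) := by gcongr
    _ = _ := by rw [mul_add 2 p 1, pow_add]; field_simp; ring

lemma tendsto_f (α β : ℝ) (p : ℕ) : Tendsto (fun N => f α β N p) atTop (𝓝 (fLim α β p)) := by
  have hmono : Monotone fun n => f α β (n + p) p := monotone_nat_of_le_succ fun n => by
    rw [add_right_comm]
    exact f_le_succ α β (Nat.le_add_left p n)
  have h := tendsto_atTop_ciSup hmono
    ⟨1, by rintro _ ⟨n, rfl⟩; exact f_le_one α β (Nat.le_add_left p n)⟩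
  have h' := (tendsto_add_atTop_iff_nat (f := fun N => f α β N p) p).mp h
  rwa [fLim, h'.limUnder_eq]

lemma f_le_fLim (α β : ℝ) {N p : ℕ} (hp : p ≤ N) : f α β N p ≤ fLim α β p := by
  refine ge_of_tendsto (tendsto_f α β p) (eventually_ge_atTop N |>.mono fun M hM => ?_)
  induction M, hM using Nat.le_induction with
  | base => exact le_rfl
  | succ M hM ih => exact ih.trans (f_le_succ α β (hp.trans hM))

lemma fLim_mem (α β : ℝ) (p : ℕ) : 0 ≤ fLim α β p ∧ fLim α β p ≤ 1 :=
  ⟨ge_of_tendsto (tendsto_f α β p) ((eventually_ge_atTop p).mono fun _ h => f_nonneg α β h),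
    le_of_tendsto (tendsto_f α β p) ((eventually_ge_atTop p).mono fun _ h => f_le_one α β h)⟩

lemma fLim_antitone (α β : ℝ) : Antitone (fLim α β) := antitone_nat_of_succ_le fun p =>
  le_of_tendsto_of_tendsto (tendsto_f α β (p + 1)) (tendsto_f α β p)
    ((eventually_ge_atTop (p + 1)).mono fun _ h => f_succ_le α β h)

lemma tendsto_fLim (α β : ℝ) : Tendsto (fLim α β) atTop (𝓝 (mSq α β)) := by
  have h := tendsto_atTop_ciInf (fLim_antitone α β)
    ⟨0, by rintro _ ⟨n, rfl⟩; exact (fLim_mem α β n).1⟩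
  rwa [mSq, h.limUnder_eq]

lemma mSq_le_one (α β : ℝ) : mSq α β ≤ 1 :=
  le_of_tendsto' (tendsto_fLim α β) fun p => (fLim_mem α β p).2

lemma corr_self (α β : ℝ) (N i : ℕ) : corr α β N i i = 1 := by
  have h : ∀ h, gibbs (energy (edgeChar N) h) (ev (spinChar N i * spinChar N i)) = 1 := fun h => by
    have : ev (spinChar N i * spinChar N i) = fun _ => 1 := by
      ext s; rw [ev_mul_apply, ev_mul_self]
    rw [this, gibbs_const]
  simp [corr, avg, h]

lemma f_one_one (α β : ℝ) :
    f α β 1 1 = 1 / 2 + 1 / 2 * quenchedAverage α β 1 fun σ => σ 1 * σ 2 := by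
  rw [f_eq α β le_rfl, blockSum_succ α β le_rfl, quenchedAverage_mul α β (by simp) (by simp), blockSum]
  have h1 : Finset.Ioc 0 (0 + 2 ^ 0) = {1} := rfl
  have h2 : Finset.Ioc 0 (2 ^ 0) = {1} := rfl
  rw [h1, h2]
  simp only [Finset.sum_singleton, corr_self]
  norm_num
  ring

/-- Doubling an isolated pair of sites `n` times. -/
lemma f_diag_ge {α β : ℝ} (hα : 1 < α) (hα' : α < 2) (hβ : (2 : ℝ) ^ ((α - 2) / 2) ≤ β) (n : ℕ) :
    f α β 1 1 - ∑ k ∈ Finset.range n, loss α β (k + 2) ≤ f α β (n + 1) (n + 1) := by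
  induction n with
  | zero => simp
  | succ n ih =>
    have := blockSum_step hα hα' hβ (n + 1)
    rw [← f_eq α β le_rfl, ← f_eq α β le_rfl] at this
    rw [Finset.sum_range_succ]
    linarith

lemma le_mSq {α β : ℝ} (hα : 1 < α) (hα' : α < 2) (hβ : (2 : ℝ) ^ ((α - 2) / 2) ≤ β) {S : ℝ}
    (hS : HasSum (fun k => loss α β (k + 2)) S) : f α β 1 1 - S ≤ mSq α β :=
  le_of_tendsto_of_tendsto' (tendsto_const_nhds.sub hS.tendsto_sum_nat)
    ((tendsto_add_atTop_iff_nat 1).mpr (tendsto_fLim α β)) fun n =>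
      (f_diag_ge hα hα' hβ n).trans (f_le_fLim α β le_rfl)

end Limits

/-! ### The explicit bound and the zero-temperature limit -/

/-- The average of a coupled character is at least that of a single spin in the field `h` of law
`N(τ, τ)`, where `1 - tanh h ≤ exp (-h)` and `𝔼 exp (-h) = exp (-τ / 2)`. -/
lemma one_sub_exp_le_avg {Ω E : Type*} [CommGroup Ω] [Fintype Ω] [Fintype E] (χ : E → Ω →* ℤˣ)
    (τ : E → ℝ≥0) (e : E) (hsurj : Function.Surjective (χ e)) :
    1 - Real.exp (-(τ e / 2)) ≤ avg χ τ (χ e) := by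
  have h1 := avg_le_avg (χ := χ) (τ := τ) (χ' := fun _ : Unit => MonoidHom.id ℤˣ)
    (τ' := fun _ => τ e) (φ := fun _ => e) (fun _ _ _ => rfl) hsurj (fun _ _ => rfl)
    (fun _ => le_rfl) (MonoidHom.id ℤˣ)
  refine le_trans ?_ h1
  have hexp : ∫ h, Real.exp (-h ()) ∂nishimoriLaw (fun _ : Unit => τ e) = Real.exp (-(τ e / 2)) := by
    have hm : MeasurePreserving (fun h : Unit → ℝ => h ()) (nishimoriLaw fun _ : Unit => τ e)
        (gaussianReal (τ e) (τ e)) :=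
      measurePreserving_eval (fun _ : Unit => gaussianReal (τ e : ℝ) (τ e)) ()
    rw [← integral_of_measurePreserving hm (F := fun x => Real.exp (-x)) (by fun_prop)]
    have := congrFun (mgf_fun_id_gaussianReal (μ := (τ e : ℝ)) (v := τ e)) (-1)
    simp only [mgf, neg_mul, one_mul] at this
    rw [this]
    congr 1
    ring
  have hint : Integrable (fun h : Unit → ℝ => Real.exp (-h ())) (nishimoriLaw (fun _ : Unit => τ e)) :=
    (ExpBounded.exp (by fun_prop) 0 1 fun h => by simpa using neg_le_abs (h ())).integrable _ _
  rw [← hexp]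
  have h2 : ∫ h, (1 - Real.exp (-h ())) ∂nishimoriLaw (fun _ : Unit => τ e)
      = 1 - ∫ h, Real.exp (-h ()) ∂nishimoriLaw (fun _ : Unit => τ e) := by
    rw [integral_sub (integrable_const _) hint]; simp
  rw [← h2]
  refine integral_mono ((integrable_const _).sub hint) ((expBounded_gibbs _ _).integrable _ _) 
    fun h => ?_
  have h3 : gibbs (energy (fun _ : Unit => MonoidHom.id ℤˣ) h) (ev (MonoidHom.id ℤˣ))
      = (Real.exp (h ()) - Real.exp (-h ())) / (Real.exp (h ()) + Real.exp (-h ())) := by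
    have hu : (Finset.univ : Finset ℤˣ) = {1, -1} := rfl
    simp [gibbs, energy, ev, hu, sub_eq_add_neg]
  simp only [h3]
  have hp := Real.exp_pos (h ())
  have hn := Real.exp_pos (-h ())
  have hpn : Real.exp (h ()) * Real.exp (-h ()) = 1 := by rw [← Real.exp_add]; simp
  rw [le_div_iff₀ (by positivity)]
  nlinarith [sq_nonneg (Real.exp (-h ()) - 1)]

section Bound

open DysonNishimori

/-- The correlation of the two spins of the smallest model. -/
lemma one_sub_exp_le_quenchedAverage (α β : ℝ) :
    1 - Real.exp (-(β ^ 2 * (b α 1 / 4) / 2)) ≤ quenchedAverage α β 1 fun σ => σ 1 * σ 2 := by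
  have he : ((1, 1, 2) : ℕ × ℕ × ℕ) ∈ edgeSet 1 := by decide
  have h1 : (1 : ℕ) ∈ Finset.Ioc 0 (2 ^ 1) := by decide
  have h2 : (2 : ℕ) ∈ Finset.Ioc 0 (2 ^ 1) := by decide
  have h := one_sub_exp_le_avg (edgeChar 1) (edgeSnr α β 1) ⟨_, he⟩ (fun u => ⟨fun i =>
    if i.1 = 1 then u else 1, by
      simp [edgeChar, spinChar_apply h1, spinChar_apply h2]⟩)
  rw [quenchedAverage_mul α β h1 h2]
  simp only [edgeSnr, coe_levelSnr] at h
  norm_num at h ⊢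
  exact h

/-- The lower bound for `m²`. -/
noncomputable def lowerBound (α β : ℝ) : ℝ :=
  1 / 2 + 1 / 2 * quenchedAverage α β 1 (fun σ => σ 1 * σ 2)
    - (2 : ℝ) ^ (2 * α - 1) / (β ^ 2 * (4 - (2 : ℝ) ^ α)) * (1 + Real.log β)
    - (4 : ℝ) ^ (-1 + α) * ((2 : ℝ) ^ α * (-4 + α) - 8 * (-3 + α)) * Real.log 2
        / (β ^ 2 * (4 - (2 : ℝ) ^ α) ^ 2)
    - (2 : ℝ) ^ (2 * α - 3 / 2)
        * ((2 : ℝ) ^ α * (-4 + α) - (2 : ℝ) ^ (5 / 2 : ℝ) * (-3 + α))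
        * Real.sqrt (R α) * Real.log 2
        / (β * ((2 : ℝ) ^ (3 / 2 : ℝ) - (2 : ℝ) ^ α) ^ 2)
    - (4 : ℝ) ^ α * Real.sqrt (R α)
        * Real.log (β + β * Real.sqrt (2 * Real.pi * Real.exp 1))
        / (β * (4 - (2 : ℝ) ^ (α + 1 / 2)))

lemma hasSum_pow_mul_add {x : ℝ} (hx0 : 0 ≤ x) (hx1 : x < 1) (A B : ℝ) :
    HasSum (fun k : ℕ => x ^ (k + 2) * (A + B * ((k + 2 : ℕ) : ℝ)))
      (x ^ 2 / (1 - x) * A + x ^ 2 * (2 - x) / (1 - x) ^ 2 * B) := by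
  have h1 := (hasSum_geometric_of_lt_one hx0 hx1).mul_left (x ^ 2 * (A + 2 * B))
  have h2 := (hasSum_coe_mul_geometric_of_norm_lt_one
    (r := x) (by rwa [Real.norm_of_nonneg hx0])).mul_left (x ^ 2 * B)
  have hx : 1 - x ≠ 0 := by linarith
  have e1 : x ^ 2 / (1 - x) * A + x ^ 2 * (2 - x) / (1 - x) ^ 2 * B
      = x ^ 2 * (A + 2 * B) * (1 - x)⁻¹ + x ^ 2 * B * (x / (1 - x) ^ 2) := by
    field_simp
    ring
  rw [e1]
  refine (congrArg (HasSum · _) (funext fun k => ?_)).mpr (h1.add h2)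
  push_cast
  ring

/-- The losses add up to the terms subtracted in the lower bound. They start with `k = 2`, the order
`f α β 1 1` of a pair of sites being the main term. -/
lemma hasSum_loss {α β : ℝ} (hα : 1 < α) (hα' : α < 3 / 2) (hβ : 0 < β) :
    HasSum (fun k => loss α β (k + 2)) (f α β 1 1 - lowerBound α β) := by
  set a := (2 : ℝ) ^ α with ha
  set c := (2 : ℝ) ^ (3 / 2 : ℝ) with hc
  have ha0 : 0 < a := Real.rpow_pos_of_pos two_pos _
  have hc0 : 0 < c := Real.rpow_pos_of_pos two_pos _
  have hac : a < c := Real.rpow_lt_rpow_of_exponent_lt one_lt_two hα'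
  have hcc : c * c = 8 := by rw [hc, ← Real.rpow_add two_pos]; norm_num
  have hc4 : c < 4 := by nlinarith
  have hx : (2 : ℝ) ^ (α - 2) = a / 4 := by rw [Real.rpow_sub two_pos, Real.rpow_two, ← ha]; norm_num
  have hy : (2 : ℝ) ^ (α - 3 / 2) = a / c := by rw [Real.rpow_sub two_pos]
  have h1 := hasSum_pow_mul_add (x := a / 4) (by positivity) (by linarith)
    (2 * (1 + Real.log β) + 2 * Real.log 2) ((2 - α) * Real.log 2)
  have h2 := hasSum_pow_mul_add (x := a / c) (by positivity) ((div_lt_one hc0).mpr hac)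
    (2 * Real.log 2 + 2 * Real.log (β + β * √(2 * Real.pi * Real.exp 1))) ((2 - α) * Real.log 2)
  have h3 := (h1.mul_right (1 / β ^ 2)).add (h2.mul_right (√(R α) / β))
  have e1 : (2 : ℝ) ^ (2 * α - 1) = a ^ 2 / 2 := by
    rw [Real.rpow_sub two_pos, Real.rpow_one, mul_comm, Real.rpow_mul two_pos.le, Real.rpow_two]
  have e2 : (4 : ℝ) ^ α = a ^ 2 := by
    rw [show (4 : ℝ) = 2 * 2 by norm_num, Real.mul_rpow two_pos.le two_pos.le, sq]
  have e3 : (4 : ℝ) ^ (-1 + α) = a ^ 2 / 4 := by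
    rw [add_comm, Real.rpow_add (by norm_num), e2, Real.rpow_neg_one]; ring
  have e4 : (2 : ℝ) ^ (2 * α - 3 / 2) = a ^ 2 / c := by
    rw [Real.rpow_sub two_pos, mul_comm, Real.rpow_mul two_pos.le, Real.rpow_two]
  have e5 : (2 : ℝ) ^ (5 / 2 : ℝ) = 2 * c := by
    rw [show (5 / 2 : ℝ) = 3 / 2 + 1 by norm_num, Real.rpow_add_one two_ne_zero, mul_comm]
  have e6 : 4 - (2 : ℝ) ^ (α + 1 / 2) = c * (c - a) / 2 := by
    have : (2 : ℝ) ^ (1 / 2 : ℝ) = c / 2 := by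
      rw [hc, show (3 / 2 : ℝ) = 1 / 2 + 1 by norm_num, Real.rpow_add_one two_ne_zero]; ring
    rw [Real.rpow_add two_pos, this, ← ha]
    linarith
  have hne1 : 4 - a ≠ 0 := by linarith
  have hne2 : c - a ≠ 0 := by linarith
  have hne3 : 1 - a / 4 ≠ 0 := by linarith
  have hne4 : 1 - a / c = (c - a) / c := by field_simp
  have hne5 : 1 - a / 4 = (4 - a) / 4 := by ring
  have hval : f α β 1 1 - lowerBound α β
      = ((a / 4) ^ 2 / (1 - a / 4) * (2 * (1 + Real.log β) + 2 * Real.log 2)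
        + (a / 4) ^ 2 * (2 - a / 4) / (1 - a / 4) ^ 2 * ((2 - α) * Real.log 2)) * (1 / β ^ 2)
        + ((a / c) ^ 2 / (1 - a / c)
          * (2 * Real.log 2 + 2 * Real.log (β + β * √(2 * Real.pi * Real.exp 1)))
        + (a / c) ^ 2 * (2 - a / c) / (1 - a / c) ^ 2 * ((2 - α) * Real.log 2)) * (√(R α) / β) := by
    rw [f_one_one, lowerBound, e1, e2, e3, e4, e5, e6, ← ha, ← hc, hne4, hne5]
    generalize Real.log (β + β * √(2 * Real.pi * Real.exp 1)) = ℓ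
    generalize √(R α) = ρ
    generalize Real.log β = b
    generalize Real.log 2 = d
    generalize quenchedAverage α β 1 (fun σ => σ 1 * σ 2) = q
    field_simp
    ring
  rw [hval]
  refine (congrArg (HasSum · _) (funext fun k => ?_)).mpr h3
  rw [loss, hx, hy]
  push_cast
  ring

lemma lowerBound_le_mSq {α β : ℝ} (hα : 1 < α) (hα' : α < 3 / 2)
    (hβ : (2 : ℝ) ^ ((α - 2) / 2) ≤ β) : lowerBound α β ≤ mSq α β := by
  have h := le_mSq hα (by linarith) hβ
    (hasSum_loss hα hα' ((Real.rpow_pos_of_pos two_pos _).trans_le hβ))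
  linarith

lemma tendsto_log_div : Tendsto (fun β : ℝ => Real.log β / β) atTop (𝓝 0) :=
  Real.isLittleO_log_id_atTop.tendsto_div_nhds_zero

lemma tendsto_lowerBound (α : ℝ) :
    Tendsto (lowerBound α) atTop (𝓝 1) := by
  have hq : Tendsto (fun β => quenchedAverage α β 1 fun σ => σ 1 * σ 2) atTop (𝓝 1) := by
    have h1 : Tendsto (fun β : ℝ => 1 - Real.exp (-(β ^ 2 * (b α 1 / 4) / 2))) atTop (𝓝 (1 - 0)) := by
      refine tendsto_const_nhds.sub (Real.tendsto_exp_neg_atTop_nhds_zero.comp ?_)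
      have hb := b_pos α 1
      exact ((tendsto_pow_atTop two_ne_zero).atTop_mul_const (by positivity)).atTop_div_const two_pos
    rw [sub_zero] at h1
    refine tendsto_of_tendsto_of_tendsto_of_le_of_le h1 tendsto_const_nhds
      (fun β => one_sub_exp_le_quenchedAverage α β) fun β => ?_
    dsimp only
    rw [quenchedAverage_mul α β (by decide) (by decide)]
    exact avg_le_one _ _ _
  have hinv : Tendsto (fun β : ℝ => β⁻¹) atTop (𝓝 0) := tendsto_inv_atTop_zero
  have hlog := tendsto_log_div
  have hlog' : Tendsto (fun β : ℝ => Real.log (β + β * √(2 * Real.pi * Real.exp 1)) * β⁻¹) atTop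
      (𝓝 0) := by
    have h2 := hlog.add (hinv.const_mul (Real.log (1 + √(2 * Real.pi * Real.exp 1))))
    rw [mul_zero, add_zero] at h2
    refine h2.congr' ((eventually_gt_atTop 0).mono fun β hβ => ?_)
    dsimp only
    rw [show β + β * √(2 * Real.pi * Real.exp 1) = β * (1 + √(2 * Real.pi * Real.exp 1)) by ring,
      Real.log_mul hβ.ne' (by positivity)]
    ring
  have hB : Tendsto (fun β : ℝ => (β⁻¹) * (β⁻¹) + β⁻¹ * (Real.log β / β)) atTop (𝓝 0) := by
    simpa using (hinv.mul hinv).add (hinv.mul hlog)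
  have hsum := (((((hq.const_mul (1 / 2)).const_add (1 / 2)).sub
    (hB.const_mul ((2 : ℝ) ^ (2 * α - 1) / (4 - (2 : ℝ) ^ α)))).sub
    ((hinv.mul hinv).const_mul ((4 : ℝ) ^ (-1 + α) * ((2 : ℝ) ^ α * (-4 + α) - 8 * (-3 + α))
      * Real.log 2 / (4 - (2 : ℝ) ^ α) ^ 2))).sub
    (hinv.const_mul ((2 : ℝ) ^ (2 * α - 3 / 2)
        * ((2 : ℝ) ^ α * (-4 + α) - (2 : ℝ) ^ (5 / 2 : ℝ) * (-3 + α))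
        * Real.sqrt (R α) * Real.log 2 / ((2 : ℝ) ^ (3 / 2 : ℝ) - (2 : ℝ) ^ α) ^ 2))).sub
    (hlog'.const_mul ((4 : ℝ) ^ α * Real.sqrt (R α) / (4 - (2 : ℝ) ^ (α + 1 / 2))))
  have hone : (1 / 2 + 1 / 2 * 1 : ℝ) = 1 := by norm_num
  simp only [mul_zero, sub_zero, hone] at hsum
  refine hsum.congr fun β => ?_
  simp only [lowerBound, div_eq_mul_inv, mul_inv]
  ring

lemma tendsto_mSq {α : ℝ} (hα : 1 < α) (hα' : α < 3 / 2) :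
    Tendsto (mSq α) atTop (𝓝 1) :=
  tendsto_of_tendsto_of_tendsto_of_le_of_le' (tendsto_lowerBound α) tendsto_const_nhds
    ((eventually_ge_atTop _).mono fun _ h => lowerBound_le_mSq hα hα' h)
    (.of_forall fun β => mSq_le_one α β)

end Bound

end NishimoriSpin

theorem theorem1 (α : ℝ) (hα₁ : 1 < α) (hα₂ : α < 3 / 2) :
    (∀ β : ℝ, (2 : ℝ) ^ ((α - 2) / 2) ≤ β →
      -- the order parameter is well defined: `f_N(p)` does not depend on the block,
      -- and both limits in the definition of `m²` exist
      (∀ N p r : ℕ, p ≤ N → 1 ≤ r → r ≤ 2 ^ (N - p) →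
        DysonNishimori.blockOrder α β N p r = DysonNishimori.f α β N p) ∧
      (∀ p : ℕ, Tendsto (fun N => DysonNishimori.f α β N p) atTop
        (𝓝 (DysonNishimori.fLim α β p))) ∧
      Tendsto (fun p => DysonNishimori.fLim α β p) atTop (𝓝 (DysonNishimori.mSq α β)) ∧
      -- the lower bound
      1 / 2 + 1 / 2 * DysonNishimori.quenchedAverage α β 1 (fun σ => σ 1 * σ 2)
        - (2 : ℝ) ^ (2 * α - 1) / (β ^ 2 * (4 - (2 : ℝ) ^ α)) * (1 + Real.log β)
        - (4 : ℝ) ^ (-1 + α) * ((2 : ℝ) ^ α * (-4 + α) - 8 * (-3 + α)) * Real.log 2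
            / (β ^ 2 * (4 - (2 : ℝ) ^ α) ^ 2)
        - (2 : ℝ) ^ (2 * α - 3 / 2)
            * ((2 : ℝ) ^ α * (-4 + α) - (2 : ℝ) ^ (5 / 2 : ℝ) * (-3 + α))
            * Real.sqrt (DysonNishimori.R α) * Real.log 2
            / (β * ((2 : ℝ) ^ (3 / 2 : ℝ) - (2 : ℝ) ^ α) ^ 2)
        - (4 : ℝ) ^ α * Real.sqrt (DysonNishimori.R α)
            * Real.log (β + β * Real.sqrt (2 * Real.pi * Real.exp 1))
            / (β * (4 - (2 : ℝ) ^ (α + 1 / 2)))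
        ≤ DysonNishimori.mSq α β) ∧
    -- long-range order at all sufficiently low temperatures
    (∃ β₀ : ℝ, (2 : ℝ) ^ ((α - 2) / 2) ≤ β₀ ∧
      ∀ β : ℝ, β₀ ≤ β → 0 < DysonNishimori.mSq α β) ∧
    -- the zero-temperature limit
    Tendsto (fun β : ℝ => DysonNishimori.mSq α β) atTop (𝓝 1) := by 
  have hlim := NishimoriSpin.tendsto_mSq hα₁ hα₂
  refine ⟨fun β hβ => ⟨fun N p r hp hr hr' => ?_, fun p => NishimoriSpin.tendsto_f α β p,
    NishimoriSpin.tendsto_fLim α β, NishimoriSpin.lowerBound_le_mSq hα₁ hα₂ hβ⟩, ?_, hlim⟩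
  · rw [NishimoriSpin.blockOrder_eq α β hp hr hr', NishimoriSpin.f_eq α β hp]
  · obtain ⟨β₀, h⟩ := eventually_atTop.mp (hlim.eventually_const_lt one_pos)
    exact ⟨max β₀ _, le_max_right _ _, fun β hβ => h β ((le_max_left _ _).trans hβ)⟩
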